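/- Let $T$ be a first-order theory in a language $L$, and for $A\subseteq M\models T$ let $\operatorname{acl}_L(A)$ be the union of all finite $A$-definable subsets of $M$. Call $T$ geometric if (i) in every model of $T$ algebraic closure satisfies exchange: $a\in\operatorname{acl}_L(Ab)\setminus\operatorname{acl}_L(A)$ implies $b\in\operatorname{acl}_L(Aa)$; and (ii) $T$ eliminates $\exists^\infty$: for every $L$-formula $\varphi(x,\bar z)$ with $x$ a single variable there is $k<\omega$ such that for all $M\models T$ and all $\bar c$ in $M$ the set $\varphi(M,\bar c)$ is infinite or has at most $k$ elements. A theory is $\mathrm{NTP}_2$ if there are no formula $\varphi(\bar x,\bar y)$ (with $\bar x,\bar y$ finite tuples of variables) and array $(\bar a_{\alpha,i})_{\alpha,i<\omega}$ of $\bar y$-tuples in some model of the theory such that $\{\varphi(\bar x,\bar a_{\alpha,i})\}_{i<\omega}$ is $2$-inconsistent for every $\alpha<\omega$ and $\{\varphi(\bar x,\bar a_{\alpha,f(\alpha)})\}_{\alpha<\omega}$ is consistent with the elementary diagram of that model for every $f:\omega\to\omega$. Let $S(x)$ be an $L$-formula in one variable, let $L_P=L\cup\{P(x)\}$ with $P$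 a new unary predicate, and, for $T$ eliminating $\exists^\infty$, let $T_{P,S}$ be the Chatzidakis–Pillay theory of the expansion of $T$ by a generic predicate $P$ inside $S$, that is, the $L_P$-theory axiomatized by $T$, $\forall x\,(P(x)\to S(x))$, and $$\forall\bar z\Big(\Big[\exists\bar x\;\varphi(\bar x,\bar z)\wedge \bar x\cap\operatorname{acl}_L(\bar z)=\emptyset\wedge\bigwedge_{i<n}S(x_i)\wedge\bigwedge_{i\neq j<n}x_i\neq x_j\Big]\to\exists\bar x\;\varphi(\bar x,\bar z)\wedge\bigwedge_{i\in I}P(x_i)\wedge\bigwedge_{i\notin I}\neg P(x_i)\Big)$$ for all $L$-formulas $\varphi(\bar x,\bar z)$, $\bar x=x_0\dots x_{n-1}$, and all $I\subseteq\{0,\dots,n-1\}$. Here the bracket, in which $\bar x$ ranges over tuples from elementary extensions (in $L$) of the model, is replaced by an $L$-formula equivalent to it in all models of $T$; such a formula exists because $T$ eliminates $\exists^\infty$. Theorem. If $T$ is geometric and $\mathrm{NTP}_2$, then $T_{P,S}$ is $\mathrm{NTP}_2$ for every $S$. In particular (taking $S(x)$ to be $x=x$) the expansion $T_P$ of $T$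 by a generic predicate is $\mathrm{NTP}_2$. -/

import Mathlib

universe u v w

namespace FirstOrder.Language

/-! ### Algebraic closure, geometric theories, `NTP₂` -/

section Geometric

/-- The (model-theoretic) algebraic closure of `A ⊆ M`: the union of all finite `A`-definable
subsets of `M`. -/
def acl (L : Language.{u, v}) {M : Type w} [L.Structure M] (A : Set M) : Set M :=
  {b | ∃ s : Set M, A.Definable₁ L s ∧ s.Finite ∧ b ∈ s}

namespace Theory

variable {L : Language.{u, v}} (T : L.Theory)

/-- Algebraic closure satisfies the exchange property in models of `T`. -/
def AclExchange : Prop :=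
  ∀ (M : ModelType.{u, v, max u v} T) (A : Set M) (a b : M),
    a ∈ acl L (insert b A) → a ∉ acl L A → b ∈ acl L (insert a A)

/-- `T` eliminates `∃^∞`: for every formula `φ(z̄, x)` with `x` a single variable there is a bound
`k` such that in every model of `T` every finite set `φ(c̄, M)` has at most `k` elements. -/
def EliminatesExistsInfty : Prop :=
  ∀ (m : ℕ) (φ : L.Formula (Fin m ⊕ Fin 1)), ∃ k : ℕ,
    ∀ (M : ModelType.{u, v, max u v} T) (c : Fin m → M),
      {a : M | φ.Realize (Sum.elim c fun _ => a)}.Finite →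
        {a : M | φ.Realize (Sum.elim c fun _ => a)}.ncard ≤ k

/-- A theory is geometric if algebraic closure satisfies exchange and `∃^∞` is eliminated. -/
structure IsGeometric : Prop where
  exchange : T.AclExchange
  eliminatesExistsInfty : T.EliminatesExistsInfty

/-- The formula `φ(x̄, ȳ)` has `TP₂` modulo `T`: in some model of `T` there is an array
`(a α i)` of `ȳ`-tuples whose rows `{φ(x̄, a α i)}ᵢ` are `2`-inconsistent and all of whose vertical
paths `{φ(x̄, a α (f α))}_α` are realized. (A path consistent with a model is realized in an
elementary extension, so asking for realizations in some model of `T` is no restriction.) -/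
def HasTP2 {n m : ℕ} (φ : L.Formula (Fin n ⊕ Fin m)) : Prop :=
  ∃ (M : ModelType.{u, v, max u v} T) (a : ℕ → ℕ → Fin m → M),
    (∀ α i j, i ≠ j →
      ¬ ∃ b : Fin n → M, φ.Realize (Sum.elim b (a α i)) ∧ φ.Realize (Sum.elim b (a α j))) ∧
    ∀ f : ℕ → ℕ, ∃ b : Fin n → M, ∀ α, φ.Realize (Sum.elim b (a α (f α)))

/-- `T` is `NTP₂` if no formula `φ(x̄, ȳ)` has `TP₂` modulo `T`. -/
def IsNTP2 : Prop :=
  ∀ (n m : ℕ) (φ : L.Formula (Fin n ⊕ Fin m)), ¬ T.HasTP2 φ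

end Theory

end Geometric

/-! ### Expanding by a generic predicate -/

section GenericPredicate

/-- The relation symbols of the language with a single unary predicate `P`. -/
inductive unaryPredicateRel : ℕ → Type
  | P : unaryPredicateRel 1

/-- The language whose only symbol is a unary predicate `P`. -/
def unaryPredicate : Language.{0, 0} := ⟨fun _ => Empty, unaryPredicateRel⟩

/-- The language `L_P = L ∪ {P(x)}`. -/
abbrev withPredicate (L : Language.{u, v}) : Language.{u, v} := L.sum unaryPredicate

/-- The symbol `P` of `L_P`. -/
def predicateSymbol (L : Language.{u, v}) : L.withPredicate.Relations 1 :=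
  Sum.inr unaryPredicateRel.P

variable {L : Language.{u, v}}

/-- An `L`-formula regarded as an `L_P`-formula. -/
def Formula.toWithPredicate {α : Type*} (φ : L.Formula α) : L.withPredicate.Formula α :=
  (LHom.sumInl : L →ᴸ L.withPredicate).onFormula φ

/-- The `L_P`-formula `P(x)`, where `x` is the variable with index `i`. -/
def predicateFormula (L : Language.{u, v}) {α : Type*} (i : α) : L.withPredicate.Formula α :=
  (predicateSymbol L).formula₁ (Term.var i)

open Classical in
/-- The `L_P`-formula `⋀_{i ∈ I} P(xᵢ) ∧ ⋀_{i ∉ I} ¬ P(xᵢ)` in the variables `z̄, x̄`. -/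
noncomputable def patternFormula (L : Language.{u, v}) {m n : ℕ} (I : Set (Fin n)) :
    L.withPredicate.Formula (Fin m ⊕ Fin n) :=
  Formula.iInf fun i : Fin n =>
    if i ∈ I then predicateFormula L (Sum.inr i) else (predicateFormula L (Sum.inr i)).not

/-- The `L_P`-sentence `∀ x, P(x) → S(x)`. -/
noncomputable def predicateSubset (S : L.Formula (Fin 1)) : L.withPredicate.Sentence :=
  Formula.iAlls (α := Empty) (Fin 1)
    (((predicateFormula L (0 : Fin 1)).imp S.toWithPredicate).relabel Sum.inr)

/-- The `L_P`-sentence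
`∀ z̄, χ(z̄) → ∃ x̄, φ(z̄, x̄) ∧ ⋀_{i ∈ I} P(xᵢ) ∧ ⋀_{i ∉ I} ¬ P(xᵢ)`. -/
noncomputable def genericityAxiom {m n : ℕ} (χ : L.Formula (Fin m))
    (φ : L.Formula (Fin m ⊕ Fin n)) (I : Set (Fin n)) : L.withPredicate.Sentence :=
  Formula.iAlls (α := Empty) (Fin m)
    ((χ.toWithPredicate.imp
      (Formula.iExs (Fin n) (φ.toWithPredicate ⊓ patternFormula L I))).relabel Sum.inr)

/-- The condition
`∃ x̄, φ(c̄, x̄) ∧ x̄ ∩ acl(c̄) = ∅ ∧ ⋀ᵢ S(xᵢ) ∧ ⋀_{i ≠ j} xᵢ ≠ xⱼ`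
on a tuple `c̄` of a model `M`. As usual the witness is looked for in the monster model, that is, in
some elementary extension `N` of `M`. -/
def HasNonalgebraicSolution (S : L.Formula (Fin 1)) {m n : ℕ} (φ : L.Formula (Fin m ⊕ Fin n))
    {M : Type w} [L.Structure M] (c : Fin m → M) : Prop :=
  ∃ (N : Type w) (_ : L.Structure N) (g : M ↪ₑ[L] N) (a : Fin n → N),
    φ.Realize (Sum.elim (g ∘ c) a) ∧
    (∀ i, a i ∉ acl L (Set.range (g ∘ c))) ∧
    (∀ i, S.Realize fun _ => a i) ∧
    Function.Injective a

namespace Theory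

variable (T : L.Theory)

/-- The `L`-formula `χ(z̄)` expresses, in all models of `T`, that
`∃ x̄, φ(z̄, x̄) ∧ x̄ ∩ acl(z̄) = ∅ ∧ ⋀ᵢ S(xᵢ) ∧ ⋀_{i ≠ j} xᵢ ≠ xⱼ`. -/
def ExpressesNonalgebraicSolution (S : L.Formula (Fin 1)) {m n : ℕ}
    (φ : L.Formula (Fin m ⊕ Fin n)) (χ : L.Formula (Fin m)) : Prop :=
  ∀ (M : ModelType.{u, v, max u v} T) (c : Fin m → M),
    χ.Realize c ↔ HasNonalgebraicSolution S φ c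

/-- The base theory `T⁰_{P,S} = T ∪ {∀ x, P(x) → S(x)}`. -/
def predicateBase (S : L.Formula (Fin 1)) : L.withPredicate.Theory :=
  (LHom.sumInl : L →ᴸ L.withPredicate).onTheory T ∪ {predicateSubset S}

/-- The Chatzidakis–Pillay theory `T_{P,S}` of the expansion of `T` by a generic predicate `P`
inside `S`: the base theory together with the axioms
`∀ z̄, [∃ x̄, φ(z̄, x̄) ∧ x̄ ∩ acl(z̄) = ∅ ∧ ⋀ᵢ S(xᵢ) ∧ ⋀_{i ≠ j} xᵢ ≠ xⱼ] →
  ∃ x̄, φ(z̄, x̄) ∧ ⋀_{i ∈ I} P(xᵢ) ∧ ⋀_{i ∉ I} ¬ P(xᵢ)`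
for all `L`-formulas `φ(z̄, x̄)` and all sets `I` of indices, where the bracket is written in
first-order form by an `L`-formula `χ(z̄)` that expresses it modulo `T`
(if `T` eliminates `∃^∞`, then such a `χ` exists for every `φ`). -/
def genericPredicate (S : L.Formula (Fin 1)) : L.withPredicate.Theory :=
  T.predicateBase S ∪
    {σ | ∃ (m n : ℕ) (φ : L.Formula (Fin m ⊕ Fin n)) (I : Set (Fin n)) (χ : L.Formula (Fin m)),
      T.ExpressesNonalgebraicSolution S φ χ ∧ σ = genericityAxiom χ φ I}

end Theory

/-! The sentences above say what they should. -/

section Realize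

/-- The interpretation of `P` in an `L_P`-structure. -/
def InPredicate (L : Language.{u, v}) {M : Type w} [L.withPredicate.Structure M] (a : M) : Prop :=
  Structure.RelMap (predicateSymbol L) ![a]

theorem realize_toWithPredicate {M : Type w} [L.Structure M] [L.withPredicate.Structure M]
    [(LHom.sumInl : L →ᴸ L.withPredicate).IsExpansionOn M] {α : Type*} (φ : L.Formula α)
    (x : α → M) : φ.toWithPredicate.Realize x ↔ φ.Realize x :=
  LHom.realize_onFormula _ φ

theorem realize_predicateFormula {M : Type w} [L.withPredicate.Structure M] {α : Type*} (i : α)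
    (x : α → M) : (predicateFormula L i).Realize x ↔ InPredicate L (x i) := by
  unfold predicateFormula InPredicate
  rw [Formula.realize_rel₁]
  rfl

theorem realize_patternFormula {M : Type w} [L.withPredicate.Structure M] {m n : ℕ}
    (I : Set (Fin n)) (c : Fin m → M) (a : Fin n → M) :
    (patternFormula L I).Realize (Sum.elim c a) ↔ ∀ i, InPredicate L (a i) ↔ i ∈ I := by
  unfold patternFormula
  rw [Formula.realize_iInf]
  refine forall_congr' fun i => ?_
  by_cases h : i ∈ I <;> simp [h, realize_predicateFormula]

theorem realize_predicateSubset {M : Type w} [L.Structure M] [L.withPredicate.Structure M]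
    [(LHom.sumInl : L →ᴸ L.withPredicate).IsExpansionOn M] (S : L.Formula (Fin 1)) :
    M ⊨ predicateSubset S ↔ ∀ a : M, InPredicate L a → S.Realize fun _ => a := by
  unfold predicateSubset Sentence.Realize
  rw [Formula.realize_iAlls]
  simp only [Formula.realize_relabel, Formula.realize_imp, realize_toWithPredicate,
    realize_predicateFormula]
  constructor
  · intro h a ha
    exact h (fun _ => a) ha
  · intro h x hx
    have := h (x 0) hx
    convert this using 2 with j
    simp [Subsingleton.elim j 0]

theorem realize_genericityAxiom {M : Type w} [L.Structure M] [L.withPredicate.Structure M]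
    [(LHom.sumInl : L →ᴸ L.withPredicate).IsExpansionOn M] {m n : ℕ} (χ : L.Formula (Fin m))
    (φ : L.Formula (Fin m ⊕ Fin n)) (I : Set (Fin n)) :
    M ⊨ genericityAxiom χ φ I ↔ ∀ c : Fin m → M, χ.Realize c →
      ∃ a : Fin n → M, φ.Realize (Sum.elim c a) ∧ ∀ i, InPredicate L (a i) ↔ i ∈ I := by
  unfold genericityAxiom Sentence.Realize
  rw [Formula.realize_iAlls]
  simp only [Formula.realize_relabel, Formula.realize_imp, Formula.realize_iExs,
    Formula.realize_inf, realize_toWithPredicate]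
  refine forall_congr' fun c => ?_
  have hc : (fun a => Sum.elim (default : Empty → M) c a) ∘ Sum.inr = c := rfl
  rw [hc]
  simp only [realize_patternFormula]

end Realize

end GenericPredicate

end FirstOrder.Language

/-! Suppose `φ(x, y)` has `TP₂` modulo `T_{P,S}`. Iterated ultrapowers make the array `(a_{α,i})`
`L_P`-indiscernible under increasing changes of rows and columns, with every `a_{α,i}` enumerating
an elementary submodel, and give a solution `c` of column `0` with the same `L_P`-type over every
`a_{α,0}` (`Theory.HasTP2.exists_pathArray`). Call `φ` of dimension `d` if it forces its solutions
into the algebraic closure of the parameters and `d` coordinates, and take `d` minimal among the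
`TP₂` witnesses. Then `acl(c a_{β,0})` meets the closure of column `0` only in `a_{β,0}`. Otherwise
exchange makes one of the `d` coordinates of `c` algebraic over the others and finitely many entries
of the column, and absorbing these into the parameters gives a witness of smaller dimension
(`independentPath_of_minimal`).

Now work in `L`. Let `d` be a finite tuple from `acl(c a_{0,0})` outside `a_{0,0}`. By independence,
column `0` admits many solutions whose copies of `d` are pairwise disjoint. As `T` is `NTP₂`,
consistency along a column passes to consistency along a row (`Theory.IsNTP2.exists_realize_row`),
so one `c'` carries copies of `d` over many entries of row `0`. A counting argument
(`exists_no_conflict`) selects two entries such that no point required to lie in `P` over one is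
required to lie outside `P` over the other. By compactness there are copies of all of `acl(c
a_{0,0})` over `a_{0,0}` and `a_{0,1}` that share `c'` and can be coloured consistently
(`IndependentPath.exists_amalgam`).

Finally, any model of `T` with a colouring inside `S` embeds, over an algebraically closed set, into
an ultrapower of a given model of `T_{P,S}` (`Theory.exists_embedding_ultrapower`). Hence the
`L_P`-type of a tuple enumerating an algebraically closed set is determined by its `L`-type and its
colours (`AclIso.sameType_withPredicate`). Embedding the coloured amalgam produces a common solution
of `φ(x, a_{0,0})` and `φ(x, a_{0,1})`, contradicting `2`-inconsistency. -/

namespace FirstOrder.Language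

open Filter

/-! ### First-order properties of tuples -/

section IsFirstOrder

/-- A property of tuples, defined uniformly in all structures, that is expressed by a formula. -/
def IsFirstOrder (L : Language.{u, v}) {α : Type*}
    (R : ∀ (M : Type w) [L.Structure M], (α → M) → Prop) : Prop :=
  ∃ φ : L.Formula α, ∀ (M : Type w) [L.Structure M] (x : α → M), φ.Realize x ↔ R M x

/-- Two tuples (possibly in different structures) satisfy the same formulas. -/
def SameType (L : Language.{u, v}) {M N X : Type*} [L.Structure M] [L.Structure N]
    (x : X → M) (y : X → N) : Prop :=
  ∀ ψ : L.Formula X, ψ.Realize x ↔ ψ.Realize y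

variable {L : Language.{u, v}} {α β γ : Type*}

theorem SameType.symm {M N X : Type*} [L.Structure M] [L.Structure N] {x : X → M} {y : X → N}
    (h : SameType L x y) : SameType L y x := fun ψ => (h ψ).symm

theorem SameType.trans {M N K X : Type*} [L.Structure M] [L.Structure N] [L.Structure K]
    {x : X → M} {y : X → N} {z : X → K} (h : SameType L x y) (h' : SameType L y z) :
    SameType L x z := fun ψ => (h ψ).trans (h' ψ)

theorem SameType.comp {M N X Y : Type*} [L.Structure M] [L.Structure N] {x : X → M} {y : X → N}
    (h : SameType L x y) (f : Y → X) : SameType L (x ∘ f) (y ∘ f) := fun ψ => by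
  rw [← Formula.realize_relabel, ← Formula.realize_relabel]
  exact h _

theorem SameType.eq_iff {M N X : Type*} [L.Structure M] [L.Structure N] {x : X → M} {y : X → N}
    (h : SameType L x y) (i j : X) : x i = x j ↔ y i = y j := by
  have := h ((Term.var i).equal (Term.var j))
  simpa [Formula.realize_equal] using this

theorem ElementaryEmbedding.sameType {M N X : Type*} [L.Structure M] [L.Structure N]
    (f : M ↪ₑ[L] N) (x : X → M) : SameType L x (f ∘ x) := fun ψ => (f.map_formula ψ x).symm

/-! ### Closure properties of first-order conditions -/

namespace IsFirstOrder

variable {R R' : ∀ (M : Type w) [L.Structure M], (α → M) → Prop}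

/-- The vehicle for every later use of indiscernibility or elementarity: a mathematical condition is
shown to be first-order by the closure lemmas, then moved along equality of types. -/
theorem transfer (hR : IsFirstOrder L R) {M N : Type w} [L.Structure M] [L.Structure N]
    {x : α → M} {y : α → N} (h : SameType L x y) : R M x ↔ R N y := by
  obtain ⟨φ, hφ⟩ := hR
  rw [← hφ, ← hφ]
  exact h φ

theorem of_formula (φ : L.Formula β) {F : ∀ (M : Type w), (α → M) → β → M} (g : β → α)
    (h : ∀ (M : Type w) (x : α → M) b, F M x b = x (g b)) :
    IsFirstOrder L fun (M : Type w) _ (x : α → M) => φ.Realize (F M x) := by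
  refine ⟨φ.relabel g, fun M _ x => ?_⟩
  rw [Formula.realize_relabel]
  have : F M x = x ∘ g := funext fun b => h M x b
  change _ ↔ φ.Realize (F M x)
  rw [this]

theorem eq (i j : α) : IsFirstOrder L fun (M : Type w) _ (x : α → M) => x i = x j :=
  ⟨(Term.var i).equal (Term.var j), fun M _ x => by simp [Formula.realize_equal]⟩

theorem false : IsFirstOrder L fun (M : Type w) _ (_ : α → M) => False :=
  ⟨⊥, fun M _ x => by simp⟩

theorem not (h : IsFirstOrder L R) : IsFirstOrder L fun (M : Type w) _ (x : α → M) => ¬ R M x := by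
  obtain ⟨φ, hφ⟩ := h
  exact ⟨φ.not, fun M _ x => by rw [Formula.realize_not, hφ]⟩

theorem and (h : IsFirstOrder L R) (h' : IsFirstOrder L R') :
    IsFirstOrder L fun (M : Type w) _ (x : α → M) => R M x ∧ R' M x := by
  obtain ⟨φ, hφ⟩ := h
  obtain ⟨ψ, hψ⟩ := h'
  exact ⟨φ ⊓ ψ, fun M _ x => by rw [Formula.realize_inf, hφ, hψ]⟩

theorem imp (h : IsFirstOrder L R) (h' : IsFirstOrder L R') :
    IsFirstOrder L fun (M : Type w) _ (x : α → M) => R M x → R' M x := by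
  obtain ⟨φ, hφ⟩ := h
  obtain ⟨ψ, hψ⟩ := h'
  exact ⟨φ.imp ψ, fun M _ x => by rw [Formula.realize_imp, hφ, hψ]⟩

theorem forall_finite {ι : Type*} [Finite ι]
    {Q : ι → ∀ (M : Type w) [L.Structure M], (α → M) → Prop}
    (h : ∀ i, IsFirstOrder L (Q i)) :
    IsFirstOrder L fun (M : Type w) _ (x : α → M) => ∀ i, Q i M x := by
  choose φ hφ using h
  exact ⟨Formula.iInf φ, fun M _ x => by simp [Formula.realize_iInf, hφ]⟩

theorem exists_finite {ι : Type*} [Finite ι]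
    {Q : ι → ∀ (M : Type w) [L.Structure M], (α → M) → Prop}
    (h : ∀ i, IsFirstOrder L (Q i)) :
    IsFirstOrder L fun (M : Type w) _ (x : α → M) => ∃ i, Q i M x := by
  choose φ hφ using h
  exact ⟨Formula.iSup φ, fun M _ x => by simp [Formula.realize_iSup, hφ]⟩

theorem exists_tuple [Finite β]
    {Q : ∀ (M : Type w) [L.Structure M], (α → M) → (β → M) → Prop}
    (h : IsFirstOrder L fun (M : Type w) _ (z : α ⊕ β → M) =>
      Q M (fun a => z (Sum.inl a)) (fun b => z (Sum.inr b))) :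
    IsFirstOrder L fun (M : Type w) _ (x : α → M) => ∃ y : β → M, Q M x y := by
  obtain ⟨φ, hφ⟩ := h
  refine ⟨φ.iExs β, fun M _ x => ?_⟩
  rw [Formula.realize_iExs]
  exact exists_congr fun y => by rw [hφ]; simp

theorem forall_tuple [Finite β]
    {Q : ∀ (M : Type w) [L.Structure M], (α → M) → (β → M) → Prop}
    (h : IsFirstOrder L fun (M : Type w) _ (z : α ⊕ β → M) =>
      Q M (fun a => z (Sum.inl a)) (fun b => z (Sum.inr b))) :
    IsFirstOrder L fun (M : Type w) _ (x : α → M) => ∀ y : β → M, Q M x y := by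
  obtain ⟨φ, hφ⟩ := h
  refine ⟨φ.iAlls β, fun M _ x => ?_⟩
  rw [Formula.realize_iAlls]
  exact forall_congr' fun y => by rw [hφ]; simp

theorem exists_elem {Q : ∀ (M : Type w) [L.Structure M], (α → M) → M → Prop}
    (h : IsFirstOrder L fun (M : Type w) _ (z : α ⊕ Unit → M) =>
      Q M (fun a => z (Sum.inl a)) (z (Sum.inr ()))) :
    IsFirstOrder L fun (M : Type w) _ (x : α → M) => ∃ y : M, Q M x y := by
  obtain ⟨φ, hφ⟩ := exists_tuple (Q := fun M _ x (y : Unit → M) => Q M x (y ())) h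
  refine ⟨φ, fun M _ x => ?_⟩
  rw [hφ]
  exact ⟨fun ⟨y, hy⟩ => ⟨_, hy⟩, fun ⟨y, hy⟩ => ⟨fun _ => y, hy⟩⟩

theorem forall_elem {Q : ∀ (M : Type w) [L.Structure M], (α → M) → M → Prop}
    (h : IsFirstOrder L fun (M : Type w) _ (z : α ⊕ Unit → M) =>
      Q M (fun a => z (Sum.inl a)) (z (Sum.inr ()))) :
    IsFirstOrder L fun (M : Type w) _ (x : α → M) => ∀ y : M, Q M x y := by
  obtain ⟨φ, hφ⟩ := forall_tuple (Q := fun M _ x (y : Unit → M) => Q M x (y ())) h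
  refine ⟨φ, fun M _ x => ?_⟩
  rw [hφ]
  exact ⟨fun h y => h fun _ => y, fun h y => h _⟩

end IsFirstOrder

/-- Every formula involves only finitely many of its variables. -/
theorem Formula.exists_finite_support {α : Type*} (φ : L.Formula α) :
    ∃ (s : Finset α) (ψ : L.Formula s), ∀ (M : Type w) [L.Structure M] (x : α → M),
      φ.Realize x ↔ ψ.Realize fun i => x i := by
  classical
  refine ⟨φ.freeVarFinset, φ.restrictFreeVar id, fun M _ x => ?_⟩
  exact (BoundedFormula.realize_restrictFreeVar (L := L) (M := M) (φ := φ) (f := id)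
    (v := fun i => x i) x (fun a => rfl)).symm

end IsFirstOrder

/-! ### Ultrapowers -/

section Ultrapower

variable {L : Language.{u, v}} {ι : Type*} (U : Ultrafilter ι) (M : Type w)

/-- The ultrapower of a structure. -/
abbrev Ultrapower : Type _ := (U : Filter ι).Product fun _ => M

variable {M}

/-- The class of a family in the ultrapower. -/
def Ultrapower.mk (x : ι → M) : Ultrapower U M := (x : (U : Filter ι).Product fun _ => M)

theorem Ultrapower.mk_surjective : Function.Surjective (Ultrapower.mk U (M := M)) :=
  Quotient.mk_surjective

theorem Ultrapower.mk_eq_mk {x y : ι → M} :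
    Ultrapower.mk U x = Ultrapower.mk U y ↔ ∀ᶠ i in U, x i = y i := Quotient.eq''

variable [L.Structure M] [Nonempty M]

theorem Ultrapower.realize_mk {β : Type*} (φ : L.Formula β) (x : β → ι → M) :
    (φ.Realize fun b => Ultrapower.mk U (x b)) ↔ ∀ᶠ i in U, φ.Realize fun b => x b i :=
  Ultraproduct.realize_formula_cast φ x

variable (L) in
/-- The diagonal embedding of a structure into an ultrapower. -/
def Ultrapower.diag :
    M ↪ₑ[L] Ultrapower U M where
  toFun m := Ultrapower.mk U fun _ => m
  map_formula' n φ x := by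
    have := Ultrapower.realize_mk (L := L) U φ (fun b (_ : ι) => x b)
    simpa [Function.comp_def] using this

theorem Ultrapower.diag_apply (m : M) : Ultrapower.diag L U m = Ultrapower.mk U fun _ => m := rfl

/-- The `L`- and `L_P`-structures on an ultrapower are built separately; Łoś's theorem for atomic
formulas shows that they agree. -/
instance Ultrapower.isExpansionOn {L' : Language} [L'.Structure M] (Φ : L →ᴸ L')
    [Φ.IsExpansionOn M] : Φ.IsExpansionOn (Ultrapower U M) where
  map_onFunction {n} f x := by
    choose y hy using fun i => Ultrapower.mk_surjective U (x i)
    obtain rfl : (fun i => Ultrapower.mk U (y i)) = x := funext hy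
    refine (Ultraproduct.funMap_cast (u := U) (Φ.onFunction f) y).trans
      (Eq.trans ?_ (Ultraproduct.funMap_cast (u := U) f y).symm)
    simp
  map_onRelation {n} r x := by
    choose y hy using fun i => Ultrapower.mk_surjective U (x i)
    obtain rfl : (fun i => Ultrapower.mk U (y i)) = x := funext hy
    have h1 := Ultrapower.realize_mk (L := L') U ((Φ.onRelation r).formula Term.var) y
    have h2 := Ultrapower.realize_mk (L := L) U (r.formula Term.var) y
    simp only [Formula.realize_rel, Term.realize_var, LHom.map_onRelation] at h1 h2
    exact propext (h1.trans h2.symm)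

end Ultrapower

/-! ### Iterated ultrafilter limits -/

section IteratedUltrafilter

/-- The iterated tensor power of a nonprincipal ultrafilter on `ℕ`. -/
noncomputable def tensorPower : ∀ n : ℕ, Ultrafilter (Fin n → ℕ)
  | 0 => pure Fin.elim0
  | n + 1 => (hyperfilter ℕ).bind fun k => (tensorPower n).map (Fin.cons k)

theorem eventually_tensorPower_succ {n : ℕ} {Q : (Fin (n + 1) → ℕ) → Prop} :
    (∀ᶠ t in tensorPower (n + 1), Q t) ↔
      ∀ᶠ k in hyperfilter ℕ, ∀ᶠ t in tensorPower n, Q (Fin.cons k t) := Iff.rfl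

/-- Coherence of marginals. If `0` is not in the range of `g`, the outermost quantifier is vacuous;
otherwise monotonicity forces `g 0 = 0`, and it is stripped from both sides. -/
theorem eventually_tensorPower_comp {N : ℕ} : ∀ {n : ℕ} {g : Fin n → Fin N}, StrictMono g →
    ∀ Q : (Fin n → ℕ) → Prop,
      (∀ᶠ t in tensorPower N, Q (t ∘ g)) ↔ ∀ᶠ t in tensorPower n, Q t := by
  induction N with
  | zero =>
    intro n g _ Q
    obtain rfl : n = 0 := by
      rcases n with _ | n
      · rfl
      · exact (g 0).elim0
    have h : ∀ t : Fin 0 → ℕ, t ∘ g = t := fun t => Subsingleton.elim _ _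
    simp only [h]
  | succ N ih =>
    intro n g hg Q
    by_cases h0 : ∀ j, g j ≠ 0
    · have hg' : StrictMono fun j => (g j).pred (h0 j) := fun a b hab => by
        simpa using hg hab
      have key : ∀ (k : ℕ) (t : Fin N → ℕ),
          (Fin.cons k t : Fin (N + 1) → ℕ) ∘ g = t ∘ fun j => (g j).pred (h0 j) := by
        intro k t
        funext j
        have : g j = ((g j).pred (h0 j)).succ := by simp
        rw [Function.comp_apply, this, Fin.cons_succ]
        simp
      rw [eventually_tensorPower_succ]
      simp only [key, ih hg', eventually_const]
    · push Not at h0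
      obtain ⟨j, hj⟩ := h0
      rcases n with _ | n
      · exact j.elim0
      have hg0 : g 0 = 0 := le_antisymm (hj ▸ hg.monotone (Fin.zero_le j)) (Fin.zero_le _)
      have hs : ∀ j : Fin n, g j.succ ≠ 0 := fun j => by
        have := hg (Fin.succ_pos j)
        rw [hg0] at this
        exact this.ne'
      have hg' : StrictMono fun j : Fin n => (g j.succ).pred (hs j) := fun a b hab => by
        simpa using hg (Fin.succ_lt_succ_iff.2 hab)
      have key : ∀ (k : ℕ) (t : Fin N → ℕ), (Fin.cons k t : Fin (N + 1) → ℕ) ∘ g =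
          Fin.cons k (t ∘ fun j : Fin n => (g j.succ).pred (hs j)) := by
        intro k t
        funext j
        refine Fin.cases ?_ (fun j => ?_) j
        · simp [hg0]
        · have : g j.succ = ((g j.succ).pred (hs j)).succ := by simp
          rw [Function.comp_apply, this, Fin.cons_succ, Fin.cons_succ]
          simp
      rw [eventually_tensorPower_succ, eventually_tensorPower_succ]
      refine eventually_congr (Eventually.of_forall fun k => ?_)
      simp only [key]
      exact ih hg' fun t => Q (Fin.cons k t)

theorem eventually_tensorPower_two_lt : ∀ᶠ t : Fin 2 → ℕ in tensorPower 2, t 0 < t 1 := by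
  rw [eventually_tensorPower_succ]
  refine Eventually.of_forall fun k => ?_
  rw [eventually_tensorPower_succ]
  have : ∀ᶠ l in hyperfilter ℕ, k < l := Nat.hyperfilter_le_atTop (eventually_gt_atTop k)
  filter_upwards [this] with l hl
  exact Eventually.of_forall fun t => hl

/-- The filter on `I → ℕ` all of whose increasing finite marginals are tensor powers. -/
def tensorFilter (I : Type*) [LinearOrder I] : Filter (I → ℕ) where
  sets := {s | ∃ (n : ℕ) (i : Fin n → I), StrictMono i ∧
    ∀ᶠ t in tensorPower n, ∀ v : I → ℕ, v ∘ i = t → v ∈ s}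
  univ_sets := ⟨0, Fin.elim0, fun a => a.elim0, Eventually.of_forall fun _ _ _ => trivial⟩
  sets_of_superset := by
    rintro s s' ⟨n, i, hi, h⟩ hs
    exact ⟨n, i, hi, h.mono fun t ht v hv => hs (ht v hv)⟩
  inter_sets := by
    classical
    rintro s s' ⟨n, i, hi, h⟩ ⟨n', i', hi', h'⟩
    -- Both witnessing index tuples factor through the increasing enumeration of their union, so
    -- marginal coherence lets them be compared in one tensor power.
    let F : Finset I := Finset.univ.image i ∪ Finset.univ.image i'
    let e := F.orderEmbOfFin rfl
    have he : Set.range e = F := F.range_orderEmbOfFin rfl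
    have hmem : ∀ j, ∃ k, e k = i j := fun j => by
      have : i j ∈ Set.range e := by rw [he]; simp [F]
      exact this
    have hmem' : ∀ j, ∃ k, e k = i' j := fun j => by
      have : i' j ∈ Set.range e := by rw [he]; simp [F]
      exact this
    choose g hg using hmem
    choose g' hg' using hmem'
    have hgm : StrictMono g := fun a b hab => by
      rw [← e.lt_iff_lt, hg, hg]; exact hi hab
    have hgm' : StrictMono g' := fun a b hab => by
      rw [← e.lt_iff_lt, hg', hg']; exact hi' hab
    refine ⟨_, e, e.strictMono, ?_⟩
    filter_upwards [(eventually_tensorPower_comp hgm _).2 h,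
      (eventually_tensorPower_comp hgm' _).2 h'] with t ht ht' v hv
    subst hv
    exact ⟨ht v (funext fun j => by simp [hg]), ht' v (funext fun j => by simp [hg'])⟩

instance tensorFilter_neBot (I : Type*) [LinearOrder I] : (tensorFilter I).NeBot := by
  refine ⟨fun h => ?_⟩
  have h' : (∅ : Set (I → ℕ)) ∈ tensorFilter I := h ▸ mem_bot
  obtain ⟨n, i, hi, h'⟩ := h'
  obtain ⟨t, ht⟩ := h'.exists
  refine ht (Function.extend i t 0) ?_
  funext j
  exact hi.injective.extend_apply t 0 j

/-- An ultrafilter on `I → ℕ` all of whose increasing finite marginals are tensor powers. -/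
noncomputable def tensorUltrafilter (I : Type*) [LinearOrder I] : Ultrafilter (I → ℕ) :=
  Ultrafilter.of (tensorFilter I)

variable {I : Type*} [LinearOrder I]

theorem eventually_tensorUltrafilter {n : ℕ} {i : Fin n → I} (hi : StrictMono i)
    (Q : (Fin n → ℕ) → Prop) :
    (∀ᶠ v in tensorUltrafilter I, Q (v ∘ i)) ↔ ∀ᶠ t in tensorPower n, Q t := by
  have main : ∀ Q : (Fin n → ℕ) → Prop, (∀ᶠ t in tensorPower n, Q t) →
      ∀ᶠ v in tensorUltrafilter I, Q (v ∘ i) := fun Q hQ =>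
    Ultrafilter.of_le (tensorFilter I)
      ⟨n, i, hi, hQ.mono fun t ht v hv => by subst hv; exact ht⟩
  refine ⟨fun h => ?_, main Q⟩
  by_contra hQ
  rw [← Ultrafilter.eventually_not] at hQ
  obtain ⟨v, hv⟩ := (h.and (main _ hQ)).exists
  exact hv.2 hv.1

theorem eventually_tensorUltrafilter_lt {p q : I} (h : p < q) :
    ∀ᶠ v : I → ℕ in tensorUltrafilter I, v p < v q := by
  have hi : StrictMono ![p, q] := by
    intro a b hab
    fin_cases a <;> fin_cases b <;> simp_all
  exact (eventually_tensorUltrafilter hi fun t => t 0 < t 1).2 eventually_tensorPower_two_lt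

/-- The source of indiscernibility: a property of finitely many coordinates is decided by a tensor
power, which does not see where the increasing indices lie. -/
theorem eventually_tensorUltrafilter_congr {J : Type*} [LinearOrder J] {i i' : J → I}
    (hi : StrictMono i) (hi' : StrictMono i') (Q : (J → ℕ) → Prop) (F : Finset J)
    (hF : ∀ t t' : J → ℕ, (∀ j ∈ F, t j = t' j) → (Q t ↔ Q t')) :
    (∀ᶠ v in tensorUltrafilter I, Q (v ∘ i)) ↔ ∀ᶠ v in tensorUltrafilter I, Q (v ∘ i') := by
  classical
  let e := F.orderEmbOfFin rfl
  have he : Set.range e = F := F.range_orderEmbOfFin rfl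
  let Q' : (Fin F.card → ℕ) → Prop := fun t => Q (Function.extend e t 0)
  have key : ∀ t : J → ℕ, Q t ↔ Q' (t ∘ e) := fun t => hF _ _ fun j hj => by
    obtain ⟨k, rfl⟩ : j ∈ Set.range e := by rw [he]; exact hj
    rw [e.injective.extend_apply]
    rfl
  simp only [key]
  exact (eventually_tensorUltrafilter (hi.comp e.strictMono) Q').trans
    (eventually_tensorUltrafilter (hi'.comp e.strictMono) Q').symm

end IteratedUltrafilter

/-! ### Indiscernible arrays -/

/-- An array of tuples with indices `ι`, together with a solution of `φ` along the column `0`, such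
that the array is indiscernible with respect to increasing changes of rows and columns, and every
entry enumerates an elementary substructure. -/
structure PathArray {L : Language.{u, v}} (M : Type w) [L.Structure M] {n m : ℕ}
    (φ : L.Formula (Fin n ⊕ Fin m)) (ι : Type w) where
  /-- the entry in a given row and column -/
  entry : ℕ → ℕ → ι → M
  /-- the solution of the column `0` -/
  sol : Fin n → M
  /-- the indices of the parameters of `φ` -/
  param : Fin m → ι
  indiscernible : ∀ {N : ℕ} {ρ ρ' : Fin N → ℕ} {s s' : Fin N → ℕ → ℕ}, StrictMono ρ →
    StrictMono ρ' → (∀ β, StrictMono (s β)) → (∀ β, StrictMono (s' β)) →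
    SameType L (fun x : Fin N × ℕ × ι => entry (ρ x.1) (s x.1 x.2.1) x.2.2)
      fun x : Fin N × ℕ × ι => entry (ρ' x.1) (s' x.1 x.2.1) x.2.2
  witness : ∀ (β k : ℕ) (ψ : L.Formula (ι ⊕ Unit)),
    (∃ z, ψ.Realize (Sum.elim (entry β k) fun _ => z)) →
      ∃ h, ψ.Realize (Sum.elim (entry β k) fun _ => entry β k h)
  inconsistent : ¬ ∃ x : Fin n → M, φ.Realize (Sum.elim x (entry 0 0 ∘ param)) ∧
    φ.Realize (Sum.elim x (entry 0 1 ∘ param))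
  realize_sol : ∀ β, φ.Realize (Sum.elim sol (entry β 0 ∘ param))
  sameType_row : ∀ β γ, SameType L (Sum.elim sol (entry β 0)) (Sum.elim sol (entry γ 0))

section Extraction

variable {L : Language.{u, v}} {M : Type w} [L.Structure M] [Nonempty M]

/-- The function on pairs that shifts rows by `ρ` and columns by `s`, where the column `0` is
reserved for the row variable. -/
def shiftIndex {N : ℕ} (ρ : Fin N → ℕ) (s : Fin N → ℕ → ℕ) (p : Fin N ×ₗ ℕ) : ℕ ×ₗ ℕ :=
  toLex (ρ (ofLex p).1, Nat.casesOn (ofLex p).2 0 fun k => s (ofLex p).1 k + 1)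

theorem shiftIndex_strictMono {N : ℕ} {ρ : Fin N → ℕ} {s : Fin N → ℕ → ℕ} (hρ : StrictMono ρ)
    (hs : ∀ β, StrictMono (s β)) : StrictMono (shiftIndex ρ s) := by
  rintro ⟨a, k⟩ ⟨b, l⟩ hab
  rcases (Prod.Lex.toLex_lt_toLex (x := (a, k)) (y := (b, l))).1 hab with h | ⟨h, h'⟩
  · exact Prod.Lex.toLex_lt_toLex.2 (Or.inl (hρ h))
  · obtain rfl : a = b := h
    refine Prod.Lex.toLex_lt_toLex.2 (Or.inr ⟨rfl, ?_⟩)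
    change k < l at h'
    rcases k with _ | k
    · rcases l with _ | l
      · exact absurd h' (lt_irrefl _)
      · exact Nat.succ_pos _
    · rcases l with _ | l
      · exact absurd h' (Nat.not_lt_zero _)
      · exact Nat.succ_lt_succ (hs a (Nat.lt_of_succ_lt_succ h'))

/-- The generic entry in a given row and column of an array. -/
noncomputable def genericEntry (M : Type w) (β k : ℕ) (h : ℕ → ℕ → M) :
    Ultrapower (tensorUltrafilter (ℕ ×ₗ ℕ)) M :=
  Ultrapower.mk _ fun v => h (v (toLex (β, 0))) (v (toLex (β, k + 1)))

/-- The value at `h` depends only on the coordinates `(β, 0)` (the row number) and `(β, k + 1)` (the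
column number), and a formula mentions finitely many of them, so an order-preserving shift of
indices changes nothing. -/
theorem sameType_genericEntry {N : ℕ} {ρ ρ' : Fin N → ℕ} {s s' : Fin N → ℕ → ℕ}
    (hρ : StrictMono ρ) (hρ' : StrictMono ρ') (hs : ∀ β, StrictMono (s β))
    (hs' : ∀ β, StrictMono (s' β)) :
    SameType L
      (fun x : Fin N × ℕ × (ℕ → ℕ → M) => genericEntry M (ρ x.1) (s x.1 x.2.1) x.2.2)
      fun x : Fin N × ℕ × (ℕ → ℕ → M) => genericEntry M (ρ' x.1) (s' x.1 x.2.1) x.2.2 := by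
  classical
  intro ψ
  obtain ⟨F, ψ', hψ'⟩ := ψ.exists_finite_support
  unfold genericEntry
  rw [Ultrapower.realize_mk, Ultrapower.realize_mk]
  let Q : (Fin N ×ₗ ℕ → ℕ) → Prop := fun t => ψ.Realize fun x =>
    x.2.2 (t (toLex (x.1, 0))) (t (toLex (x.1, x.2.1 + 1)))
  refine eventually_tensorUltrafilter_congr (shiftIndex_strictMono hρ hs)
    (shiftIndex_strictMono hρ' hs') Q
    (F.image (fun x => toLex (x.1, 0)) ∪ F.image fun x => toLex (x.1, x.2.1 + 1))
    fun t t' htt => ?_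
  simp only [Q]
  rw [hψ', hψ']
  refine iff_of_eq (congrArg _ (funext fun x => ?_))
  rw [htt _ (Finset.mem_union_left _ (Finset.mem_image_of_mem _ x.2)),
    htt _ (Finset.mem_union_right _ (Finset.mem_image_of_mem _ x.2))]

/-- The indices are all functions from array positions to `M`, so a Skolem function for `ψ` is
itself an index. -/
theorem genericEntry_witness (β k : ℕ) (ψ : L.Formula ((ℕ → ℕ → M) ⊕ Unit))
    (hψ : ∃ z, ψ.Realize (Sum.elim (genericEntry M β k) fun _ => z)) :
    ∃ h, ψ.Realize (Sum.elim (genericEntry M β k) fun _ => genericEntry M β k h) := by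
  obtain ⟨z, hz⟩ := hψ
  obtain ⟨z, rfl⟩ := Ultrapower.mk_surjective _ z
  have h1 : (Sum.elim (genericEntry M β k) fun _ => Ultrapower.mk _ z) =
      fun x => Ultrapower.mk _ ((Sum.elim (fun h v => h (v (toLex (β, 0))) (v (toLex (β, k + 1))))
        fun _ => z : (ℕ → ℕ → M) ⊕ Unit → _) x) := by
    funext x; rcases x with x | x <;> rfl
  rw [h1, Ultrapower.realize_mk] at hz
  -- The Skolem function: at each position of the original array it chooses a witness for `ψ`
  -- whenever one exists.
  let w : ℕ → ℕ → M := fun a b => Classical.epsilon fun z : M =>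
    ψ.Realize (Sum.elim (fun h => h a b) fun _ => z)
  refine ⟨w, ?_⟩
  have h2 : (Sum.elim (genericEntry M β k) fun _ => genericEntry M β k w) =
      fun x => Ultrapower.mk _ ((Sum.elim (fun h v => h (v (toLex (β, 0))) (v (toLex (β, k + 1))))
        fun _ v => w (v (toLex (β, 0))) (v (toLex (β, k + 1))) :
          (ℕ → ℕ → M) ⊕ Unit → (ℕ ×ₗ ℕ → ℕ) → M) x) := by
    funext x; rcases x with x | x <;> rfl
  rw [h2, Ultrapower.realize_mk]
  filter_upwards [hz] with v hv
  have h3 : ∃ z : M, ψ.Realize (Sum.elim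
      (fun h : ℕ → ℕ → M => h (v (toLex (β, 0))) (v (toLex (β, k + 1)))) fun _ => z) := by
    refine ⟨z v, ?_⟩
    convert hv using 2 with x
    rcases x with x | x <;> rfl
  have h4 := Classical.epsilon_spec h3
  convert h4 using 2 with x
  rcases x with x | x <;> rfl

/-- Entries `0` and `1` share the row number `v (β, 0)` and have different column numbers `v (β, 1)
< v (β, 2)` almost everywhere, so inconsistency of a row of the original array applies pointwise. -/
theorem genericEntry_inconsistent {n m : ℕ} {φ : L.Formula (Fin n ⊕ Fin m)}
    {a : ℕ → ℕ → Fin m → M}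
    (h : ∀ α i j, i ≠ j →
      ¬ ∃ b : Fin n → M, φ.Realize (Sum.elim b (a α i)) ∧ φ.Realize (Sum.elim b (a α j)))
    (β : ℕ) : ¬ ∃ x, φ.Realize (Sum.elim x fun j => genericEntry M β 0 fun α i => a α i j) ∧
      φ.Realize (Sum.elim x fun j => genericEntry M β 1 fun α i => a α i j) := by
  rintro ⟨x, h0, h1⟩
  choose x' hx' using fun i => Ultrapower.mk_surjective _ (x i)
  obtain rfl : (fun i => Ultrapower.mk _ (x' i)) = x := funext hx'
  have key : ∀ k, φ.Realize (Sum.elim (fun i => Ultrapower.mk _ (x' i))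
      fun j => genericEntry M β k fun α i => a α i j) →
      ∀ᶠ v : ℕ ×ₗ ℕ → ℕ in tensorUltrafilter (ℕ ×ₗ ℕ), φ.Realize
        (Sum.elim (fun i => x' i v) (a (v (toLex (β, 0))) (v (toLex (β, k + 1))))) := by
    intro k hk
    have h1 : (Sum.elim (fun i => Ultrapower.mk _ (x' i))
        fun j => genericEntry M β k fun α i => a α i j) =
        fun y => Ultrapower.mk _ ((Sum.elim x'
          fun j v => a (v (toLex (β, 0))) (v (toLex (β, k + 1))) j :
            Fin n ⊕ Fin m → (ℕ ×ₗ ℕ → ℕ) → M) y) := by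
      funext y; rcases y with y | y <;> rfl
    rw [h1, Ultrapower.realize_mk] at hk
    filter_upwards [hk] with v hv
    convert hv using 2 with y
    rcases y with y | y <;> rfl
  have hlt : (toLex (β, 0 + 1) : ℕ ×ₗ ℕ) < toLex (β, 1 + 1) :=
    Prod.Lex.toLex_lt_toLex.2 (Or.inr ⟨rfl, by norm_num⟩)
  obtain ⟨v, ⟨h0, h1⟩, h2⟩ :=
    (((key 0 h0).and (key 1 h1)).and (eventually_tensorUltrafilter_lt hlt)).exists
  exact h _ _ _ h2.ne ⟨_, h0, h1⟩

/-- Every `v` defines one path through the original array, sending row `v (β, 0)` to column `v (β,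
1)`; solutions of these paths are glued in the ultrapower. -/
theorem exists_genericEntry_solution {n m : ℕ} {φ : L.Formula (Fin n ⊕ Fin m)}
    {a : ℕ → ℕ → Fin m → M}
    (h : ∀ f : ℕ → ℕ, ∃ b : Fin n → M, ∀ α, φ.Realize (Sum.elim b (a α (f α)))) :
    ∃ x, ∀ β, φ.Realize (Sum.elim x fun j => genericEntry M β 0 fun α i => a α i j) := by
  classical
  choose b hb using h
  -- Row numbers may collide for exceptional `v`, hence the choice of the least `β`. For fixed `β`,
  -- almost every `v` has `v (γ, 0) < v (β, 0)` for all `γ < β`, so the least index is `β`. The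
  -- value `0` on unused rows is irrelevant.
  let path : (ℕ ×ₗ ℕ → ℕ) → ℕ → ℕ := fun v α =>
    if h : ∃ β, v (toLex (β, 0)) = α then v (toLex (Nat.find h, 1)) else 0
  refine ⟨fun i => Ultrapower.mk _ fun v => b (path v) i, fun β => ?_⟩
  have h1 : (Sum.elim (fun i => Ultrapower.mk _ fun v => b (path v) i)
      fun j => genericEntry M β 0 fun α i => a α i j) =
      fun y => Ultrapower.mk _ ((Sum.elim (fun i v => b (path v) i)
        fun j v => a (v (toLex (β, 0))) (v (toLex (β, 0 + 1))) j :
          Fin n ⊕ Fin m → (ℕ ×ₗ ℕ → ℕ) → M) y) := by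
    funext y; rcases y with y | y <;> rfl
  rw [h1, Ultrapower.realize_mk]
  have hlt : ∀ γ ∈ Finset.range β, ∀ᶠ v : ℕ ×ₗ ℕ → ℕ in tensorUltrafilter (ℕ ×ₗ ℕ),
      v (toLex (γ, 0)) < v (toLex (β, 0)) := fun γ hγ =>
    eventually_tensorUltrafilter_lt
      (Prod.Lex.toLex_lt_toLex.2 (Or.inl (Finset.mem_range.1 hγ)))
  filter_upwards [(eventually_all_finset (Finset.range β)).2 hlt] with v hv
  have hex : ∃ γ, v (toLex (γ, 0)) = v (toLex (β, 0)) := ⟨β, rfl⟩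
  have hfind : Nat.find hex = β := by
    refine (Nat.find_eq_iff hex).2 ⟨rfl, fun γ hγ => ?_⟩
    exact (hv γ (Finset.mem_range.2 hγ)).ne
  have hpath : path v (v (toLex (β, 0))) = v (toLex (β, 0 + 1)) := by
    simp only [path, dif_pos hex, hfind]
  have := hb (path v) (v (toLex (β, 0)))
  rw [hpath] at this
  convert this using 2 with y
  rcases y with y | y <;> rfl

end Extraction

/-! ### Making the rows alike over the solution -/

section Extraction

variable {L : Language.{u, v}} {M : Type w} [L.Structure M] [Nonempty M]

/-- The entries of an array in which also the rows are chosen generically. -/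
noncomputable def rowGenericEntry (M : Type w) (β k : ℕ) (h : ℕ → ℕ → M) :
    Ultrapower (tensorUltrafilter ℕ) (Ultrapower (tensorUltrafilter (ℕ ×ₗ ℕ)) M) :=
  Ultrapower.mk _ fun v => genericEntry M (v β) k h

theorem eventually_strictMono_comp {N : ℕ} {ρ : Fin N → ℕ} (hρ : StrictMono ρ) :
    ∀ᶠ v : ℕ → ℕ in tensorUltrafilter ℕ, StrictMono (v ∘ ρ) := by
  have h : ∀ a b : Fin N, ∀ᶠ v : ℕ → ℕ in tensorUltrafilter ℕ, a < b → v (ρ a) < v (ρ b) := by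
    intro a b
    by_cases hab : a < b
    · exact (eventually_tensorUltrafilter_lt (hρ hab)).mono fun v hv _ => hv
    · exact Eventually.of_forall fun v h => absurd h hab
  have h' := eventually_all.2 fun a => eventually_all.2 (h a)
  exact h'.mono fun v hv a b hab => hv a b hab

/-- For almost every `v` the selected rows are increasing, so indiscernibility of the first array
gives the same type before the limit is taken. -/
theorem sameType_rowGenericEntry_aux {N : ℕ} {ρ : Fin N → ℕ} {s : Fin N → ℕ → ℕ}
    (hρ : StrictMono ρ) (hs : ∀ β, StrictMono (s β)) :
    SameType L
      (fun x : Fin N × ℕ × (ℕ → ℕ → M) => rowGenericEntry M (ρ x.1) (s x.1 x.2.1) x.2.2)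
      fun x : Fin N × ℕ × (ℕ → ℕ → M) => genericEntry M x.1 x.2.1 x.2.2 := by
  intro ψ
  unfold rowGenericEntry
  rw [Ultrapower.realize_mk]
  rw [← eventually_const (f := (tensorUltrafilter ℕ : Filter (ℕ → ℕ)))
    (p := Formula.Realize ψ fun x : Fin N × ℕ × (ℕ → ℕ → M) => genericEntry M x.1 x.2.1 x.2.2)]
  refine eventually_congr ?_
  filter_upwards [eventually_strictMono_comp hρ] with v hv
  exact sameType_genericEntry hv Fin.val_strictMono hs (fun _ => strictMono_id) ψ

theorem sameType_genericEntry_single (β β' k : ℕ) :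
    SameType L (genericEntry M β k) (genericEntry M β' k) :=
  (sameType_genericEntry (L := L) (M := M) (N := 1) (ρ := fun _ => β) (ρ' := fun _ => β')
    (s := fun _ => id) (s' := fun _ => id) (Subsingleton.strictMono _) (Subsingleton.strictMono _)
    (fun _ => strictMono_id) (fun _ => strictMono_id)).comp fun h => (0, k, h)

/-- Entries in the same column but different rows of the first array have the same type, so a
witness index found for one row serves for all, and hence in the limit. -/
theorem rowGenericEntry_witness (β k : ℕ) (ψ : L.Formula ((ℕ → ℕ → M) ⊕ Unit))
    (hψ : ∃ z, ψ.Realize (Sum.elim (rowGenericEntry M β k) fun _ => z)) :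
    ∃ h, ψ.Realize (Sum.elim (rowGenericEntry M β k) fun _ => rowGenericEntry M β k h) := by
  obtain ⟨z, hz⟩ := hψ
  obtain ⟨z, rfl⟩ := Ultrapower.mk_surjective _ z
  have h1 : (Sum.elim (rowGenericEntry M β k) fun _ => Ultrapower.mk _ z) =
      fun x => Ultrapower.mk _ ((Sum.elim (fun h v => genericEntry M (v β) k h)
        fun _ => z : (ℕ → ℕ → M) ⊕ Unit → _) x) := by
    funext x; rcases x with x | x <;> rfl
  rw [h1, Ultrapower.realize_mk] at hz
  obtain ⟨v₀, hv₀⟩ := hz.exists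
  have h2 : ∃ z, ψ.Realize (Sum.elim (genericEntry M (v₀ β) k) fun _ => z) := by
    refine ⟨z v₀, ?_⟩
    convert hv₀ using 2 with x
    rcases x with x | x <;> rfl
  obtain ⟨h, hh⟩ := genericEntry_witness _ _ ψ h2
  refine ⟨h, ?_⟩
  have h3 : (Sum.elim (rowGenericEntry M β k) fun _ => rowGenericEntry M β k h) =
      fun x => Ultrapower.mk _ (fun v => genericEntry M (v β) k
        ((Sum.elim id fun _ => h : (ℕ → ℕ → M) ⊕ Unit → _) x)) := by
    funext x; rcases x with x | x <;> rfl
  rw [h3, Ultrapower.realize_mk]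
  refine Eventually.of_forall fun v => ?_
  refine ((sameType_genericEntry_single (v₀ β) (v β) k).comp
    (Sum.elim id fun _ => h : (ℕ → ℕ → M) ⊕ Unit → _) ψ).1 ?_
  convert hh using 2 with x
  funext x
  rcases x with x | x <;> rfl

/-- The first ultrapower gives indiscernibility and a solution of column `0`. The second keeps that
solution constant while choosing rows generically, which equalizes the types of the rows over it. -/
theorem Theory.HasTP2.exists_pathArray {T : L.Theory} {n m : ℕ} {φ : L.Formula (Fin n ⊕ Fin m)}
    (h : T.HasTP2 φ) :
    ∃ (M : Theory.ModelType.{u, v, max u v} T) (ι : Type (max u v)),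
      Nonempty (PathArray (L := L) M φ ι) := by
  obtain ⟨M, a, ha, ha'⟩ := h
  obtain ⟨x, hx⟩ := exists_genericEntry_solution ha'
  let M₁ := Ultrapower (tensorUltrafilter (ℕ ×ₗ ℕ)) M
  let M₂ := Ultrapower (tensorUltrafilter ℕ) M₁
  have hM₁ : M₁ ⊨ T := ((Ultrapower.diag L (tensorUltrafilter (ℕ ×ₗ ℕ))
    (M := M)).theory_model_iff T).1 inferInstance
  have hM₂ : M₂ ⊨ T := ((Ultrapower.diag L (tensorUltrafilter ℕ) (M := M₁)).theory_model_iff T).1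
    inferInstance
  let p : Fin m → ℕ → ℕ → M := fun j α i => a α i j
  refine ⟨Theory.ModelType.of T M₂, ℕ → ℕ → M, ⟨{
    entry := rowGenericEntry M
    sol := fun i => Ultrapower.mk _ fun _ => x i
    param := p
    indiscernible := fun hρ hρ' hs hs' =>
      (sameType_rowGenericEntry_aux hρ hs).trans (sameType_rowGenericEntry_aux hρ' hs').symm
    witness := rowGenericEntry_witness
    inconsistent := ?_
    realize_sol := ?_
    sameType_row := ?_ }⟩⟩
  · rintro ⟨y, h0, h1⟩
    choose y' hy' using fun i => Ultrapower.mk_surjective _ (y i)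
    obtain rfl : (fun i => Ultrapower.mk _ (y' i)) = y := funext hy'
    have key : ∀ k, φ.Realize (Sum.elim (fun i => Ultrapower.mk _ (y' i))
        (rowGenericEntry M 0 k ∘ p)) →
        ∀ᶠ v : ℕ → ℕ in tensorUltrafilter ℕ, φ.Realize
          (Sum.elim (fun i => y' i v) fun j => genericEntry M (v 0) k fun α i => a α i j) := by
      intro k hk
      have h1 : (Sum.elim (fun i => Ultrapower.mk _ (y' i)) (rowGenericEntry M 0 k ∘ p)) =
          fun z => Ultrapower.mk _ ((Sum.elim y' fun j v => genericEntry M (v 0) k (p j) :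
            Fin n ⊕ Fin m → (ℕ → ℕ) → M₁) z) := by
        funext z; rcases z with z | z <;> rfl
      rw [h1, Ultrapower.realize_mk] at hk
      filter_upwards [hk] with v hv
      convert hv using 2 with z
      rcases z with z | z <;> rfl
    obtain ⟨v, hv0, hv1⟩ := ((key 0 h0).and (key 1 h1)).exists
    exact genericEntry_inconsistent ha _ ⟨_, hv0, hv1⟩
  · intro β
    have h1 : (Sum.elim (fun i => Ultrapower.mk _ fun _ => x i) (rowGenericEntry M β 0 ∘ p)) =
        fun z => Ultrapower.mk _ ((Sum.elim (fun i _ => x i)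
          fun j v => genericEntry M (v β) 0 (p j) : Fin n ⊕ Fin m → (ℕ → ℕ) → M₁) z) := by
      funext z; rcases z with z | z <;> rfl
    change φ.Realize (Sum.elim (fun i => Ultrapower.mk _ fun _ => x i)
      (rowGenericEntry M β 0 ∘ p))
    rw [h1, Ultrapower.realize_mk]
    refine Eventually.of_forall fun v => ?_
    convert hx (v β) using 2 with z
    rcases z with z | z <;> rfl
  · intro β γ ψ
    have h1 : ∀ β, (Sum.elim (fun i => Ultrapower.mk _ fun _ => x i) (rowGenericEntry M β 0)) =
        fun z => Ultrapower.mk _ ((Sum.elim (fun i _ => x i)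
          fun h v => genericEntry M (v β) 0 h : Fin n ⊕ (ℕ → ℕ → M) → (ℕ → ℕ) → M₁) z) := by
      intro β; funext z; rcases z with z | z <;> rfl
    change ψ.Realize (M := M₂) (Sum.elim (fun i => Ultrapower.mk _ fun _ => x i)
      (rowGenericEntry M β 0)) ↔ ψ.Realize (M := M₂) (Sum.elim
        (fun i => Ultrapower.mk _ fun _ => x i) (rowGenericEntry M γ 0))
    rw [h1, h1, Ultrapower.realize_mk, Ultrapower.realize_mk]
    let Q : (Fin 1 → ℕ) → Prop := fun t => ψ.Realize
      (Sum.elim x fun h => genericEntry M (t 0) 0 h)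
    -- The type of row `β` over the solution is a limit along the one-variable marginal at `β`,
    -- which is the same for all `β`.
    have key : ∀ β, (∀ᶠ v : ℕ → ℕ in tensorUltrafilter ℕ, ψ.Realize fun z =>
        (Sum.elim (fun i _ => x i) fun h v => genericEntry M (v β) 0 h :
          Fin n ⊕ (ℕ → ℕ → M) → (ℕ → ℕ) → M₁) z v) ↔ ∀ᶠ t in tensorPower 1, Q t := by
      intro β
      rw [← eventually_tensorUltrafilter (i := fun _ : Fin 1 => β) (Subsingleton.strictMono _) Q]
      refine eventually_congr (Eventually.of_forall fun v => ?_)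
      refine iff_of_eq (congrArg _ (funext fun z => ?_))
      rcases z with z | z <;> rfl
    rw [key β, key γ]

end Extraction

/-! ### Algebraic closure -/

section AlgebraicClosure

/-- The predicate `Q` holds for at most `k` elements. -/
def AtMost {M : Type*} (k : ℕ) (Q : M → Prop) : Prop :=
  ∀ w : Fin (k + 1) → M, (∀ i, Q (w i)) → ∃ i j, i ≠ j ∧ w i = w j

theorem AtMost.finite {M : Type*} {k : ℕ} {Q : M → Prop} (h : AtMost k Q) : {z | Q z}.Finite := by
  by_contra hinf
  obtain ⟨f⟩ : Nonempty (Fin (k + 1) ↪ {z | Q z}) := by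
    have := Set.Infinite.to_subtype hinf
    exact ⟨(Fin.valEmbedding).trans (Infinite.natEmbedding _)⟩
  obtain ⟨i, j, hij, h⟩ := h (fun i => f i) fun i => (f i).2
  exact hij (f.injective (Subtype.ext h))

theorem atMost_of_finite {M : Type*} {Q : M → Prop} (h : {z | Q z}.Finite) {k : ℕ}
    (hk : {z | Q z}.ncard ≤ k) : AtMost k Q := by
  intro w hw
  have : Set.MapsTo w (Set.univ : Set (Fin (k + 1))) {z | Q z} := fun i _ => hw i
  obtain ⟨i, _, j, _, hij, h⟩ := Set.exists_ne_map_eq_of_ncard_lt_of_maps_to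
    (by rw [Set.ncard_univ, Nat.card_fin]; omega) this h
  exact ⟨i, j, hij, h⟩

variable {L : Language.{u, v}}

theorem IsFirstOrder.atMost {α : Type*} (k : ℕ)
    {Q : ∀ (M : Type w) [L.Structure M], (α → M) → M → Prop}
    (h : IsFirstOrder L fun (M : Type w) _ (z : α ⊕ Unit → M) =>
      Q M (fun a => z (Sum.inl a)) (z (Sum.inr ()))) :
    IsFirstOrder L fun (M : Type w) _ (x : α → M) => AtMost k (Q M x) := by
  obtain ⟨φ, hφ⟩ := h
  unfold AtMost
  refine .forall_tuple (.imp (.forall_finite fun i => ?_) ?_)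
  · refine ⟨φ.relabel (Sum.elim Sum.inl fun _ => Sum.inr i), fun M _ x => ?_⟩
    rw [Formula.realize_relabel, hφ]
    rfl
  · exact .exists_finite fun i => .exists_finite fun j =>
      .and (by by_cases h : i = j
               · simpa [h] using IsFirstOrder.false
               · simpa [h] using IsFirstOrder.false.not) (.eq _ _)

theorem Formula.exists_finite_support_left {α β : Type*} (φ : L.Formula (α ⊕ β)) :
    ∃ (s : Finset α) (ψ : L.Formula (s ⊕ β)), ∀ (M : Type w) [L.Structure M] (x : α → M)
      (y : β → M), φ.Realize (Sum.elim x y) ↔ ψ.Realize (Sum.elim (fun i : s => x i) y) := by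
  classical
  obtain ⟨s, ψ, hψ⟩ := φ.exists_finite_support
  let g : s → s.toLeft ⊕ β := fun i => match i with
    | ⟨Sum.inl a, h⟩ => Sum.inl ⟨a, Finset.mem_toLeft.2 h⟩
    | ⟨Sum.inr b, _⟩ => Sum.inr b
  refine ⟨s.toLeft, ψ.relabel g, fun M _ x y => ?_⟩
  rw [hψ, Formula.realize_relabel]
  refine iff_of_eq (congrArg _ (funext fun i => ?_))
  rcases i with ⟨a | b, h⟩ <;> rfl

variable {M : Type w} [L.Structure M]

theorem subset_acl (A : Set M) : A ⊆ acl L A := fun a ha =>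
  ⟨{a}, Set.Definable.singleton_of_mem L ha, Set.finite_singleton a, rfl⟩

theorem acl_mono {A B : Set M} (h : A ⊆ B) : acl L A ⊆ acl L B := fun _ ⟨s, hs, hf, hb⟩ =>
  ⟨s, hs.mono h, hf, hb⟩

theorem mem_acl_range_iff_formula {X : Type*} {e : X → M} {z : M} :
    z ∈ acl L (Set.range e) ↔ ∃ ψ : L.Formula (X ⊕ Unit),
      {y | ψ.Realize (Sum.elim e fun _ => y)}.Finite ∧ ψ.Realize (Sum.elim e fun _ => z) := by
  constructor
  · rintro ⟨s, hs, hf, hz⟩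
    obtain ⟨φ, hφ⟩ := Set.definable_iff_exists_formula_sum.1 hs
    choose p hp using fun a : Set.range e => a.2
    have key : ∀ y, y ∈ s ↔ (φ.relabel (Sum.map p fun _ => ())).Realize
        (Sum.elim e fun _ => y) := by
      intro y
      have h1 : y ∈ s ↔ (fun _ : Fin 1 => y) ∈ {x : Fin 1 → M | x 0 ∈ s} := Iff.rfl
      rw [h1, hφ, Formula.realize_relabel]
      refine iff_of_eq (congrArg φ.Realize (funext fun i => ?_))
      rcases i with a | b
      · exact (hp a).symm
      · rfl
    refine ⟨_, ?_, (key z).1 hz⟩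
    convert hf using 1
    ext y
    exact (key y).symm
  · rintro ⟨ψ, hf, hz⟩
    refine ⟨_, ?_, hf, hz⟩
    refine Set.definable_iff_exists_formula_sum.2
      ⟨ψ.relabel (Sum.map (fun x => ⟨e x, x, rfl⟩) fun _ => 0), ?_⟩
    ext y
    change ψ.Realize _ ↔ Formula.Realize (M := M) _ _
    rw [Formula.realize_relabel]
    refine iff_of_eq (congrArg _ (funext fun i => ?_))
    rcases i with a | b <;> rfl

theorem mem_acl_of_isFirstOrder {X : Type*} {e : X → M} {z : M}
    {R : ∀ (M : Type w) [L.Structure M], (X ⊕ Unit → M) → Prop} (hR : IsFirstOrder L R)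
    (hf : {y | R M (Sum.elim e fun _ => y)}.Finite) (hz : R M (Sum.elim e fun _ => z)) :
    z ∈ acl L (Set.range e) := by
  obtain ⟨ψ, hψ⟩ := hR
  refine mem_acl_range_iff_formula.2 ⟨ψ, ?_, (hψ M _).2 hz⟩
  simpa only [hψ] using hf

/-- With an explicit bound `k`, finiteness is a first-order condition on the parameters and can be
transferred. -/
theorem mem_acl_range {X : Type*} {e : X → M} {z : M} :
    z ∈ acl L (Set.range e) ↔ ∃ (ψ : L.Formula (X ⊕ Unit)) (k : ℕ),
      AtMost k (fun y => ψ.Realize (Sum.elim e fun _ => y)) ∧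
        ψ.Realize (Sum.elim e fun _ => z) := by
  rw [mem_acl_range_iff_formula]
  exact exists_congr fun ψ => ⟨fun h => ⟨_, atMost_of_finite h.1 le_rfl, h.2⟩,
    fun ⟨k, h⟩ => ⟨h.1.finite, h.2⟩⟩

theorem isFirstOrder_atMost_realize {X : Type*} (ψ : L.Formula (X ⊕ Unit)) (k : ℕ) :
    IsFirstOrder L fun (M : Type w) _ (x : X → M) =>
      AtMost k fun y => ψ.Realize (Sum.elim x fun _ => y) :=
  .atMost k (.of_formula ψ id fun M x b => by rcases b with b | b <;> rfl)

theorem acl_acl_subset (A : Set M) : acl L (acl L A) ⊆ acl L A := by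
  intro z hz
  have h1 : Set.range (Subtype.val : acl L A → M) = acl L A := Subtype.range_val
  have h2 : Set.range (Subtype.val : A → M) = A := Subtype.range_val
  rw [← h1] at hz
  obtain ⟨ψ, k, hk, hz⟩ := mem_acl_range.1 hz
  obtain ⟨P, ψ', hψ'⟩ := ψ.exists_finite_support_left.{u, v, w}
  have hP : ∀ p : P, ∃ θ : L.Formula (A ⊕ Unit),
      {y | θ.Realize (Sum.elim Subtype.val fun _ => y)}.Finite ∧
        θ.Realize (Sum.elim Subtype.val fun _ => (p.1 : M)) := fun p =>
    mem_acl_range_iff_formula.1 (by rw [h2]; exact p.1.2)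
  choose θ hθf hθ using hP
  rw [← h2]
  -- Quantify over the finitely many candidates `w` for the algebraic parameters. Including the
  -- bound `AtMost k` keeps the fibre over every candidate finite.
  refine mem_acl_of_isFirstOrder (R := fun N _ x => ∃ w : P → N,
    (∀ p, (θ p).Realize (Sum.elim (fun a => x (Sum.inl a)) fun _ => w p)) ∧
      AtMost k (fun y => ψ'.Realize (Sum.elim w fun _ => y)) ∧
        ψ'.Realize (Sum.elim w fun _ => x (Sum.inr ()))) ?_ ?_ ?_
  · refine .exists_tuple (.and (.forall_finite fun p => ?_) (.and (.atMost k ?_) ?_))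
    · exact .of_formula (θ p) (Sum.elim (Sum.inl ∘ Sum.inl) fun _ => Sum.inr p)
        fun M x b => by rcases b with b | b <;> rfl
    · exact .of_formula ψ' (Sum.elim (Sum.inl ∘ Sum.inr) fun _ => Sum.inr ())
        fun M x b => by rcases b with b | b <;> rfl
    · exact .of_formula ψ' (Sum.elim Sum.inr fun _ => Sum.inl (Sum.inr ()))
        fun M x b => by rcases b with b | b <;> rfl
  · have hfin : {w : P → M | ∀ p, (θ p).Realize (Sum.elim Subtype.val fun _ => w p)}.Finite := by
      have := Set.Finite.pi' fun p => hθf p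
      exact this
    refine (hfin.biUnion (t := fun w => {y | AtMost k
      (fun y => ψ'.Realize (Sum.elim w fun _ => y)) ∧ ψ'.Realize (Sum.elim w fun _ => y)})
      fun w _ => ?_).subset ?_
    · by_cases hw : AtMost k (fun y => ψ'.Realize (Sum.elim w fun _ => y))
      · exact hw.finite.subset fun y hy => hy.2
      · exact Set.finite_empty.subset fun y hy => hw hy.1
    · rintro y ⟨w, hw, hk, hy⟩
      exact Set.mem_biUnion (show w ∈ {w : P → M | _} from hw) ⟨hk, hy⟩
  · refine ⟨fun p => p.1, hθ, ?_, (hψ' M _ _).1 hz⟩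
    intro w hw
    exact hk w fun i => (hψ' M _ _).2 (hw i)

theorem acl_subset_of_subset_acl {A B : Set M} (h : A ⊆ acl L B) : acl L A ⊆ acl L B :=
  (acl_mono h).trans (acl_acl_subset B)

/-- A tuple closed under witnesses enumerates an algebraically closed set. -/
theorem acl_range_subset_of_witness {X : Type*} {e : X → M}
    (h : ∀ ψ : L.Formula (X ⊕ Unit), (∃ z, ψ.Realize (Sum.elim e fun _ => z)) →
      ∃ i, ψ.Realize (Sum.elim e fun _ => e i)) : acl L (Set.range e) ⊆ Set.range e := by
  intro z hz
  by_contra hze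
  obtain ⟨ψ, hf, hz⟩ := mem_acl_range_iff_formula.1 hz
  have hf' : ({y | ψ.Realize (Sum.elim e fun _ => y)} ∩ Set.range e).Finite := hf.inter_of_left _
  choose p hp using fun y : ↥({y | ψ.Realize (Sum.elim e fun _ => y)} ∩ Set.range e) => y.2.2
  have := hf'.to_subtype
  obtain ⟨θ, hθ⟩ : IsFirstOrder L fun (M : Type w) _ (x : X ⊕ Unit → M) =>
      ψ.Realize (fun i => x i) ∧ ∀ y, ¬ x (Sum.inr ()) = x (Sum.inl (p y)) :=
    .and (.of_formula ψ id fun _ _ _ => rfl) (.forall_finite fun y => .not (.eq _ _))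
  obtain ⟨i, hi⟩ := h θ ⟨z, (hθ M _).2 ⟨hz, fun y hy => hze ⟨_, hy.symm⟩⟩⟩
  have hi' := (hθ M _).1 hi
  exact hi'.2 ⟨e i, hi'.1, i, rfl⟩ (hp ⟨e i, hi'.1, i, rfl⟩).symm

/-- The finite solution set of an algebraic formula over `x` is listed by finitely many coordinates
of `x`; that the list is complete is a first-order property of `x`. -/
theorem acl_range_subset_of_sameType {N : Type w} [L.Structure N] {X : Type*} {x : X → M}
    {y : X → N} (h : SameType L x y) (hx : acl L (Set.range x) ⊆ Set.range x) :
    acl L (Set.range y) ⊆ Set.range y := by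
  intro z hz
  obtain ⟨ψ, k, hk, hz⟩ := mem_acl_range.1 hz
  have hk' := ((isFirstOrder_atMost_realize ψ k).transfer h).2 hk
  have hf := hk'.finite
  have hsub : ∀ y : {y | ψ.Realize (Sum.elim x fun _ => y)}, ∃ i, x i = y := fun y =>
    hx (mem_acl_range.2 ⟨ψ, k, hk', y.2⟩)
  choose p hp using hsub
  have := hf.to_subtype
  have hR : IsFirstOrder L fun (M : Type w) _ (x : X → M) =>
      ∀ z, ψ.Realize (Sum.elim x fun _ => z) → ∃ i, z = x (p i) :=
    .forall_elem (.imp (.of_formula ψ id fun M x b => by rcases b with b | b <;> rfl)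
      (.exists_finite fun i => .eq _ _))
  obtain ⟨i, hi⟩ := (hR.transfer h).1 (fun z hz => ⟨⟨z, hz⟩, (hp ⟨z, hz⟩).symm⟩) z hz
  exact ⟨_, hi.symm⟩

theorem ElementaryEmbedding.acl_range_subset {N : Type w} [L.Structure N] (f : M ↪ₑ[L] N) :
    acl L (Set.range f) ⊆ Set.range f := by
  have h : SameType L (id : M → M) f := f.sameType id
  exact acl_range_subset_of_sameType h (by simp)

end AlgebraicClosure

/-! ### Transversals -/

section Transversal

/-- The tuple `t` meets every element of `X`. -/
def Hits {M κ ι : Type*} (X : Set (κ → M)) (t : ι → M) : Prop :=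
  ∀ w ∈ X, ∃ k i, w k = t i

/-- Fix `w ∈ X`. A transversal contains some `w k`, and deleting this entry leaves a transversal of
the tuples in `X` that avoid `w k`. Those have no transversal shorter than `n`, since adjoining `w
k` would give a forbidden one for `X`; so induction applies to each of the finitely many choices. -/
theorem finite_hits_of_minimal {M κ : Type*} [Finite κ] {n : ℕ} : ∀ {X : Set (κ → M)},
    (∀ m < n, ∀ t : Fin m → M, ¬ Hits X t) → {t : Fin n → M | Hits X t}.Finite := by
  induction n with
  | zero => exact fun _ => Set.toFinite _
  | succ n ih =>
    intro X hX
    obtain ⟨w, hw⟩ : X.Nonempty := by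
      by_contra h
      rw [Set.not_nonempty_iff_eq_empty] at h
      exact hX 0 n.succ_pos Fin.elim0 (by rw [h]; exact fun w hw => hw.elim)
    let Y : κ → Set (κ → M) := fun k => {w' ∈ X | ∀ k', w' k' ≠ w k}
    have hY : ∀ k, {t : Fin n → M | Hits (Y k) t}.Finite := fun k => ih fun m hm t ht => by
      refine hX (m + 1) (by omega) (Fin.cons (w k) t) fun w' hw' => ?_
      by_cases h : ∀ k', w' k' ≠ w k
      · obtain ⟨k', i, hi⟩ := ht w' ⟨hw', h⟩
        exact ⟨k', i.succ, by simpa using hi⟩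
      · push Not at h
        obtain ⟨k', hk'⟩ := h
        exact ⟨k', 0, by simpa using hk'⟩
    refine (Set.finite_iUnion fun k : κ => Set.finite_iUnion fun i : Fin (n + 1) =>
      (hY k).image fun t => i.insertNth (α := fun _ => M) (w k) t).subset fun t ht => ?_
    obtain ⟨k, i, hi⟩ := ht w hw
    refine Set.mem_iUnion.2 ⟨k, Set.mem_iUnion.2 ⟨i, i.removeNth t, ?_, ?_⟩⟩
    · rintro w' ⟨hw', hne⟩
      obtain ⟨k', j, hj⟩ := ht w' hw'
      have hji : j ≠ i := by
        rintro rfl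
        exact hne k' (hj.trans hi.symm)
      obtain ⟨j, rfl⟩ := Fin.exists_succAbove_eq hji
      exact ⟨k', j, hj⟩
    · simp only [hi]
      exact Fin.insertNth_self_removeNth i t

variable {L : Language.{u, v}}

theorem IsFirstOrder.hits {α κ ι : Type*} [Finite κ] [Finite ι]
    {Q : ∀ (M : Type w) [L.Structure M], (α → M) → (κ → M) → Prop}
    {F : ∀ (M : Type w), (α → M) → ι → M} (g : ι → α)
    (hg : ∀ (M : Type w) (x : α → M) i, F M x i = x (g i))
    (h : IsFirstOrder L fun (M : Type w) _ (z : α ⊕ κ → M) =>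
      Q M (fun a => z (Sum.inl a)) (fun b => z (Sum.inr b))) :
    IsFirstOrder L fun (M : Type w) _ (x : α → M) => Hits {w | Q M x w} (F M x) := by
  simp only [Hits, Set.mem_ofPred_eq, hg]
  exact .forall_tuple (.imp h (.exists_finite fun k => .exists_finite fun i => .eq _ _))

variable {M : Type w} [L.Structure M]

/-- The entries of the transversals of least size form a finite set definable over `e`, and every
solution meets it. -/
theorem exists_mem_acl_of_hits {X κ : Type*} [Finite κ] {e : X → M}
    {R : ∀ (M : Type w) [L.Structure M], (X ⊕ κ → M) → Prop} (hR : IsFirstOrder L R)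
    {n : ℕ} {t : Fin n → M} (ht : Hits {w | R M (Sum.elim e w)} t) {w : κ → M}
    (hw : R M (Sum.elim e w)) : ∃ k, w k ∈ acl L (Set.range e) := by
  classical
  have hex : ∃ n, ∃ t : Fin n → M, Hits {w | R M (Sum.elim e w)} t := ⟨n, t, ht⟩
  obtain ⟨t, ht⟩ := Nat.find_spec hex
  have hfin := finite_hits_of_minimal (X := {w | R M (Sum.elim e w)}) (n := Nat.find hex)
    fun m hm t ht => Nat.find_min hex hm ⟨t, ht⟩
  generalize Nat.find hex = n at t ht hfin
  obtain ⟨k, i, hki⟩ := ht w hw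
  refine ⟨k, mem_acl_of_isFirstOrder (R := fun M _ x => ∃ t : Fin n → M,
    Hits {w | R M (Sum.elim (fun a => x (Sum.inl a)) w)} t ∧ ∃ i, x (Sum.inr ()) = t i) ?_ ?_
    ⟨t, ht, i, hki⟩⟩
  · obtain ⟨φ, hφ⟩ := hR
    simp only [← hφ]
    refine .exists_tuple (.and (.hits Sum.inr (fun _ _ _ => rfl) ?_)
      (.exists_finite fun i => .eq _ _))
    exact .of_formula φ (Sum.elim (Sum.inl ∘ Sum.inl ∘ Sum.inl) Sum.inr)
      fun M x b => by rcases b with b | b <;> rfl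
  · refine (hfin.biUnion fun t _ => Set.finite_range t).subset ?_
    rintro y ⟨t, ht, i, hi⟩
    exact Set.mem_biUnion ht ⟨i, hi.symm⟩

/-- A definable condition with a nonalgebraic solution has solutions outside every finite set. -/
theorem exists_solution_avoiding {X κ : Type*} [Finite κ] {e : X → M}
    {R : ∀ (M : Type w) [L.Structure M], (X ⊕ κ → M) → Prop} (hR : IsFirstOrder L R)
    {w : κ → M} (hw : R M (Sum.elim e w)) (hacl : ∀ k, w k ∉ acl L (Set.range e))
    {F : Set M} (hF : F.Finite) : ∃ w' : κ → M, R M (Sum.elim e w') ∧ ∀ k, w' k ∉ F := by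
  by_contra! h
  obtain ⟨n, t, -, rfl⟩ := hF.fin_param
  have : Hits {w | R M (Sum.elim e w)} t := fun w' hw' => by
    obtain ⟨k, i, hi⟩ := h w' hw'
    exact ⟨k, i, hi.symm⟩
  obtain ⟨k, hk⟩ := exists_mem_acl_of_hits hR this hw
  exact hacl k hk

end Transversal

/-! ### Uniform bounds on transversals -/

section Bound

variable {L : Language.{u, v}} {T : L.Theory}

theorem Theory.EliminatesExistsInfty.exists_bound (hT : T.EliminatesExistsInfty) {α : Type*}
    [Finite α] (φ : L.Formula (α ⊕ Unit)) : ∃ k : ℕ,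
      ∀ (M : Theory.ModelType.{u, v, max u v} T) (c : α → M),
        {a : M | φ.Realize (Sum.elim c fun _ => a)}.Finite →
          {a : M | φ.Realize (Sum.elim c fun _ => a)}.ncard ≤ k := by
  obtain ⟨m, ⟨e⟩⟩ := Finite.exists_equiv_fin α
  obtain ⟨k, hk⟩ := hT m (φ.relabel (Sum.map e fun _ => 0))
  refine ⟨k, fun M c => ?_⟩
  convert hk M (c ∘ e.symm) using 5
  all_goals
    rw [Formula.realize_relabel]
    refine iff_of_eq (congrArg φ.Realize (funext fun i => ?_))
    rcases i with a | b <;> simp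

theorem exists_tuple_of_ncard_le {M : Type*} [Nonempty M] {F : Set M} (hF : F.Finite) {t : ℕ}
    (ht : F.ncard ≤ t) : ∃ e : Fin t → M, F ⊆ Set.range e := by
  classical
  obtain ⟨n, e, he, rfl⟩ := hF.fin_param
  have hn : n ≤ t := by
    rwa [Set.ncard_eq_toFinset_card', Set.toFinset_range, Finset.card_image_of_injective _ he,
      Finset.card_univ, Fintype.card_fin] at ht
  refine ⟨fun i => if h : i.1 < n then e ⟨i, h⟩ else Classical.arbitrary M, ?_⟩
  rintro _ ⟨i, rfl⟩
  exact ⟨⟨i, i.2.trans_le hn⟩, by simp⟩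

theorem Hits.exists_minimal {M κ : Type*} {X : Set (κ → M)} {n : ℕ} {t : Fin n → M}
    (ht : Hits X t) : ∃ j ≤ n, (∀ i < j, ∀ e : Fin i → M, ¬ Hits X e) ∧ ∃ e : Fin j → M,
      Hits X e := by
  classical
  have hex : ∃ j, ∃ e : Fin j → M, Hits X e := ⟨n, t, ht⟩
  exact ⟨Nat.find hex, Nat.find_min' hex ⟨t, ht⟩, fun i hi e he => Nat.find_min hex hi ⟨e, he⟩,
    Nat.find_spec hex⟩

/-- If `T` eliminates `∃^∞`, then the definable sets of tuples in a uniform family that have a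
finite transversal have one of bounded size. -/
theorem Theory.EliminatesExistsInfty.exists_hits_bound (hT : T.EliminatesExistsInfty) (n : ℕ) :
    ∀ {α : Type} [Finite α]
      {R : ∀ (M : Type (max u v)) [L.Structure M], (α → M) → (Fin n → M) → Prop},
      (IsFirstOrder L fun (M : Type (max u v)) _ (x : α ⊕ Fin n → M) =>
        R M (fun a => x (Sum.inl a)) fun i => x (Sum.inr i)) →
      ∃ t : ℕ, ∀ (M : Theory.ModelType.{u, v, max u v} T) (c : α → M),
        (∃ (m : ℕ) (e : Fin m → M), Hits {w | R M c w} e) →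
          ∃ e : Fin t → M, Hits {w | R M c w} e := by
  induction n with
  | zero =>
    intro α _ R _
    refine ⟨0, fun M c ⟨m, e, he⟩ => ⟨Fin.elim0, fun w hw => ?_⟩⟩
    obtain ⟨k, _⟩ := he w hw
    exact k.elim0
  | succ n ih =>
    intro α _ R hR
    obtain ⟨φ, hφ⟩ := hR
    have hφ' : ∀ (M : Type (max u v)) [L.Structure M] (c : α → M) (w : Fin (n + 1) → M),
        R M c w ↔ φ.Realize (Sum.elim c w) := fun M _ c w => (hφ M (Sum.elim c w)).symm
    let Fib : ∀ (M : Type (max u v)) [L.Structure M], (α → M) → M → (Fin n → M) → Prop :=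
      fun M _ c a w => φ.Realize (Sum.elim c (Fin.cons a w))
    have hFib : ∀ {β : Type} (g : α → β) (b : β) (h : Fin n → β), IsFirstOrder L
        fun (M : Type (max u v)) _ (x : β → M) =>
          Fib M (fun a => x (g a)) (x b) fun i => x (h i) := fun g b h =>
      .of_formula φ (Sum.elim g (Fin.cons b h)) fun M x i => by
        rcases i with i | i
        · rfl
        · refine Fin.cases ?_ (fun i => ?_) i <;> simp
    -- Split off the first coordinate `a`: fibres over `a` with any finite transversal have one of
    -- size `t₀`, uniformly in `a` and the parameters.
    obtain ⟨t₀, ht₀⟩ := ih (α := α ⊕ Unit)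
      (R := fun M _ x w => Fib M (fun a => x (Sum.inl a)) (x (Sum.inr ())) w)
      (hFib (Sum.inl ∘ Sum.inl) (Sum.inl (Sum.inr ())) Sum.inr)
    have hHits : ∀ {β : Type} (j : ℕ) (g : α → β) (b : β) (s : Fin j → β), IsFirstOrder L
        fun (M : Type (max u v)) _ (x : β → M) =>
          Hits {w | Fib M (fun a => x (g a)) (x b) w} fun i => x (s i) := fun j g b s =>
      .hits s (fun _ _ _ => rfl) (hFib (Sum.inl ∘ g) (Sum.inl b) Sum.inr)
    have hEx : ∀ {β : Type} (j : ℕ) (g : α → β) (b : β), IsFirstOrder L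
        fun (M : Type (max u v)) _ (x : β → M) =>
          ∃ e : Fin j → M, Hits {w | Fib M (fun a => x (g a)) (x b) w} e := fun j g b =>
      .exists_tuple (hHits j (Sum.inl ∘ g) (Sum.inl b) Sum.inr)
    -- `Z M c a` is the set of entries of the least-size transversals of the fibre over `a`,
    -- provided that size is at most `t₀`. It is finite and uniformly definable.
    let Z : ∀ (M : Type (max u v)) [L.Structure M], (α → M) → M → M → Prop := fun M _ c a z =>
      ∃ j : Fin (t₀ + 1), (∀ i : Fin j, ¬ ∃ e : Fin i → M, Hits {w | Fib M c a w} e) ∧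
        ∃ e : Fin j → M, Hits {w | Fib M c a w} e ∧ ∃ i, z = e i
    have hZ : ∀ {β : Type} (g : α → β) (b z : β), IsFirstOrder L
        fun (M : Type (max u v)) _ (x : β → M) =>
          Z M (fun a => x (g a)) (x b) (x z) := fun g b z =>
      .exists_finite fun j => .and (.forall_finite fun i => .not (hEx _ g b))
        (.exists_tuple (.and (hHits _ (Sum.inl ∘ g) (Sum.inl b) Sum.inr)
          (.exists_finite fun i => .eq _ _)))
    -- `χ` defines the first coordinates whose fibre has no transversal of size `t₀`. They all lie
    -- in any given global transversal, so elimination of `∃^∞` bounds their number by `K`.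
    obtain ⟨χ, hχ⟩ := (hEx (β := α ⊕ Unit) t₀ Sum.inl (Sum.inr ())).not
    obtain ⟨K, hK⟩ := hT.exists_bound χ
    -- For each `k`, induction also bounds transversals of the tails whose coordinate `k` lies in
    -- `Z` of a good fibre. The sum of these bounds and `K` is the final bound.
    choose t ht using fun k : Fin n => ih (α := α)
      (R := fun M _ c w => ∃ a : M, Fib M c a w ∧
        (∃ e : Fin t₀ → M, Hits {w | Fib M c a w} e) ∧ Z M c a (w k))
      (.exists_elem (.and (hFib (Sum.inl ∘ Sum.inl) (Sum.inr ()) (Sum.inl ∘ Sum.inr))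
        (.and (hEx t₀ (Sum.inl ∘ Sum.inl) (Sum.inr ()))
          (hZ (Sum.inl ∘ Sum.inl) (Sum.inr ()) (Sum.inl (Sum.inr k))))))
    refine ⟨K + ∑ k, t k, fun M c ⟨m, e, he⟩ => ?_⟩
    simp only [hφ'] at he ⊢
    let Y : Set M := {a | ¬ ∃ e : Fin t₀ → M, Hits {w | Fib M c a w} e}
    have hfib : ∀ a ∉ Set.range e, Hits {w | Fib M c a w} e := fun a ha w hw => by
      obtain ⟨k, i, hi⟩ := he _ hw
      rcases Fin.eq_zero_or_eq_succ k with rfl | ⟨k, rfl⟩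
      · exact absurd ⟨i, hi.symm⟩ ha
      · exact ⟨k, i, by simpa using hi⟩
    have hYe : Y ⊆ Set.range e := fun a ha => by
      by_contra hae
      exact ha (ht₀ M (Sum.elim c fun _ => a) ⟨m, e, hfib a hae⟩)
    have hYf : Y.Finite := (Set.finite_range e).subset hYe
    have hYeq : {a : M | χ.Realize (Sum.elim c fun _ => a)} = Y := by
      ext a
      exact hχ M _
    have hYK : Y.ncard ≤ K := hYeq ▸ hK M c (hYeq ▸ hYf)
    have hZf : ∀ a, {z | Z M c a z}.Finite := fun a => by
      refine (Set.finite_iUnion fun j : Fin (t₀ + 1) => ?_ : (⋃ j : Fin (t₀ + 1),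
        {z | (∀ i : Fin j, ¬ ∃ e : Fin i → M, Hits {w | Fib M c a w} e) ∧
          ∃ e : Fin j → M, Hits {w | Fib M c a w} e ∧ ∃ i, z = e i}).Finite).subset
        fun z ⟨j, hj⟩ => Set.mem_iUnion.2 ⟨j, hj⟩
      by_cases hmin : ∀ i : Fin j, ¬ ∃ e : Fin i → M, Hits {w | Fib M c a w} e
      · refine ((finite_hits_of_minimal (X := {w | Fib M c a w}) (n := j)
          fun i hi e he => hmin ⟨i, hi⟩ ⟨e, he⟩).biUnion fun e _ => Set.finite_range e).subset ?_
        rintro z ⟨_, e, he, i, hi⟩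
        exact Set.mem_biUnion he ⟨i, hi.symm⟩
      · exact Set.finite_empty.subset fun z hz => hmin hz.1
    have hproj : ∀ k : Fin n, ∃ e' : Fin (t k) → M, Hits {w | ∃ a : M, Fib M c a w ∧
        (∃ e : Fin t₀ → M, Hits {w | Fib M c a w} e) ∧ Z M c a (w k)} e' := fun k => by
      refine ht k M c ?_
      have hF : (Set.range e ∪ ⋃ i, {z | Z M c (e i) z}).Finite :=
        (Set.finite_range e).union (Set.finite_iUnion fun i => hZf _)
      obtain ⟨e', he'⟩ := exists_tuple_of_ncard_le hF le_rfl
      refine ⟨_, e', fun w hw => ?_⟩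
      obtain ⟨a, ha, -, haZ⟩ := hw
      -- Over `a` in the given transversal `e`, the coordinate `w k` lies in one of finitely many
      -- finite sets `Z`; over any other `a`, the fibre itself is hit by `e`.
      by_cases hae : a ∈ Set.range e
      · obtain ⟨i, rfl⟩ := hae
        obtain ⟨j, hj⟩ := he' (Or.inr (Set.mem_iUnion.2 ⟨i, haZ⟩))
        exact ⟨k, j, hj.symm⟩
      · obtain ⟨k', i, hi⟩ := hfib a hae w ha
        obtain ⟨j, hj⟩ := he' (Or.inl ⟨i, rfl⟩)
        exact ⟨k', j, hi.trans hj.symm⟩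
    choose e' he' using hproj
    have hU : (⋃ k, Set.range (e' k)).Finite := Set.finite_iUnion fun k => Set.finite_range _
    have hUc : (⋃ k, Set.range (e' k)).ncard ≤ ∑ k, t k := by
      refine (Set.ncard_iUnion_le_of_fintype _).trans (Finset.sum_le_sum fun k _ => ?_)
      rw [← Set.image_univ]
      refine (Set.ncard_image_le Set.finite_univ).trans ?_
      simp
    obtain ⟨f, hf⟩ := exists_tuple_of_ncard_le (hYf.union hU)
      ((Set.ncard_union_le _ _).trans (add_le_add hYK hUc))
    refine ⟨f, fun w hw => ?_⟩
    have hw' : Fib M c (w 0) (Fin.tail w) := by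
      simp only [Fib, Fin.cons_self_tail]
      exact hw
    by_cases hwY : w 0 ∈ Y
    · obtain ⟨j, hj⟩ := hf (Or.inl hwY)
      exact ⟨0, j, hj.symm⟩
    · have hwY' := not_not.1 hwY
      obtain ⟨g, hg⟩ := hwY'
      obtain ⟨j, hj, hmin, g', hg'⟩ := hg.exists_minimal
      obtain ⟨k, i, hi⟩ := hg' _ hw'
      obtain ⟨k', i', hi'⟩ := he' k (Fin.tail w) ⟨w 0, hw', ⟨g, hg⟩, ⟨j, Nat.lt_succ_of_le hj⟩,
        fun i ⟨e, he⟩ => hmin i i.2 e he, g', hg', i, hi⟩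
      obtain ⟨l, hl⟩ := hf (Or.inr (Set.mem_iUnion.2 ⟨k, i', rfl⟩))
      exact ⟨k'.succ, l, hi'.trans hl.symm⟩

/-- If `T` eliminates `∃^∞`, then the existence of a nonalgebraic solution is a first-order
property. -/
theorem Theory.EliminatesExistsInfty.exists_expressesNonalgebraicSolution
    (hT : T.EliminatesExistsInfty) (S : L.Formula (Fin 1)) {m n : ℕ}
    (φ : L.Formula (Fin m ⊕ Fin n)) :
    ∃ χ : L.Formula (Fin m), T.ExpressesNonalgebraicSolution S φ χ := by
  classical
  let R : ∀ (M : Type (max u v)) [L.Structure M], (Fin m → M) → (Fin n → M) → Prop :=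
    fun M _ c w => φ.Realize (Sum.elim c w) ∧ (∀ i, S.Realize fun _ => w i) ∧
      ∀ i j, w i = w j → i = j
  have hR : ∀ {β : Type} (g : Fin m → β) (h : Fin n → β), IsFirstOrder L
      fun (M : Type (max u v)) _ (x : β → M) => R M (fun i => x (g i)) fun i => x (h i) :=
    fun g h => .and (.of_formula φ (Sum.elim g h) fun M x b => by rcases b with b | b <;> rfl)
      (.and (.forall_finite fun i => .of_formula S (fun _ => h i) fun _ _ _ => rfl)
        (.forall_finite fun i => .forall_finite fun j => .imp (.eq _ _)
          (by by_cases h : i = j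
              · simpa [h] using IsFirstOrder.false.not
              · simpa [h] using IsFirstOrder.false)))
  obtain ⟨t, ht⟩ := hT.exists_hits_bound n (hR Sum.inl Sum.inr)
  obtain ⟨χ, hχ⟩ : IsFirstOrder L fun (M : Type (max u v)) _ (c : Fin m → M) =>
      ¬ ∃ e : Fin t → M, Hits {w | R M c w} e :=
    .not (.exists_tuple (.hits Sum.inr (fun _ _ _ => rfl) (hR (Sum.inl ∘ Sum.inl) Sum.inr)))
  refine ⟨χ, fun M c => ?_⟩
  rw [hχ]
  constructor
  · intro h
    -- Without a transversal of size `t` there is no finite one, so solutions avoid every finite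
    -- subset of `M`. In an ultrapower along the finite subsets their limit lies outside `M`, which
    -- is algebraically closed.
    have havoid : ∀ F : Finset M, ∃ w, R M c w ∧ ∀ i, w i ∉ F := by
      intro F
      by_contra! hF
      refine h (ht M c ?_)
      obtain ⟨e, he⟩ := exists_tuple_of_ncard_le F.finite_toSet le_rfl
      refine ⟨_, e, fun w hw => ?_⟩
      obtain ⟨i, hi⟩ := hF w hw
      obtain ⟨j, hj⟩ := he hi
      exact ⟨i, j, hj.symm⟩
    choose w hw hwF using havoid
    let U : Ultrafilter (Finset M) := Ultrafilter.of atTop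
    have hU : (U : Filter (Finset M)) ≤ atTop := Ultrafilter.of_le _
    refine ⟨Ultrapower U M, inferInstance, Ultrapower.diag L U,
      fun i => Ultrapower.mk U fun F => w F i, ?_, ?_, ?_, ?_⟩
    · have h1 : (Sum.elim (Ultrapower.diag L U ∘ c) fun i => Ultrapower.mk U fun F => w F i) =
          fun x => Ultrapower.mk U ((Sum.elim (fun j _ => c j) fun i F => w F i :
            Fin m ⊕ Fin n → Finset M → M) x) := by
        funext x; rcases x with x | x <;> rfl
      rw [h1, Ultrapower.realize_mk]
      refine Eventually.of_forall fun F => ?_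
      convert (hw F).1 using 2 with x
      rcases x with x | x <;> rfl
    · intro i hi
      have h1 : Set.range (Ultrapower.diag L U ∘ c) ⊆ Set.range (Ultrapower.diag L U (M := M)) :=
        Set.range_comp_subset_range _ _
      obtain ⟨a, ha⟩ := (Ultrapower.diag L U (M := M)).acl_range_subset (acl_mono h1 hi)
      rw [Ultrapower.diag_apply, Ultrapower.mk_eq_mk] at ha
      obtain ⟨F, hF, hF'⟩ := (ha.and (hU (eventually_ge_atTop {a}))).exists
      exact hwF F i (hF ▸ Finset.singleton_subset_iff.1 hF')
    · intro i
      rw [Ultrapower.realize_mk (L := L) U S fun _ F => w F i]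
      exact Eventually.of_forall fun F => (hw F).2.1 i
    · intro i j hij
      rw [Ultrapower.mk_eq_mk] at hij
      obtain ⟨F, hF⟩ := hij.exists
      exact (hw F).2.2 i j hF
  · rintro ⟨N, _, g, a, ha, hacl, haS, hinj⟩ ⟨e, he⟩
    -- A transversal in `M` remains one in the elementary extension, forcing some coordinate of
    -- every solution there to be algebraic over the parameters.
    have hfo : IsFirstOrder L fun (M : Type (max u v)) _ (x : Fin m ⊕ Fin t → M) =>
        Hits {w | R M (fun i => x (Sum.inl i)) w} fun j => x (Sum.inr j) :=
      .hits Sum.inr (fun _ _ _ => rfl) (hR (Sum.inl ∘ Sum.inl) Sum.inr)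
    have he' := (hfo.transfer (g.sameType (Sum.elim c e))).1 he
    obtain ⟨k, hk⟩ := exists_mem_acl_of_hits (e := g ∘ c) (hR Sum.inl Sum.inr)
      (t := g ∘ e) he' (w := a) ⟨ha, haS, fun i j h => hinj h⟩
    exact hacl k hk

end Bound

/-! ### Types in models with a generic predicate -/

section GenericModels

variable {L : Language.{u, v}} {T : L.Theory} {S : L.Formula (Fin 1)}

section Model

variable {M : Type w} [L.Structure M] [L.withPredicate.Structure M]
  [(LHom.sumInl : L →ᴸ L.withPredicate).IsExpansionOn M]

theorem Theory.model_of_model_genericPredicate (hM : M ⊨ T.genericPredicate S) : M ⊨ T :=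
  (LHom.onTheory_model (LHom.sumInl : L →ᴸ L.withPredicate) T).1
    (hM.mono (Set.subset_union_left.trans Set.subset_union_left))

theorem Theory.realize_of_inPredicate (hM : M ⊨ T.genericPredicate S) {a : M}
    (ha : InPredicate L a) : S.Realize fun _ => a :=
  (realize_predicateSubset S).1 (hM.realize_of_mem _ (Or.inl (Or.inr rfl))) a ha

end Model

variable {N M : Type (max u v)} [L.Structure N] [Nonempty N] [L.Structure M]
  [L.withPredicate.Structure M] [(LHom.sumInl : L →ᴸ L.withPredicate).IsExpansionOn M]

/-- The nonalgebraic solution in `N` makes `χ` true at `c`, with `N` as its own elementary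
extension. Then `χ` holds at `c'`, where the genericity axiom supplies the colouring. -/
theorem Theory.exists_realize_pattern (hT : T.EliminatesExistsInfty) (hN : N ⊨ T)
    (hM : M ⊨ T.genericPredicate S) {B C : Type*} [Finite B] [Finite C]
    (φ : L.Formula (B ⊕ C)) {c : B → N} {a : C → N} {c' : B → M} (hc : SameType L c c')
    (ha : φ.Realize (Sum.elim c a)) (hacl : ∀ i, a i ∉ acl L (Set.range c))
    (haS : ∀ i, S.Realize fun _ => a i) (hinj : Function.Injective a) (I : Set C) :
    ∃ a' : C → M, φ.Realize (Sum.elim c' a') ∧ ∀ i, InPredicate L (a' i) ↔ i ∈ I := by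
  obtain ⟨m, ⟨eB⟩⟩ := Finite.exists_equiv_fin B
  obtain ⟨n, ⟨eC⟩⟩ := Finite.exists_equiv_fin C
  have hMT : M ⊨ T := Theory.model_of_model_genericPredicate hM
  obtain ⟨χ, hχ⟩ := hT.exists_expressesNonalgebraicSolution S (φ.relabel (Sum.map eB eC))
  have key : ∀ {K : Type (max u v)} [L.Structure K] (c : B → K) (a : C → K),
      (φ.relabel (Sum.map eB eC)).Realize (Sum.elim (c ∘ eB.symm) (a ∘ eC.symm)) ↔
        φ.Realize (Sum.elim c a) := by
    intro K _ c a
    rw [Formula.realize_relabel]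
    refine iff_of_eq (congrArg φ.Realize (funext fun i => ?_))
    rcases i with i | i <;> simp
  have h1 : χ.Realize (c ∘ eB.symm) := by
    refine (hχ (Theory.ModelType.of T N) _).2 ⟨N, inferInstance, ElementaryEmbedding.refl L N,
      a ∘ eC.symm, (key c a).2 ha, fun i => ?_, fun i => haS _, hinj.comp eC.symm.injective⟩
    have h2 : Set.range ((ElementaryEmbedding.refl L N) ∘ c ∘ eB.symm) = Set.range c :=
      eB.symm.surjective.range_comp c
    have h3 : a (eC.symm i) ∉ acl L (Set.range ((ElementaryEmbedding.refl L N) ∘ c ∘ eB.symm)) := by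
      rw [h2]
      exact hacl _
    exact h3
  have h2 : χ.Realize (c' ∘ eB.symm) := (hc.comp eB.symm χ).1 h1
  obtain ⟨a', ha', haI⟩ := (realize_genericityAxiom χ _ (eC '' I)).1
    (hM.realize_of_mem _ (Or.inr ⟨m, n, _, eC '' I, χ, hχ, rfl⟩)) _ h2
  refine ⟨a' ∘ eC, ?_, fun i => ?_⟩
  · rw [← key]
    convert ha' using 2
    funext i
    simp
  · rw [Function.comp_apply, haI]
    simp

/-- A finite approximation of an embedding into a model with a generic predicate. -/
theorem Theory.exists_finite_embedding [Nonempty M] (hT : T.EliminatesExistsInfty) (hN : N ⊨ T)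
    (hM : M ⊨ T.genericPredicate S) {P : Set N} (hP : ∀ a ∈ P, S.Realize fun _ => a)
    {X : Type*} {x : X → N} {y : X → M} (hx : acl L (Set.range x) ⊆ Set.range x)
    (hxy : SameType L x y) (hPxy : ∀ i, x i ∈ P ↔ InPredicate L (y i)) (s : Finset N)
    (θ : L.Formula s) (hθ : θ.Realize fun d => (d : N)) :
    ∃ σ : s → M, θ.Realize σ ∧ (∀ d : s, (d : N) ∈ P ↔ InPredicate L (σ d)) ∧
      ∀ i (h : x i ∈ s), σ ⟨x i, h⟩ = y i := by
  classical
  -- Points of `B` have prescribed images. Points of `C` satisfy `S` and are nonalgebraic over `B`,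
  -- so they may be coloured freely. Points of `E` fail `S`, hence cannot lie in `P`; they are
  -- quantified away while retaining `¬ S`.
  let B := {d : s // (d : N) ∈ Set.range x}
  let C := {d : s // (d : N) ∉ Set.range x ∧ S.Realize fun _ => (d : N)}
  let E := {d : s // (d : N) ∉ Set.range x ∧ ¬ S.Realize fun _ => (d : N)}
  let cls : s → (B ⊕ C) ⊕ E := fun d =>
    if h : (d : N) ∈ Set.range x then Sum.inl (Sum.inl ⟨d, h⟩) else
      if h' : S.Realize fun _ => (d : N) then Sum.inl (Sum.inr ⟨d, h, h'⟩) else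
        Sum.inr ⟨d, h, h'⟩
  choose p hp using fun b : B => b.2
  have hcls : ∀ d : s, (Sum.elim (Sum.elim (fun b : B => (b.1 : N)) fun b : C => (b.1 : N))
      fun b : E => (b.1 : N)) (cls d) = d := by
    intro d
    by_cases h : (d : N) ∈ Set.range x
    · simp only [cls, dif_pos h, Sum.elim_inl]
    · by_cases h' : S.Realize fun _ => (d : N)
      · simp only [cls, dif_neg h, dif_pos h', Sum.elim_inl, Sum.elim_inr]
      · simp only [cls, dif_neg h, dif_neg h', Sum.elim_inr]
  obtain ⟨φ, hφ⟩ : IsFirstOrder L fun (M : Type (max u v)) _ (z : B ⊕ C → M) =>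
      ∃ e : E → M, θ.Realize (fun d => Sum.elim z e (cls d)) ∧
        ∀ b, ¬ S.Realize fun _ => e b :=
    .exists_tuple (.and (.of_formula θ cls fun M z d => by rcases cls d with b | b <;> rfl)
      (.forall_finite fun b => .not (.of_formula S (fun _ => Sum.inr b) fun _ _ _ => rfl)))
  have hc : (fun b : B => (b.1 : N)) = x ∘ p := funext fun b => (hp b).symm
  have hc' : SameType L (fun b : B => (b.1 : N)) (y ∘ p) := by
    rw [hc]
    exact hxy.comp p
  have h1 : φ.Realize (Sum.elim (fun b : B => (b.1 : N)) fun b : C => (b.1 : N)) := by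
    refine (hφ N _).2 ⟨fun b => b.1, ?_, fun b => b.2.2⟩
    simp only [hcls]
    exact hθ
  have h2 : ∀ b : C, (b.1 : N) ∉ acl L (Set.range fun b : B => (b.1 : N)) := by
    intro b hb
    rw [hc] at hb
    exact b.2.1 (hx (acl_mono (Set.range_comp_subset_range _ _) hb))
  have h3 : Function.Injective fun b : C => (b.1 : N) := fun b b' h =>
    Subtype.ext (Subtype.ext h)
  obtain ⟨a, ha, haP⟩ := Theory.exists_realize_pattern hT hN hM φ hc' h1 h2 (fun b => b.2.2) h3
    {b : C | (b.1 : N) ∈ P}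
  obtain ⟨e, he, heS⟩ := (hφ M _).1 ha
  refine ⟨fun d => Sum.elim (Sum.elim (y ∘ p) a) e (cls d), he, fun d => ?_, fun i hi => ?_⟩
  · by_cases h : (d : N) ∈ Set.range x
    · simp only [cls, dif_pos h, Sum.elim_inl, Function.comp_apply]
      rw [← hPxy, hp]
    · by_cases h' : S.Realize fun _ => (d : N)
      · simp only [cls, dif_neg h, dif_pos h', Sum.elim_inl, Sum.elim_inr]
        exact (haP ⟨d, h, h'⟩).symm
      · simp only [cls, dif_neg h, dif_neg h', Sum.elim_inr]
        exact iff_of_false (fun hd => h' (hP _ hd)) fun hd =>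
          heS _ (Theory.realize_of_inPredicate hM hd)
  · have h : ((⟨x i, hi⟩ : s) : N) ∈ Set.range x := ⟨i, rfl⟩
    simp only [cls, dif_pos h, Sum.elim_inl, Function.comp_apply]
    exact (hxy.eq_iff _ _).1 (hp ⟨⟨x i, hi⟩, h⟩)

/-- Every model of `T` with a predicate inside `S` embeds, over an algebraically closed subset, into
an elementary extension of a given model with a generic predicate. -/
theorem Theory.exists_embedding_ultrapower [Nonempty M] (hT : T.EliminatesExistsInfty) (hN : N ⊨ T)
    (hM : M ⊨ T.genericPredicate S) {P : Set N} (hP : ∀ a ∈ P, S.Realize fun _ => a)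
    {X : Type*} {x : X → N} {y : X → M} (hx : acl L (Set.range x) ⊆ Set.range x)
    (hxy : SameType L x y) (hPxy : ∀ i, x i ∈ P ↔ InPredicate L (y i)) :
    ∃ (ι : Type (max u v)) (U : Ultrafilter ι) (g : N → Ultrapower U M),
      SameType L (id : N → N) g ∧ (∀ a, a ∈ P ↔ InPredicate L (g a)) ∧
        ∀ i, g (x i) = Ultrapower.diag L U (y i) := by
  classical
  let Idx := Finset N × Finset {ψ : L.Formula N // ψ.Realize (id : N → N)}
  have key : ∀ j : Idx, ∃ σ : N → M, (∀ ψ ∈ j.2, ψ.1.Realize σ) ∧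
      (∀ d ∈ j.1, d ∈ P ↔ InPredicate L (σ d)) ∧ ∀ i, x i ∈ j.1 → σ (x i) = y i := by
    intro j
    obtain ⟨θ, hθ⟩ : IsFirstOrder L fun (M : Type (max u v)) _ (z : N → M) =>
        ∀ ψ : j.2, ψ.1.1.Realize z :=
      .forall_finite fun ψ => .of_formula ψ.1.1 id fun _ _ _ => rfl
    obtain ⟨s, θ', hθ'⟩ := θ.exists_finite_support
    have hs : ∀ a : s, (a : N) ∈ s ∪ j.1 := fun a => Finset.mem_union_left _ a.2
    obtain ⟨σ, hσ, hσP, hσy⟩ := Theory.exists_finite_embedding hT hN hM hP hx hxy hPxy (s ∪ j.1)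
      (θ'.relabel fun a : s => ⟨a, hs a⟩)
      (Formula.realize_relabel.2 ((hθ' N id).1 ((hθ N id).2 fun ψ => ψ.1.2)))
    let τ : N → M := fun a => if h : a ∈ s ∪ j.1 then σ ⟨a, h⟩ else Classical.arbitrary M
    have hτ : ∀ a (h : a ∈ s ∪ j.1), τ a = σ ⟨a, h⟩ := fun a h => dif_pos h
    refine ⟨τ, fun ψ hψ => ?_, fun d hd => ?_, fun i hi => ?_⟩
    · refine (hθ M τ).1 ((hθ' M τ).2 ?_) ⟨ψ, hψ⟩
      have := Formula.realize_relabel.1 hσ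
      convert this using 2 with a
      exact hτ a (hs a)
    · have hd' := Finset.mem_union_right s hd
      rw [hτ d hd', ← hσP]
    · have hd' := Finset.mem_union_right s hi
      rw [hτ _ hd', hσy]
  choose σ hσ hσP hσy using key
  let U : Ultrafilter Idx := Ultrafilter.of atTop
  have hU : (U : Filter Idx) ≤ atTop := Ultrafilter.of_le _
  have hmem : ∀ d : N, ∀ᶠ j : Idx in U, d ∈ j.1 := fun d =>
    ((eventually_ge_atTop (({d}, ∅) : Idx)).filter_mono hU).mono fun j hj =>
      Finset.singleton_subset_iff.1 hj.1
  have hmem' : ∀ ψ, ∀ᶠ j : Idx in U, ψ ∈ j.2 := fun ψ =>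
    ((eventually_ge_atTop ((∅, {ψ}) : Idx)).filter_mono hU).mono fun j hj =>
      Finset.singleton_subset_iff.1 hj.2
  have hreal : ∀ ψ : L.Formula N, ψ.Realize (id : N → N) →
      ψ.Realize fun a => Ultrapower.mk U fun j => σ j a := fun ψ hψ => by
    rw [Ultrapower.realize_mk]
    exact (hmem' ⟨ψ, hψ⟩).mono fun j hj => hσ j _ hj
  refine ⟨Idx, U, fun a => Ultrapower.mk U fun j => σ j a, fun ψ => ⟨hreal ψ, fun h => ?_⟩,
    fun a => ?_, fun i => ?_⟩
  · by_contra hψ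
    exact (Formula.realize_not.1 (hreal ψ.not (Formula.realize_not.2 hψ))) h
  · have h1 := Ultrapower.realize_mk U (predicateFormula L ()) fun (_ : Unit) (j : Idx) => σ j a
    simp only [realize_predicateFormula] at h1
    rw [h1]
    constructor
    · exact fun ha => (hmem a).mono fun j hj => (hσP j a hj).1 ha
    · intro h
      obtain ⟨j, hj, hj'⟩ := (h.and (hmem a)).exists
      exact (hσP j a hj').2 hj
  · rw [Ultrapower.diag_apply, Ultrapower.mk_eq_mk]
    exact (hmem (x i)).mono fun j hj => hσy j i hj

end GenericModels

/-! ### Elimination of quantifiers down to algebraically closed sets -/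

section QuantifierElimination

variable {L : Language.{u, v}} {T : L.Theory} {S : L.Formula (Fin 1)}

theorem exists_term_withPredicate {β : Type*} (t : L.withPredicate.Term β) :
    ∃ t' : L.Term β, ∀ (M : Type w) [L.Structure M] [L.withPredicate.Structure M]
      [(LHom.sumInl : L →ᴸ L.withPredicate).IsExpansionOn M] (z : β → M),
      t.realize z = t'.realize z := by
  induction t with
  | var i => exact ⟨Term.var i, fun M _ _ _ z => rfl⟩
  | func f ts ih =>
    choose ts' hts' using ih
    rcases f with f | f
    · refine ⟨Term.func f ts', fun M _ _ _ z => ?_⟩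
      have h1 : (fun i => (ts i).realize z) = fun i => (ts' i).realize z :=
        funext fun i => hts' i M z
      exact (congrArg (Structure.funMap (L := L.withPredicate) (Sum.inl f)) h1).trans
        (LHom.map_onFunction (LHom.sumInl : L →ᴸ L.withPredicate) f _)
    · exact f.elim

theorem exists_formula_equal_withPredicate {β : Type*} (t₁ t₂ : L.withPredicate.Term β) :
    ∃ ψ : L.Formula β, ∀ (M : Type w) [L.Structure M] [L.withPredicate.Structure M]
      [(LHom.sumInl : L →ᴸ L.withPredicate).IsExpansionOn M] (z : β → M),
      t₁.realize z = t₂.realize z ↔ ψ.Realize z := by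
  obtain ⟨t₁', h₁⟩ := exists_term_withPredicate.{u, v, w} t₁
  obtain ⟨t₂', h₂⟩ := exists_term_withPredicate.{u, v, w} t₂
  exact ⟨t₁'.equal t₂', fun M _ _ _ z => by rw [h₁, h₂, Formula.realize_equal]⟩

theorem term_realize_mem_acl {M : Type w} [L.Structure M] {X : Type*} (t : L.Term X) (x : X → M) :
    t.realize x ∈ acl L (Set.range x) := by
  have key : ∀ z, Formula.Realize (M := M)
      ((t.relabel Sum.inl).equal (Term.var (Sum.inr ()) : L.Term (X ⊕ Unit)))
      (Sum.elim x fun _ => z) ↔ t.realize x = z := fun z => by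
    rw [Formula.realize_equal, Term.realize_relabel]
    rfl
  refine mem_acl_range_iff_formula.2
    ⟨(t.relabel Sum.inl).equal (Term.var (Sum.inr ())), ?_, (key _).2 rfl⟩
  simp only [key]
  exact (Set.finite_singleton (t.realize x)).subset fun y hy => hy.symm

/-- The tuples `x` and `y` in models with a generic predicate enumerate algebraically closed sets
that correspond to each other. -/
structure AclIso {M N : Type (max u v)} [L.Structure M] [L.withPredicate.Structure M]
    [L.Structure N] [L.withPredicate.Structure N] (T : L.Theory) (S : L.Formula (Fin 1))
    {X : Type (max u v)} (x : X → M) (y : X → N) : Prop where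
  left_model : M ⊨ T.genericPredicate S
  right_model : N ⊨ T.genericPredicate S
  acl_subset : acl L (Set.range x) ⊆ Set.range x
  sameType : SameType L x y
  inPredicate_iff : ∀ i, InPredicate L (x i) ↔ InPredicate L (y i)

theorem AclIso.symm {M N : Type (max u v)} [L.Structure M] [L.withPredicate.Structure M]
    [L.Structure N] [L.withPredicate.Structure N] {X : Type (max u v)} {x : X → M} {y : X → N}
    (h : AclIso T S x y) : AclIso T S y x :=
  ⟨h.2, h.1, acl_range_subset_of_sameType h.sameType h.acl_subset, h.sameType.symm,
    fun i => (h.inPredicate_iff i).symm⟩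

/-- The back-and-forth step, extending the correspondence to all of `M` at once. -/
theorem AclIso.exists_extension {M N : Type (max u v)} [L.Structure M]
    [L.withPredicate.Structure M] [(LHom.sumInl : L →ᴸ L.withPredicate).IsExpansionOn M]
    [Nonempty M] [L.Structure N] [L.withPredicate.Structure N]
    [(LHom.sumInl : L →ᴸ L.withPredicate).IsExpansionOn N] [Nonempty N]
    (hT : T.EliminatesExistsInfty) {X : Type (max u v)} {x : X → M} {y : X → N}
    (h : AclIso T S x y) :
    ∃ (ι : Type (max u v)) (U : Ultrafilter ι) (g : M → Ultrapower U N),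
      AclIso T S id g ∧ ∀ i, g (x i) = Ultrapower.diag L.withPredicate U (y i) := by
  obtain ⟨ι, U, g, hg, hgP, hgx⟩ := Theory.exists_embedding_ultrapower hT
    (Theory.model_of_model_genericPredicate h.left_model) h.right_model
    (P := {a : M | InPredicate L a})
    (fun a ha => Theory.realize_of_inPredicate h.left_model ha) h.acl_subset h.sameType
    h.inPredicate_iff
  refine ⟨ι, U, g, ⟨h.left_model, ?_, by simp, hg, hgP⟩, hgx⟩
  exact ((Ultrapower.diag L.withPredicate U (M := N)).theory_model_iff _).1 h.right_model

/-- Induction on the formula for all pairs of models simultaneously, since the quantifier step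
replaces the tuples and the second model. -/
theorem AclIso.realize_boundedFormula (hT : T.EliminatesExistsInfty) {α : Type*} {n : ℕ}
    (φ : L.withPredicate.BoundedFormula α n) :
    ∀ {M N : Type (max u v)} [L.Structure M] [L.withPredicate.Structure M]
      [(LHom.sumInl : L →ᴸ L.withPredicate).IsExpansionOn M] [Nonempty M]
      [L.Structure N] [L.withPredicate.Structure N]
      [(LHom.sumInl : L →ᴸ L.withPredicate).IsExpansionOn N] [Nonempty N]
      {X : Type (max u v)} {x : X → M} {y : X → N}, AclIso T S x y →
      ∀ (v : α → X) (z : Fin n → X),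
        φ.Realize (x ∘ v) (x ∘ z) ↔ φ.Realize (y ∘ v) (y ∘ z) := by
  induction φ with
  | falsum => intros; exact Iff.rfl
  | equal t₁ t₂ =>
    intro M N _ _ _ _ _ _ _ _ X x y h v z
    obtain ⟨ψ, hψ⟩ := exists_formula_equal_withPredicate.{u, v, max u v} t₁ t₂
    simp only [BoundedFormula.Realize]
    rw [hψ, hψ, ← Sum.comp_elim, ← Sum.comp_elim]
    exact h.sameType.comp _ ψ
  | rel R ts =>
    intro M N _ _ _ _ _ _ _ _ X x y h v z
    choose ts' hts' using fun i => exists_term_withPredicate.{u, v, max u v} (ts i)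
    simp only [BoundedFormula.Realize, hts', ← Sum.comp_elim]
    rcases R with R | R
    · have hM := LHom.map_onRelation (LHom.sumInl : L →ᴸ L.withPredicate) (M := M) R
        fun i => (ts' i).realize (x ∘ Sum.elim v z)
      have hN := LHom.map_onRelation (LHom.sumInl : L →ᴸ L.withPredicate) (M := N) R
        fun i => (ts' i).realize (y ∘ Sum.elim v z)
      refine (iff_of_eq hM).trans (Iff.trans ?_ (iff_of_eq hN).symm)
      have := h.sameType.comp (Sum.elim v z) (R.formula ts')
      rwa [Formula.realize_rel, Formula.realize_rel] at this
    · cases R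
      have key : ∀ {K : Type (max u v)} [L.withPredicate.Structure K] (t : Fin 1 → K),
          Structure.RelMap (predicateSymbol L) t ↔ InPredicate L (t 0) := by
        intro K _ t
        unfold InPredicate
        refine iff_of_eq (congrArg _ (funext fun i => ?_))
        rw [Subsingleton.elim i 0]
        rfl
      refine (key _).trans (Iff.trans ?_ (key _).symm)
      -- `P` may be applied to a term; its value is algebraic over the tuple, hence one of its
      -- coordinates.
      obtain ⟨i, hi⟩ := h.acl_subset (acl_mono (Set.range_comp_subset_range _ _)
        (term_realize_mem_acl (ts' 0) (x ∘ Sum.elim v z)))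
      have h1 := h.sameType (((ts' 0).relabel (Sum.elim v z)).equal (Term.var i))
      rw [Formula.realize_equal, Formula.realize_equal, Term.realize_relabel,
        Term.realize_relabel, Term.realize_var, Term.realize_var] at h1
      rw [← hi, h1.1 hi.symm]
      exact h.inPredicate_iff i
  | imp φ ψ ihφ ihψ =>
    intro M N _ _ _ _ _ _ _ _ X x y h v z
    exact imp_congr (ihφ h v z) (ihψ h v z)
  | all φ ih =>
    have main : ∀ {M N : Type (max u v)} [L.Structure M] [L.withPredicate.Structure M]
        [(LHom.sumInl : L →ᴸ L.withPredicate).IsExpansionOn M] [Nonempty M]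
        [L.Structure N] [L.withPredicate.Structure N]
        [(LHom.sumInl : L →ᴸ L.withPredicate).IsExpansionOn N] [Nonempty N]
        {X : Type (max u v)} {x : X → M} {y : X → N}, AclIso T S x y →
        ∀ (v : α → X) (z : Fin _ → X),
          φ.all.Realize (y ∘ v) (y ∘ z) → φ.all.Realize (x ∘ v) (x ∘ z) := by
      intro M N _ _ _ _ _ _ _ _ X x y h v z hy a
      -- After the extension every element of `M` is a coordinate of the tuple, so `a` has the
      -- counterpart `g a` in an ultrapower of `N`.
      obtain ⟨ι, U, g, hg, hgx⟩ := h.exists_extension hT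
      rw [← (Ultrapower.diag L.withPredicate U (M := N)).map_boundedFormula] at hy
      have h1 := (ih hg (x ∘ v) (Fin.snoc (x ∘ z) a)).2
      refine h1 ?_
      convert hy (g a) using 1
      · funext i
        exact hgx (v i)
      · rw [Fin.comp_snoc]
        congr 1
        funext i
        exact hgx (z i)
    intro M N _ _ _ _ _ _ _ _ X x y h v z
    exact ⟨main h.symm v z, main h v z⟩

theorem AclIso.sameType_withPredicate (hT : T.EliminatesExistsInfty) {M N : Type (max u v)}
    [L.Structure M] [L.withPredicate.Structure M]
    [(LHom.sumInl : L →ᴸ L.withPredicate).IsExpansionOn M] [Nonempty M]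
    [L.Structure N] [L.withPredicate.Structure N]
    [(LHom.sumInl : L →ᴸ L.withPredicate).IsExpansionOn N] [Nonempty N]
    {X : Type (max u v)} {x : X → M} {y : X → N} (h : AclIso T S x y) :
    SameType L.withPredicate x y := fun ψ => by
  have := AclIso.realize_boundedFormula hT ψ h id default
  simp only [Formula.Realize]
  rw [Subsingleton.elim (x ∘ default) default, Subsingleton.elim (y ∘ default) default] at this
  exact this

end QuantifierElimination

/-! ### Consistency along rows in `NTP₂` theories -/

section RowConsistency

variable {L : Language.{u, v}} {T : L.Theory}

/-- To witness `TP₂` it suffices that all finite parts of paths are realized. -/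
theorem Theory.hasTP2_of_finite_paths (M : Theory.ModelType.{u, v, max u v} T) {X Y : Type*}
    {n m : ℕ} (eX : X ≃ Fin n) (eY : Y ≃ Fin m) (ψ : L.Formula (X ⊕ Y)) (a : ℕ → ℕ → Y → M)
    (hrow : ∀ α i j, i ≠ j →
      ¬ ∃ b : X → M, ψ.Realize (Sum.elim b (a α i)) ∧ ψ.Realize (Sum.elim b (a α j)))
    (hpath : ∀ (f : ℕ → ℕ) (N : ℕ), ∃ b : X → M, ∀ α < N, ψ.Realize (Sum.elim b (a α (f α)))) :
    T.HasTP2 (ψ.relabel (Sum.map eX eY)) := by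
  have := Finite.of_equiv _ eX.symm
  have := Finite.of_equiv _ eY.symm
  let U := hyperfilter ℕ
  have key : ∀ {K : Type (max u v)} [L.Structure K] (b : Fin n → K) (c : Y → K),
      (ψ.relabel (Sum.map eX eY)).Realize (Sum.elim b (c ∘ eY.symm)) ↔
        ψ.Realize (Sum.elim (b ∘ eX) c) := by
    intro K _ b c
    rw [Formula.realize_relabel]
    refine iff_of_eq (congrArg ψ.Realize (funext fun i => ?_))
    rcases i with i | i <;> simp
  have hM : Ultrapower U M ⊨ T :=
    ((Ultrapower.diag L U (M := M)).theory_model_iff T).1 inferInstance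
  refine ⟨Theory.ModelType.of T (Ultrapower U M),
    fun α i => (Ultrapower.diag L U ∘ a α i) ∘ eY.symm, ?_, ?_⟩
  · rintro α i j hij ⟨b, hb⟩
    have hb' := And.intro ((key (K := Ultrapower U M) b _).1 hb.1)
      ((key (K := Ultrapower U M) b _).1 hb.2)
    refine hrow α i j hij ?_
    have hfo : IsFirstOrder L fun (M : Type (max u v)) _ (y : Y ⊕ Y → M) => ∃ b : X → M,
        ψ.Realize (Sum.elim b fun i => y (Sum.inl i)) ∧
          ψ.Realize (Sum.elim b fun i => y (Sum.inr i)) :=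
      .exists_tuple (.and
        (.of_formula ψ (Sum.elim Sum.inr (Sum.inl ∘ Sum.inl))
          fun M x b => by rcases b with b | b <;> rfl)
        (.of_formula ψ (Sum.elim Sum.inr (Sum.inl ∘ Sum.inr))
          fun M x b => by rcases b with b | b <;> rfl))
    exact (hfo.transfer ((Ultrapower.diag L U (M := M)).sameType
      (Sum.elim (a α i) (a α j)))).2 ⟨b ∘ eX, hb'⟩
  · intro f
    choose b hb using hpath f
    refine ⟨fun i => Ultrapower.mk U fun N => b N (eX.symm i), fun α => ?_⟩
    change (ψ.relabel (Sum.map eX eY)).Realize (M := Ultrapower U M) (Sum.elim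
      (fun i => Ultrapower.mk U fun N => b N (eX.symm i))
        ((Ultrapower.diag L U ∘ a α (f α)) ∘ eY.symm))
    rw [key]
    have h1 : (Sum.elim ((fun i => Ultrapower.mk U fun N => b N (eX.symm i)) ∘ eX)
        (Ultrapower.diag L U ∘ a α (f α))) = fun x => Ultrapower.mk U
          ((Sum.elim (fun i N => b N i) fun i _ => a α (f α) i : X ⊕ Y → ℕ → M) x) := by
      funext x
      rcases x with x | x
      · simp
      · rfl
    rw [h1, Ultrapower.realize_mk]
    have h2 : ∀ᶠ N in hyperfilter ℕ, α < N := Nat.hyperfilter_le_atTop (eventually_gt_atTop α)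
    filter_upwards [h2] with N hN
    convert hb N α hN using 2 with x
    rcases x with x | x <;> rfl

/-- An array is indiscernible with respect to increasing changes of rows and columns. -/
def IsIndiscernibleArray (L : Language.{u, v}) {M : Type w} [L.Structure M] {ι : Type*}
    (entry : ℕ → ℕ → ι → M) : Prop :=
  ∀ {N : ℕ} {ρ ρ' : Fin N → ℕ} {s s' : Fin N → ℕ → ℕ}, StrictMono ρ →
    StrictMono ρ' → (∀ β, StrictMono (s β)) → (∀ β, StrictMono (s' β)) →
    SameType L (fun x : Fin N × ℕ × ι => entry (ρ x.1) (s x.1 x.2.1) x.2.2)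
      fun x : Fin N × ℕ × ι => entry (ρ' x.1) (s' x.1 x.2.1) x.2.2

theorem IsIndiscernibleArray.exists_realize_iff {M : Type w} [L.Structure M] {ι X : Type*}
    [Finite X] {entry : ℕ → ℕ → ι → M} (h : IsIndiscernibleArray L entry) (θ : L.Formula (ι ⊕ X))
    {N : ℕ} (r : ℕ) {ρ : Fin N → ℕ} (hρ : StrictMono ρ) {s : Fin N → ℕ → ℕ}
    (hs : ∀ β, StrictMono (s β)) :
    (∃ x : X → M, ∀ (β : Fin N) (k : Fin r), θ.Realize (Sum.elim (entry (ρ β) (s β k)) x)) ↔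
      ∃ x : X → M, ∀ (β : Fin N) (k : Fin r), θ.Realize (Sum.elim (entry β k) x) := by
  have hfo : IsFirstOrder L fun (M : Type w) _ (y : Fin N × ℕ × ι → M) => ∃ x : X → M,
      ∀ (β : Fin N) (k : Fin r), θ.Realize (Sum.elim (fun i => y (β, k, i)) x) :=
    .exists_tuple (.forall_finite fun β => .forall_finite fun k =>
      .of_formula θ (Sum.elim (fun i => Sum.inl (β, k, i)) Sum.inr)
        fun M x b => by rcases b with b | b <;> rfl)
  exact hfo.transfer (h hρ Fin.val_strictMono hs fun _ => strictMono_id)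

/-- In an `NTP₂` theory, a formula that is consistent along the first column of an indiscernible
array is consistent along the rows. -/
theorem Theory.IsNTP2.exists_realize_row (hT : T.IsNTP2)
    (M : Theory.ModelType.{u, v, max u v} T) {ι X : Type*} [Finite X] {entry : ℕ → ℕ → ι → M}
    (h : IsIndiscernibleArray L entry) (θ : L.Formula (ι ⊕ X))
    (hcon : ∀ N : ℕ, ∃ x : X → M, ∀ β < N, θ.Realize (Sum.elim (entry β 0) x)) (K : ℕ) :
    ∃ x : X → M, ∀ k < K, θ.Realize (Sum.elim (entry 0 k) x) := by
  classical
  -- Take the least number of columns whose consistency fails for some number `N` of rows. It is at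
  -- least `2`, because column `0` is consistent; write it as `r + 2`.
  let Con : ℕ → ℕ → Prop := fun r N => ∃ x : X → M, ∀ (β : Fin N) (k : Fin r),
    θ.Realize (Sum.elim (entry β k) x)
  by_contra hK
  have hex : ∃ r, ∃ N, ¬ Con r N := ⟨K, 1, fun ⟨x, hx⟩ => hK ⟨x, fun k hk => hx 0 ⟨k, hk⟩⟩⟩
  obtain ⟨r, hr⟩ : ∃ r, Nat.find hex = r + 2 := by
    refine ⟨Nat.find hex - 2, ?_⟩
    have h0 : Nat.find hex ≠ 0 := fun h0 => by
      obtain ⟨N, hN⟩ := Nat.find_spec hex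
      rw [h0] at hN
      exact hN ⟨fun _ => Classical.arbitrary M, fun _ k => k.elim0⟩
    have h1 : Nat.find hex ≠ 1 := fun h1 => by
      obtain ⟨N, hN⟩ := Nat.find_spec hex
      rw [h1] at hN
      obtain ⟨x, hx⟩ := hcon N
      refine hN ⟨x, fun β k => ?_⟩
      rw [Subsingleton.elim k 0]
      exact hx β β.2
    omega
  obtain ⟨N, hN⟩ := Nat.find_spec hex
  rw [hr] at hN
  have hCon : ∀ N, Con (r + 1) N := fun N => by
    by_contra hc
    exact Nat.find_min hex (m := r + 1) (by omega) ⟨N, hc⟩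
  have hblock : ∀ α : ℕ, StrictMono fun β : Fin N => α * N + β := fun α β γ hβγ =>
    Nat.add_lt_add_left hβγ _
  obtain ⟨F, θ', hθ'⟩ := θ.exists_finite_support_left.{u, v, max u v}
  obtain ⟨ψ, hψ⟩ : IsFirstOrder L
      fun (M : Type (max u v)) _ (y : X ⊕ (Fin N × Fin (r + 1) × F) → M) =>
        ∀ (β : Fin N) (k : Fin (r + 1)), θ'.Realize
          (Sum.elim (fun i => y (Sum.inr (β, k, i))) fun i => y (Sum.inl i)) :=
    .forall_finite fun β => .forall_finite fun k =>
      .of_formula θ' (Sum.elim (fun i => Sum.inr (β, k, i)) Sum.inl)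
        fun M x b => by rcases b with b | b <;> rfl
  obtain ⟨n, ⟨eX⟩⟩ := Finite.exists_equiv_fin X
  obtain ⟨m, ⟨eY⟩⟩ := Finite.exists_equiv_fin (Fin N × Fin (r + 1) × F)
  -- Group the array into blocks of `N` rows and `r + 1` columns. Paths of blocks are consistent by
  -- minimality, while two blocks in one row contain `r + 2` columns and are inconsistent, which
  -- would be `TP₂`.
  let a : ℕ → ℕ → (Fin N × Fin (r + 1) × F) → M := fun α j y =>
    entry (α * N + y.1) (j * (r + 1) + y.2.1) y.2.2
  have hψa : ∀ (x : X → M) α j, ψ.Realize (Sum.elim x (a α j)) ↔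
      ∀ (β : Fin N) (k : Fin (r + 1)),
        θ.Realize (Sum.elim (entry (α * N + β) (j * (r + 1) + k)) x) := by
    intro x α j
    rw [hψ]
    exact forall_congr' fun β => forall_congr' fun k =>
      (hθ' M (entry (α * N + β) (j * (r + 1) + k)) x).symm
  refine hT n m _ (Theory.hasTP2_of_finite_paths M eX eY ψ a ?_ ?_)
  · have hlt : ∀ α i j, i < j → ¬ ∃ b : X → M,
        ψ.Realize (Sum.elim b (a α i)) ∧ ψ.Realize (Sum.elim b (a α j)) := by
      rintro α i j hij ⟨x, hx, hx'⟩
      rw [hψa] at hx hx'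
      -- All `r + 1` columns of block `i`, followed by the columns from the start of block `j`.
      let col : ℕ → ℕ := fun k => if k < r + 1 then i * (r + 1) + k else j * (r + 1) + (k - (r + 1))
      have hcol : StrictMono col := by
        have hij' : i * (r + 1) + (r + 1) ≤ j * (r + 1) := by
          rw [← Nat.succ_mul]
          exact Nat.mul_le_mul_right _ hij
        intro k l hkl
        simp only [col]
        split_ifs <;> omega
      refine hN ((h.exists_realize_iff θ (r + 2) (hblock α) fun _ => hcol).1 ⟨x, fun β k => ?_⟩)
      by_cases hk : k.1 < r + 1
      · simp only [col, if_pos hk]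
        exact hx β ⟨k, hk⟩
      · have hk' : k.1 = r + 1 := by omega
        simp only [col, hk', lt_irrefl, if_false, Nat.sub_self]
        exact hx' β 0
    intro α i j hij
    rcases hij.lt_or_gt with hij | hij
    · exact hlt α i j hij
    · exact fun ⟨x, hx, hx'⟩ => hlt α j i hij ⟨x, hx', hx⟩
  · intro f N'
    obtain ⟨x, hx⟩ := (h.exists_realize_iff θ (r + 1) (N := N' * N) (ρ := Fin.val)
      (s := fun β k => f (β / N) * (r + 1) + k) Fin.val_strictMono
      fun β k l hkl => Nat.add_lt_add_left hkl _).2 (hCon _)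
    refine ⟨x, fun α hα => (hψa _ _ _).2 fun β k => ?_⟩
    have hlt : α * N + β < N' * N := by
      have : (α + 1) * N ≤ N' * N := Nat.mul_le_mul_right _ hα
      rw [Nat.succ_mul] at this
      omega
    have hdiv : (α * N + β) / N = α := by
      have hN0 : 0 < N := β.pos
      rw [Nat.mul_comm, Nat.mul_add_div hN0, Nat.div_eq_of_lt β.2, Nat.add_zero]
    have := hx ⟨α * N + β, hlt⟩ k
    simp only [hdiv] at this
    exact this

end RowConsistency

/-! ### Amalgamating copies of a solution along a row -/

section Combinatorics

/-- For each `s`, at least a fraction `2 ^ (-|κ|)` of the subsets of the finite set of all values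
contain the `C`-values of `d s` and omit the others. A conflict between `s` and `s'` makes their two
families of subsets disjoint, so at most `2 ^ |κ|` indices can conflict pairwise. -/
theorem exists_no_conflict {κ M : Type*} [Fintype κ] (C : κ → Prop) {K : ℕ}
    (hK : 2 ^ Fintype.card κ < K) (d : Fin K → κ → M)
    (hd : ∀ s k l, C k → ¬ C l → d s k ≠ d s l) :
    ∃ s s', s < s' ∧ ∀ k l, C k → ¬ C l → d s k ≠ d s' l ∧ d s' k ≠ d s l := by
  classical
  by_contra! hcon
  let A : Fin K → Finset M := fun s => (Finset.univ.filter C).image (d s)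
  let B : Fin K → Finset M := fun s => (Finset.univ.filter fun k => ¬ C k).image (d s)
  let E : Finset M := Finset.univ.biUnion fun s => A s ∪ B s
  have hAE : ∀ s, A s ⊆ E := fun s => Finset.subset_union_left.trans
    (Finset.subset_biUnion_of_mem (fun s => A s ∪ B s) (Finset.mem_univ s))
  have hBE : ∀ s, B s ⊆ E := fun s => Finset.subset_union_right.trans
    (Finset.subset_biUnion_of_mem (fun s => A s ∪ B s) (Finset.mem_univ s))
  have hAB : ∀ s, Disjoint (A s) (B s) := fun s => by
    rw [Finset.disjoint_left]
    intro x hx hx'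
    obtain ⟨k, hk, rfl⟩ := Finset.mem_image.1 hx
    obtain ⟨l, hl, hkl⟩ := Finset.mem_image.1 hx'
    exact hd s k l (Finset.mem_filter.1 hk).2 (Finset.mem_filter.1 hl).2 hkl.symm
  have hcard : ∀ s, (A s).card + (B s).card ≤ Fintype.card κ := fun s => by
    refine (add_le_add Finset.card_image_le Finset.card_image_le).trans ?_
    rw [Finset.card_filter_add_card_filter_not, Finset.card_univ]
  have hIcc : ∀ s, 2 ^ (E.card - Fintype.card κ) ≤ (Finset.Icc (A s) (E \ B s)).card := fun s => by
    rw [Finset.card_Icc_finset (Finset.subset_sdiff.2 ⟨hAE s, hAB s⟩),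
      Finset.card_sdiff_of_subset (hBE s)]
    have := hcard s
    exact Nat.pow_le_pow_right (by norm_num) (by omega)
  have hconf : ∀ s s', s < s' → Disjoint (Finset.Icc (A s) (E \ B s))
      (Finset.Icc (A s') (E \ B s')) := fun s s' hss => by
    rw [Finset.disjoint_left]
    intro R hR hR'
    obtain ⟨hR1, hR2⟩ := Finset.mem_Icc.1 hR
    obtain ⟨hR1', hR2'⟩ := Finset.mem_Icc.1 hR'
    obtain ⟨k, l, hk, hl, hkl⟩ := hcon s s' hss
    have hmA : ∀ s, d s k ∈ A s := fun s => Finset.mem_image_of_mem _ (by simpa using hk)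
    have hmB : ∀ s, d s l ∈ B s := fun s => Finset.mem_image_of_mem _ (by simpa using hl)
    by_cases h : d s k = d s' l
    · exact (Finset.mem_sdiff.1 (hR2' (hR1 (hmA s)))).2 (h ▸ hmB s')
    · exact (Finset.mem_sdiff.1 (hR2 (hR1' (hmA s')))).2 (hkl h ▸ hmB s)
  have hdisj : (↑(Finset.univ : Finset (Fin K)) : Set (Fin K)).PairwiseDisjoint
      fun s => Finset.Icc (A s) (E \ B s) := fun s _ s' _ hss => by
    rcases lt_or_gt_of_ne hss with h | h
    · exact hconf s s' h
    · exact (hconf s' s h).symm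
  have hsub : (Finset.univ.biUnion fun s => Finset.Icc (A s) (E \ B s)) ⊆ E.powerset :=
    Finset.biUnion_subset.2 fun s _ R hR =>
      Finset.mem_powerset.2 ((Finset.mem_Icc.1 hR).2.trans Finset.sdiff_subset)
  have h1 := Finset.card_le_card hsub
  rw [Finset.card_biUnion hdisj, Finset.card_powerset] at h1
  have h2 : K * 2 ^ (E.card - Fintype.card κ) ≤ 2 ^ E.card := by
    refine le_trans ?_ h1
    refine le_trans ?_ (Finset.sum_le_sum fun s _ => hIcc s)
    simp
  have h3 : 2 ^ E.card ≤ 2 ^ Fintype.card κ * 2 ^ (E.card - Fintype.card κ) := by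
    rw [← pow_add]
    exact Nat.pow_le_pow_right (by norm_num) (by omega)
  have h4 := Nat.le_of_mul_le_mul_right (h2.trans h3) (by positivity)
  omega

theorem exists_disjoint_sequence {κ M : Type*} [Finite κ] {Q : (κ → M) → Prop}
    (h : ∀ F : Set M, F.Finite → ∃ w, Q w ∧ ∀ k, w k ∉ F) :
    ∃ W : ℕ → κ → M, (∀ t, Q (W t)) ∧ ∀ t t', t ≠ t' → ∀ k l, W t k ≠ W t' l := by
  obtain ⟨W, hW, hr⟩ := exists_seq_of_forall_finset_exists Q
    (fun w w' => ∀ k l, w k ≠ w' l) fun s _ => by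
      obtain ⟨w, hw, hwF⟩ := h (⋃ w ∈ s, Set.range w)
        (s.finite_toSet.biUnion fun w _ => Set.finite_range w)
      refine ⟨w, hw, fun w' hw' k l hkl => hwF l ?_⟩
      exact Set.mem_biUnion (show w' ∈ (s : Set (κ → M)) from hw') ⟨k, hkl⟩
  refine ⟨W, hW, fun t t' htt k l hkl => ?_⟩
  rcases htt.lt_or_gt with h | h
  · exact hr _ _ h k l hkl
  · exact hr _ _ h l k hkl.symm

/-- Each bad `t` uses an element of `F` in one of the two sequences, and disjointness lets each
sequence use it only once. -/
theorem exists_avoiding_of_card_lt {κ M : Type*} {K : ℕ} {F : Finset M} (hK : 2 * F.card < K)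
    (d₀ d₁ : Fin K → κ → M) (h₀ : ∀ t t', t ≠ t' → ∀ k l, d₀ t k ≠ d₀ t' l)
    (h₁ : ∀ t t', t ≠ t' → ∀ k l, d₁ t k ≠ d₁ t' l) :
    ∃ t, ∀ k, d₀ t k ∉ F ∧ d₁ t k ∉ F := by
  by_contra! hcon
  have hbad : ∀ t, ∃ y : Bool × F, ∃ k, (bif y.1 then d₀ t k else d₁ t k) = y.2 := fun t => by
    obtain ⟨k, hk⟩ := hcon t
    by_cases h : d₀ t k ∈ F
    · exact ⟨(true, ⟨_, h⟩), k, rfl⟩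
    · exact ⟨(false, ⟨_, hk h⟩), k, rfl⟩
  choose y hy using hbad
  have hinj : Function.Injective y := fun t t' htt => by
    by_contra hne
    obtain ⟨k, hk⟩ := hy t
    obtain ⟨l, hl⟩ := hy t'
    rw [← htt] at hl
    rcases hb : (y t).1 with _ | _
    · rw [hb] at hk hl
      exact h₁ t t' hne k l (hk.trans hl.symm)
    · rw [hb] at hk hl
      exact h₀ t t' hne k l (hk.trans hl.symm)
  have := Fintype.card_le_of_injective y hinj
  simp at this
  omega

end Combinatorics

/-! ### Disjoint solutions along a column -/

section Amalgamation

variable {L : Language.{u, v}} {T : L.Theory}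

/-- An indiscernible array of algebraically closed tuples with a tuple `sol` of the same type over
all entries of the first column, such that `sol` is independent enough over this column. -/
structure IndependentPath (L : Language.{u, v}) {M : Type w} [L.Structure M] {ι : Type*} {n : ℕ}
    (entry : ℕ → ℕ → ι → M) (sol : Fin n → M) : Prop where
  indiscernible : IsIndiscernibleArray L entry
  sameType_row : ∀ β γ, SameType L (Sum.elim sol (entry β 0)) (Sum.elim sol (entry γ 0))
  notMem_acl : ∀ β z, z ∈ acl L (Set.range (Sum.elim sol (entry β 0))) →
    z ∉ Set.range (entry β 0) → z ∉ acl L (Set.range fun p : ℕ × ι => entry p.1 0 p.2)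

variable {ι κ : Type*} [Finite κ] {n : ℕ}

/-- If every algebraic conjugate of `d` over row `β` met the entry, finitely many coordinates would
witness this. That is a first-order statement, so it would transfer back to row `0` and contradict
the choice of `d`. -/
theorem IndependentPath.exists_row {M : Type w} [L.Structure M] {entry : ℕ → ℕ → ι → M}
    {sol : Fin n → M} (h : IndependentPath L entry sol) {θ : L.Formula (ι ⊕ (κ ⊕ Fin n))}
    {d : κ → M} (hθ : θ.Realize (Sum.elim (entry 0 0) (Sum.elim d sol)))
    (hd : ∀ k, d k ∈ acl L (Set.range (Sum.elim sol (entry 0 0))))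
    (hd' : ∀ k, d k ∉ Set.range (entry 0 0)) (β : ℕ) :
    ∃ d' : κ → M, θ.Realize (Sum.elim (entry β 0) (Sum.elim d' sol)) ∧
      (∀ k, d' k ∈ acl L (Set.range (Sum.elim sol (entry β 0)))) ∧
      ∀ k, d' k ∉ Set.range (entry β 0) := by
  choose δ m hm hδ using fun k => mem_acl_range.1 (hd k)
  have hm' : ∀ k, AtMost (m k) fun y =>
      (δ k).Realize (Sum.elim (Sum.elim sol (entry β 0)) fun _ => y) := fun k =>
    ((isFirstOrder_atMost_realize (δ k) (m k)).transfer (h.sameType_row 0 β)).1 (hm k)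
  by_contra! hcon
  let G : Set (κ → M) := {d' | θ.Realize (Sum.elim (entry β 0) (Sum.elim d' sol)) ∧
    ∀ k, (δ k).Realize (Sum.elim (Sum.elim sol (entry β 0)) fun _ => d' k)}
  have hGf : G.Finite := (Set.Finite.pi' fun k => (hm' k).finite).subset fun d' hd' => hd'.2
  have hG : ∀ d' : G, ∃ k i, entry β 0 i = d'.1 k := fun d' =>
    hcon d'.1 d'.2.1 fun k => mem_acl_range.2 ⟨δ k, m k, hm' k, d'.2.2 k⟩
  choose k i hki using hG
  have := hGf.to_subtype
  have hfo : IsFirstOrder L fun (M : Type w) _ (x : Fin n ⊕ ι → M) => ∀ d' : κ → M,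
      (θ.Realize (Sum.elim (fun i => x (Sum.inr i)) (Sum.elim d' fun i => x (Sum.inl i))) ∧
        ∀ k, (δ k).Realize (Sum.elim x fun _ => d' k)) → ∃ g : G, x (Sum.inr (i g)) = d' (k g) :=
    .forall_tuple (.imp (.and
      (.of_formula θ (Sum.elim (Sum.inl ∘ Sum.inr) (Sum.elim Sum.inr (Sum.inl ∘ Sum.inl)))
        fun M x b => by rcases b with b | b | b <;> rfl)
      (.forall_finite fun k => .of_formula (δ k) (Sum.elim Sum.inl fun _ => Sum.inr k)
        fun M x b => by rcases b with b | b <;> rfl))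
      (.exists_finite fun g => .eq _ _))
  obtain ⟨g, hg⟩ := (hfo.transfer (h.sameType_row β 0)).1
    (fun d' hd' => ⟨⟨d', hd'⟩, hki ⟨d', hd'⟩⟩) d ⟨hθ, hδ⟩
  exact hd' _ ⟨_, hg⟩

/-- The condition on a row that there are `K` solutions, the nonalgebraic parts of which are
disjoint. -/
def DisjointSolutions {M : Type w} [L.Structure M] (θ : L.Formula (ι ⊕ (κ ⊕ Fin n))) (K : ℕ)
    (e : ι → M) (x : Fin K × Fin n → M) (d : Fin K × κ → M) : Prop :=
  (∀ t, θ.Realize (Sum.elim e (Sum.elim (fun k => d (t, k)) fun i => x (t, i)))) ∧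
    ∀ t t' k l, t ≠ t' → ¬ d (t, k) = d (t', l)

theorem isFirstOrder_disjointSolutions (θ : L.Formula (ι ⊕ (κ ⊕ Fin n))) (K : ℕ) {β : Type*}
    (f : ι → β) (g : Fin K × Fin n → β) (h : Fin K × κ → β) :
    IsFirstOrder L fun (M : Type w) _ (y : β → M) =>
      DisjointSolutions θ K (fun i => y (f i)) (fun i => y (g i)) fun i => y (h i) :=
  .and (.forall_finite fun t => .of_formula θ (Sum.elim f (Sum.elim (fun k => h (t, k))
      fun i => g (t, i))) fun M x b => by rcases b with b | b | b <;> rfl)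
    (.forall_finite fun t => .forall_finite fun t' => .forall_finite fun k => .forall_finite fun l =>
      .imp (by by_cases h : t = t'
               · simpa [h] using IsFirstOrder.false
               · simpa [h] using IsFirstOrder.false.not) (.not (.eq _ _)))

/-- Concatenate the algebraic parts over `N` rows. By independence no coordinate is algebraic over
the column, so solutions exist outside any finite set and can be chosen successively disjoint. -/
theorem IndependentPath.exists_disjointSolutions {M : Type w} [L.Structure M]
    {entry : ℕ → ℕ → ι → M} {sol : Fin n → M} (h : IndependentPath L entry sol)
    {θ : L.Formula (ι ⊕ (κ ⊕ Fin n))}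
    {d : κ → M} (hθ : θ.Realize (Sum.elim (entry 0 0) (Sum.elim d sol)))
    (hd : ∀ k, d k ∈ acl L (Set.range (Sum.elim sol (entry 0 0))))
    (hd' : ∀ k, d k ∉ Set.range (entry 0 0)) (K N : ℕ) :
    ∃ x : Fin K × Fin n → M, ∀ β < N, ∃ d, DisjointSolutions θ K (entry β 0) x d := by
  choose d' hθ' hacl hmem using h.exists_row hθ hd hd'
  let R : ∀ (M : Type w) [L.Structure M], ((ℕ × ι) ⊕ (Fin N × κ) → M) → Prop := fun M _ y =>
    ∃ x : Fin n → M, ∀ β : Fin N, θ.Realize (Sum.elim (fun i => y (Sum.inl (β, i)))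
      (Sum.elim (fun k => y (Sum.inr (β, k))) x))
  have hR : IsFirstOrder L R := .exists_tuple (.forall_finite fun β =>
    .of_formula θ (Sum.elim (fun i => Sum.inl (Sum.inl (β, i)))
      (Sum.elim (fun k => Sum.inl (Sum.inr (β, k))) Sum.inr))
      fun M x b => by rcases b with b | b | b <;> rfl)
  obtain ⟨W, hW, hdisj⟩ := exists_disjoint_sequence
    (Q := fun w => R M (Sum.elim (fun p : ℕ × ι => entry p.1 0 p.2) w)) fun F hF =>
      exists_solution_avoiding hR (e := fun p : ℕ × ι => entry p.1 0 p.2)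
        (w := fun p : Fin N × κ => d' p.1 p.2) ⟨sol, fun β => hθ' β⟩
        (fun p => h.notMem_acl p.1 _ (hacl _ _) (hmem _ _)) hF
  choose x hx using hW
  exact ⟨fun p => x p.1 p.2, fun β hβ => ⟨fun p => W p.1 (⟨β, hβ⟩, p.2), fun t => hx t ⟨β, hβ⟩,
    fun t t' k l htt => hdisj t t' (fun h => htt (Fin.ext h)) _ _⟩⟩

end Amalgamation

/-! ### Two compatible copies over one row -/

section Copies

variable {L : Language.{u, v}} {T : L.Theory} {ι κ : Type*} [Finite κ] {n : ℕ}

/-- Copies of a solution over the entries `0` and `1` of the first row, which share the solution,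
avoid a given finite set, and do not have conflicting colours. -/
theorem IndependentPath.exists_copies (hT : T.IsNTP2) (M : Theory.ModelType.{u, v, max u v} T)
    {entry : ℕ → ℕ → ι → M} {sol : Fin n → M} (h : IndependentPath L entry sol)
    {θ : L.Formula (ι ⊕ (κ ⊕ Fin n))} {d : κ → M}
    (hθ : θ.Realize (Sum.elim (entry 0 0) (Sum.elim d sol)))
    (hd : ∀ k, d k ∈ acl L (Set.range (Sum.elim sol (entry 0 0))))
    (hd' : ∀ k, d k ∉ Set.range (entry 0 0)) (C : κ → Prop)
    (hC : ∀ k l, C k → ¬ C l → d k ≠ d l) (F : Finset M) :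
    ∃ (c : Fin n → M) (d₀ d₁ : κ → M), θ.Realize (Sum.elim (entry 0 0) (Sum.elim d₀ c)) ∧
      θ.Realize (Sum.elim (entry 0 1) (Sum.elim d₁ c)) ∧ (∀ k, d₀ k ∉ F ∧ d₁ k ∉ F) ∧
      ∀ k l, C k → ¬ C l → d₀ k ≠ d₁ l ∧ d₁ k ≠ d₀ l := by
  classical
  have := Fintype.ofFinite κ
  obtain ⟨θ', hθ'⟩ : IsFirstOrder L fun (M : Type (max u v)) _ (z : ι ⊕ (κ ⊕ Fin n) → M) =>
      θ.Realize (fun i => z i) ∧ ∀ p : {p : κ × κ // C p.1 ∧ ¬ C p.2},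
        ¬ z (Sum.inr (Sum.inl p.1.1)) = z (Sum.inr (Sum.inl p.1.2)) :=
    .and (.of_formula θ id fun _ _ _ => rfl) (.forall_finite fun p => .not (.eq _ _))
  have hθd : θ'.Realize (Sum.elim (entry 0 0) (Sum.elim d sol)) :=
    (hθ' M _).2 ⟨hθ, fun p => hC _ _ p.2.1 p.2.2⟩
  -- `K` columns ensure a conflict-free pair, `K₂` disjoint copies ensure that one avoids `F`, and
  -- `K₁` exceeds `K * K * K₂`, so some pair of columns works for at least `K₂` copies.
  let K := 2 ^ Fintype.card κ + 1
  let K₂ := 2 * F.card + 1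
  let K₁ := K * K * K₂ + 1
  obtain ⟨Θ, hΘ⟩ : IsFirstOrder L fun (M : Type (max u v)) _ (z : ι ⊕ (Fin K₁ × Fin n) → M) =>
      ∃ d, DisjointSolutions θ' K₁ (fun i => z (Sum.inl i)) (fun i => z (Sum.inr i)) d :=
    .exists_tuple (isFirstOrder_disjointSolutions θ' K₁ _ _ _)
  obtain ⟨x, hx⟩ := hT.exists_realize_row M h.indiscernible Θ (fun N => by
    obtain ⟨x, hx⟩ := h.exists_disjointSolutions hθd hd hd' K₁ N
    exact ⟨x, fun β hβ => (hΘ M _).2 (hx β hβ)⟩) K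
  choose D hD using fun s : Fin K => (hΘ M _).1 (hx s s.2)
  have hpair : ∀ t : Fin K₁, ∃ p : Fin K × Fin K, p.1 < p.2 ∧ ∀ k l, C k → ¬ C l →
      D p.1 (t, k) ≠ D p.2 (t, l) ∧ D p.2 (t, k) ≠ D p.1 (t, l) := fun t => by
    obtain ⟨s, s', hss, hs⟩ := exists_no_conflict C (Nat.lt_succ_self _) (fun s k => D s (t, k))
      fun s k l hk hl => ((hθ' M _).1 ((hD s).1 t)).2 ⟨(k, l), hk, hl⟩
    exact ⟨(s, s'), hss, hs⟩
  choose p hp hpC using hpair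
  obtain ⟨⟨s, s'⟩, hfib⟩ := Fintype.exists_lt_card_fiber_of_mul_lt_card (f := p) (n := K₂)
    (by simp [K₁])
  obtain ⟨t, ht⟩ : ∃ t : Fin K₂ ↪ Fin K₁, ∀ r, p (t r) = (s, s') := by
    have hle : Fintype.card (Fin K₂) ≤
        Fintype.card (Finset.univ.filter fun r => p r = (s, s')) := by
      rw [Fintype.card_fin, Fintype.card_coe]
      exact hfib.le
    obtain ⟨e⟩ := Function.Embedding.nonempty_of_card_le hle
    exact ⟨e.trans (Function.Embedding.subtype _), fun r => (Finset.mem_filter.1 (e r).2).2⟩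
  have hss : s < s' := by
    have := hp (t 0)
    rwa [ht] at this
  -- Indiscernibility moves columns `s` and `s'` to `0` and `1`. It need not respect `F`, so all
  -- `K₂` copies are moved and one avoiding `F` is chosen afterwards.
  let col : ℕ → ℕ := fun k => if k = 0 then s else s' + (k - 1)
  have hcol : StrictMono col := by
    intro k l hkl
    have : s.1 < s'.1 := hss
    simp only [col]
    split_ifs <;> omega
  have hfo : IsFirstOrder L fun (M : Type (max u v)) _ (z : Fin 1 × ℕ × ι → M) =>
      ∃ (x : Fin K₂ × Fin n → M) (d₀ d₁ : Fin K₂ × κ → M),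
        (DisjointSolutions θ' K₂ (fun i => z (0, 0, i)) x d₀ ∧
          DisjointSolutions θ' K₂ (fun i => z (0, 1, i)) x d₁) ∧
        ∀ (r : Fin K₂) (p : {p : κ × κ // C p.1 ∧ ¬ C p.2}),
          ¬ d₀ (r, p.1.1) = d₁ (r, p.1.2) ∧ ¬ d₁ (r, p.1.1) = d₀ (r, p.1.2) :=
    .exists_tuple (.exists_tuple (.exists_tuple (.and
      (.and (isFirstOrder_disjointSolutions θ' K₂ _ _ _)
        (isFirstOrder_disjointSolutions θ' K₂ _ _ _))
      (.forall_finite fun r => .forall_finite fun p =>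
        .and (.not (.eq _ _)) (.not (.eq _ _))))))
  have hmove := hfo.transfer (h.indiscernible (N := 1) (ρ := Fin.val) (ρ' := Fin.val)
    (s := fun _ => col) (s' := fun _ => id) Fin.val_strictMono Fin.val_strictMono
    (fun _ => hcol) fun _ => strictMono_id)
  obtain ⟨x', d₀, d₁, ⟨h₀, h₁⟩, hcol'⟩ := hmove.1
    ⟨fun r => x (t r.1, r.2), fun r => D s (t r.1, r.2), fun r => D s' (t r.1, r.2),
      ⟨⟨fun r => (hD s).1 (t r), fun r r' k l hrr =>
        (hD s).2 _ _ k l fun h => hrr (t.injective h)⟩,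
      ⟨fun r => (hD s').1 (t r), fun r r' k l hrr =>
        (hD s').2 _ _ k l fun h => hrr (t.injective h)⟩⟩,
      fun r q => by
        have := hpC (t r) q.1.1 q.1.2 q.2.1 q.2.2
        rwa [ht] at this⟩
  obtain ⟨r, hr⟩ := exists_avoiding_of_card_lt (Nat.lt_succ_self (2 * F.card))
    (fun r k => d₀ (r, k)) (fun r k => d₁ (r, k)) (fun r r' hrr k l => h₀.2 r r' k l hrr)
    fun r r' hrr k l => h₁.2 r r' k l hrr
  exact ⟨fun i => x' (r, i), fun k => d₀ (r, k), fun k => d₁ (r, k), ((hθ' M _).1 (h₀.1 r)).1,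
    ((hθ' M _).1 (h₁.1 r)).1, hr, fun k l hk hl => hcol' r ⟨(k, l), hk, hl⟩⟩

end Copies

/-! ### Amalgams by compactness -/

section Amalgam

variable {L : Language.{u, v}} {T : L.Theory} {ι : Type*} {n : ℕ}

theorem IsIndiscernibleArray.sameType_entry {M : Type w} [L.Structure M] {entry : ℕ → ℕ → ι → M}
    (h : IsIndiscernibleArray L entry) (β k l : ℕ) : SameType L (entry β k) (entry β l) := by
  have := (h (N := 1) (ρ := fun _ => β) (ρ' := fun _ => β) (s := fun _ i => k + i)
    (s' := fun _ i => l + i) (Subsingleton.strictMono _) (Subsingleton.strictMono _)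
    (fun _ i j hij => Nat.add_lt_add_left hij _) fun _ i j hij => Nat.add_lt_add_left hij _).comp
      fun i : ι => ((0, 0, i) : Fin 1 × ℕ × ι)
  exact this

/-- A finite approximation of the two copies of the algebraic closure of `sol` and an entry. -/
theorem IndependentPath.exists_finite_amalgam (hT : T.IsNTP2)
    (M : Theory.ModelType.{u, v, max u v} T) {entry : ℕ → ℕ → ι → M} {sol : Fin n → M}
    (h : IndependentPath L entry sol) (P : Set M)
    {D : Set M} (hD : D = acl L (Set.range (Sum.elim sol (entry 0 0)))) (s : Finset D)
    (q : Finset (L.Formula D)) (hq : ∀ ψ ∈ q, ψ.Realize (Subtype.val : D → M))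
    (F : Finset M) :
    ∃ σ : Fin 2 → D → M,
      (∀ i, ∀ ψ ∈ q, ψ.Realize (σ i)) ∧
      (∀ i (d : D) j, (d : M) = entry 0 0 j → σ i d = entry 0 i j) ∧
      (∀ d : D, (d : M) ∈ Set.range sol → σ 0 d = σ 1 d) ∧
      (∀ i, ∀ d ∈ s, (d : M) ∉ Set.range (entry 0 0) → σ i d ∉ F) ∧
      ∀ d ∈ s, ∀ e ∈ s, (d : M) ∉ Set.range (entry 0 0) → (e : M) ∉ Set.range (entry 0 0) →
        (d : M) ∈ P → (e : M) ∉ P → σ 0 d ≠ σ 1 e ∧ σ 1 d ≠ σ 0 e := by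
  classical
  have hsol : ∀ j, sol j ∈ D := fun j => hD ▸ subset_acl _ ⟨Sum.inl j, rfl⟩
  obtain ⟨θ₀, hθ₀⟩ : IsFirstOrder L fun (M : Type (max u v)) _ (z : D ⊕ Fin n → M) =>
      (∀ ψ : q, ψ.1.Realize fun d => z (Sum.inl d)) ∧
        ∀ j, z (Sum.inl ⟨sol j, hsol j⟩) = z (Sum.inr j) :=
    .and (.forall_finite fun ψ => .of_formula ψ.1 Sum.inl fun _ _ _ => rfl)
      (.forall_finite fun j => .eq _ _)
  obtain ⟨s₀, θ₁, hθ₁⟩ := θ₀.exists_finite_support_left.{u, v, max u v}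
  let κ := {d : D // d ∈ s₀ ∪ s ∧ (d : M) ∉ Set.range (entry 0 0)}
  have : Finite κ := Finite.of_injective (fun k : κ => (⟨k.1, k.2.1⟩ : ↥(s₀ ∪ s)))
    fun k l hkl => Subtype.ext (Subtype.mk.inj hkl)
  choose p hp using fun d : {d : D // (d : M) ∈ Set.range (entry 0 0)} => d.2
  let cls : s₀ → ι ⊕ (κ ⊕ Fin n) := fun d =>
    if hd : ((d : D) : M) ∈ Set.range (entry 0 0) then Sum.inl (p ⟨d, hd⟩)
    else Sum.inr (Sum.inl ⟨d, Finset.mem_union_left _ d.2, hd⟩)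
  let θ : L.Formula (ι ⊕ (κ ⊕ Fin n)) := θ₁.relabel (Sum.elim cls fun j => Sum.inr (Sum.inr j))
  -- Entry points move to column `i`, and the tracked points outside the entry to `w`. Elsewhere the
  -- identity is harmless, since the truth of `θ₀` depends only on `s₀`, and it makes `τ 0` the
  -- inclusion for the original `w`.
  let τ : ℕ → (κ → M) → D → M := fun i w d =>
    if hd : (d : M) ∈ Set.range (entry 0 0) then entry 0 i (p ⟨d, hd⟩)
    else if hd' : d ∈ s₀ ∪ s then w ⟨d, hd', hd⟩ else d
  have hτ : ∀ i (w : κ → M) (k : κ), τ i w k.1 = w k := fun i w k => by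
    simp only [τ, dif_neg k.2.2, dif_pos k.2.1, Subtype.coe_eta]
  have hθ : ∀ i (w : κ → M) c, θ.Realize (Sum.elim (entry 0 i) (Sum.elim w c)) ↔
      (∀ ψ : q, ψ.1.Realize (τ i w)) ∧ ∀ j, τ i w ⟨sol j, hsol j⟩ = c j := fun i w c => by
    rw [Formula.realize_relabel]
    refine Iff.trans ?_ (hθ₀ M (Sum.elim (τ i w) c))
    rw [hθ₁]
    refine iff_of_eq (congrArg _ (funext fun d => ?_))
    rcases d with d | j
    · by_cases hd : ((d : D) : M) ∈ Set.range (entry 0 0)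
      · simp only [Function.comp_apply, Sum.elim_inl, cls, τ, dif_pos hd]
      · have hd' : (d : D) ∈ s₀ ∪ s := Finset.mem_union_left _ d.2
        simp only [Function.comp_apply, Sum.elim_inl, Sum.elim_inr, cls, τ, dif_neg hd, dif_pos hd']
    · rfl
  have hτ0 : τ 0 (fun k => k.1) = Subtype.val := funext fun d => by
    by_cases hd : (d : M) ∈ Set.range (entry 0 0)
    · simp only [τ, dif_pos hd]
      exact hp ⟨d, hd⟩
    · by_cases hd' : d ∈ s₀ ∪ s
      · simp only [τ, dif_neg hd, dif_pos hd']
      · simp only [τ, dif_neg hd, dif_neg hd']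
  obtain ⟨c, d₀, d₁, h₀, h₁, hF, hC⟩ := h.exists_copies hT M (θ := θ) (d := fun k => k.1)
    ((hθ 0 _ _).2 (by rw [hτ0]; exact ⟨fun ψ => hq _ ψ.2, fun j => rfl⟩))
    (fun k => hD ▸ k.1.2) (fun k => k.2.2) (fun k => (k.1 : M) ∈ P)
    (fun k l hk hl hkl => hl (hkl ▸ hk)) F
  rw [hθ] at h₀ h₁
  have hp' : ∀ (i : ℕ) (w : κ → M) (d : D) j, (d : M) = entry 0 0 j → τ i w d = entry 0 i j :=
    fun i w d j hdj => by
      have hd : (d : M) ∈ Set.range (entry 0 0) := ⟨j, hdj.symm⟩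
      simp only [τ, dif_pos hd]
      exact ((IsIndiscernibleArray.sameType_entry h.indiscernible 0 0 i).eq_iff _ _).1 ((hp ⟨d, hd⟩).trans hdj)
  refine ⟨![τ 0 d₀, τ 1 d₁], ?_, ?_, ?_, ?_, ?_⟩
  · rw [Fin.forall_fin_two]
    exact ⟨fun ψ hψ => h₀.1 ⟨ψ, hψ⟩, fun ψ hψ => h₁.1 ⟨ψ, hψ⟩⟩
  · rw [Fin.forall_fin_two]
    exact ⟨fun d j hdj => hp' 0 d₀ d j hdj, fun d j hdj => hp' 1 d₁ d j hdj⟩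
  · rintro ⟨_, hd⟩ ⟨j, rfl⟩
    exact (h₀.2 j).trans (h₁.2 j).symm
  · rw [Fin.forall_fin_two]
    refine ⟨fun d hd hd' => ?_, fun d hd hd' => ?_⟩
    · have := (hF ⟨d, Finset.mem_union_right _ hd, hd'⟩).1
      rwa [← hτ 0 d₀] at this
    · have := (hF ⟨d, Finset.mem_union_right _ hd, hd'⟩).2
      rwa [← hτ 1 d₁] at this
  · intro d hd e he hd' he' hdP heP
    have := hC ⟨d, Finset.mem_union_right _ hd, hd'⟩ ⟨e, Finset.mem_union_right _ he, he'⟩ hdP heP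
    rwa [← hτ 0 d₀, ← hτ 0 d₀, ← hτ 1 d₁, ← hτ 1 d₁] at this

/-- Two copies of the algebraic closure of `sol` and an entry, which share `sol`, lie over the
entries `0` and `1` of the first row, avoid the given model and agree on the predicate `P`. -/
theorem IndependentPath.exists_amalgam (hT : T.IsNTP2)
    (M : Theory.ModelType.{u, v, max u v} T) {entry : ℕ → ℕ → ι → M} {sol : Fin n → M}
    (h : IndependentPath L entry sol) (P : Set M)
    {D : Set M} (hD : D = acl L (Set.range (Sum.elim sol (entry 0 0)))) :
    ∃ (I : Type (max u v)) (U : Ultrafilter I)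
      (f : Fin 2 → D → Ultrapower U M),
      (∀ i, SameType L (Subtype.val : D → M) (f i)) ∧
      (∀ i (d : D) j, (d : M) = entry 0 0 j → f i d = Ultrapower.diag L U (entry 0 i j)) ∧
      (∀ d : D, (d : M) ∈ Set.range sol → f 0 d = f 1 d) ∧
      (∀ i (d : D), (d : M) ∉ Set.range (entry 0 0) → f i d ∉ Set.range (Ultrapower.diag L U (M := M))) ∧
      ∀ i j (d e : D), (d : M) ∉ Set.range (entry 0 0) → (e : M) ∉ Set.range (entry 0 0) →
        f i d = f j e → ((d : M) ∈ P ↔ (e : M) ∈ P) := by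
  classical
  let Idx := Finset D × Finset {ψ : L.Formula D // ψ.Realize (Subtype.val : D → M)} × Finset M
  choose σ hσ hσe hσs hσF hσP using fun j : Idx =>
    h.exists_finite_amalgam hT M P hD j.1 (j.2.1.image Subtype.val)
      (fun ψ hψ => by
        obtain ⟨ψ', -, rfl⟩ := Finset.mem_image.1 hψ
        exact ψ'.2) j.2.2
  let U : Ultrafilter Idx := Ultrafilter.of atTop
  have hU : (U : Filter Idx) ≤ atTop := Ultrafilter.of_le _
  have hmem : ∀ d : D, ∀ᶠ j : Idx in U, d ∈ j.1 := fun d =>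
    ((eventually_ge_atTop (({d}, ∅, ∅) : Idx)).filter_mono hU).mono fun j hj =>
      Finset.singleton_subset_iff.1 hj.1
  have hmem' : ∀ ψ, ∀ᶠ j : Idx in U, ψ ∈ j.2.1 := fun ψ =>
    ((eventually_ge_atTop ((∅, {ψ}, ∅) : Idx)).filter_mono hU).mono fun j hj =>
      Finset.singleton_subset_iff.1 hj.2.1
  have hmemF : ∀ a, ∀ᶠ j : Idx in U, a ∈ j.2.2 := fun a =>
    ((eventually_ge_atTop ((∅, ∅, {a}) : Idx)).filter_mono hU).mono fun j hj =>
      Finset.singleton_subset_iff.1 hj.2.2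
  have hreal : ∀ i (ψ : L.Formula D), ψ.Realize (Subtype.val : D → M) →
      ψ.Realize fun d => Ultrapower.mk U fun j => σ j i d := fun i ψ hψ => by
    rw [Ultrapower.realize_mk]
    exact (hmem' ⟨ψ, hψ⟩).mono fun j hj => hσ j i _ (Finset.mem_image_of_mem _ hj)
  have hsame : ∀ i, SameType L (Subtype.val : D → M)
      fun d => Ultrapower.mk U fun j => σ j i d := fun i ψ => ⟨hreal i ψ, fun h => by
    by_contra hψ
    exact (Formula.realize_not.1 (hreal i ψ.not (Formula.realize_not.2 hψ))) h⟩
  have hconf : ∀ i j (d e : D), (d : M) ∉ Set.range (entry 0 0) → (e : M) ∉ Set.range (entry 0 0) →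
      Ultrapower.mk U (fun l => σ l i d) = Ultrapower.mk U (fun l => σ l j e) →
        (d : M) ∈ P → (e : M) ∈ P := by
    intro i j d e hd he hde hdP
    by_contra heP
    -- Within one copy, equality of types gives injectivity; only the two different copies need the
    -- no-conflict condition.
    by_cases hij : i = j
    · subst hij
      have : (d : M) = e := ((hsame i).eq_iff d e).2 hde
      exact heP (this ▸ hdP)
    · rw [Ultrapower.mk_eq_mk] at hde
      obtain ⟨l, hl, hld, hle⟩ := (hde.and ((hmem d).and (hmem e))).exists
      have := hσP l d hld e hle hd he hdP heP
      fin_cases i <;> fin_cases j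
      · exact hij rfl
      · exact this.1 hl
      · exact this.2 hl
      · exact hij rfl
  refine ⟨Idx, U, fun i d => Ultrapower.mk U fun j => σ j i d, hsame, fun i d j hdj => ?_,
    fun d hd => ?_, fun i d hd => ?_, fun i j d e hd he hde => ⟨hconf i j d e hd he hde,
      hconf j i e d he hd hde.symm⟩⟩
  · rw [Ultrapower.diag_apply, Ultrapower.mk_eq_mk]
    exact Eventually.of_forall fun l => hσe l i d j hdj
  · rw [Ultrapower.mk_eq_mk]
    exact Eventually.of_forall fun l => hσs l d hd
  · rintro ⟨a, ha⟩
    rw [Ultrapower.diag_apply, Ultrapower.mk_eq_mk] at ha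
    obtain ⟨l, hl, hld, hla⟩ := (ha.and ((hmem d).and (hmemF a))).exists
    exact hσF l i d hld hd (hl ▸ hla)

end Amalgam

/-! ### Colouring the amalgam -/

section GenericAmalgam

variable {L : Language.{u, v}} {T : L.Theory} {S : L.Formula (Fin 1)} {ι : Type*} {n : ℕ}

/-- In a model with a generic predicate, the solution `sol` can be moved to a tuple that has the
same `L_P`-type over the entries `0` and `1` of the first row. -/
theorem IndependentPath.exists_sameType_withPredicate (hT : T.EliminatesExistsInfty)
    (hT' : T.IsNTP2) {M : Type (max u v)} [L.Structure M] [Nonempty M]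
    [L.withPredicate.Structure M] [(LHom.sumInl : L →ᴸ L.withPredicate).IsExpansionOn M]
    (hM : M ⊨ T.genericPredicate S) {entry : ℕ → ℕ → ι → M} {sol : Fin n → M}
    (h : IndependentPath L entry sol)
    (hP : ∀ i j, InPredicate L (entry 0 0 j) ↔ InPredicate L (entry 0 i j)) :
    ∃ (I : Type (max u v)) (U : Ultrafilter I) (c : Fin n → Ultrapower U M), ∀ i : Fin 2,
      SameType L.withPredicate (Sum.elim sol (entry 0 0))
        (Sum.elim c (Ultrapower.diag L.withPredicate U ∘ entry 0 i)) := by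
  have hMT : M ⊨ T := Theory.model_of_model_genericPredicate hM
  obtain ⟨D, hD⟩ : ∃ D : Set M, D = acl L (Set.range (Sum.elim sol (entry 0 0))) := ⟨_, rfl⟩
  have hmem : ∀ j, Sum.elim sol (entry 0 0) j ∈ D := fun j => hD ▸ subset_acl _ ⟨j, rfl⟩
  obtain ⟨I, U, f, hf, hfe, hfs, hfd, hfP⟩ :=
    h.exists_amalgam hT' (Theory.ModelType.of T M) {a : M | InPredicate L a} hD
  let N : Type (max u v) := Ultrapower U M
  let j : M ↪ₑ[L] N := Ultrapower.diag L U
  have hN : N ⊨ T := (j.theory_model_iff T).1 hMT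
  -- Keep the colours of `M` and copy those of the new points. New points avoid `M`, and
  -- coincidences between them respect `P`, so `Q` induces the intended colours on `M` and on both
  -- copies.
  let Q : Set N := j '' {a : M | InPredicate L a} ∪
    {b | ∃ (i : Fin 2) (d : D), (d : M) ∉ Set.range (entry 0 0) ∧ InPredicate L (d : M) ∧ f i d = b}
  have hQS : ∀ b ∈ Q, S.Realize fun _ => b := by
    rintro _ (⟨a, ha, rfl⟩ | ⟨i, d, -, hd, rfl⟩)
    · exact (j.map_formula S fun _ => a).2 (Theory.realize_of_inPredicate hM ha)
    · exact ((hf i).comp (fun _ : Fin 1 => d) S).1 (Theory.realize_of_inPredicate hM hd)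
  have hQj : ∀ a, j a ∈ Q ↔ InPredicate L a := by
    refine fun a => ⟨?_, fun ha => Or.inl ⟨a, ha, rfl⟩⟩
    rintro (⟨a', ha', haa⟩ | ⟨i, d, hd, -, hda⟩)
    · exact j.injective haa ▸ ha'
    · exact (hfd i d hd ⟨a, hda.symm⟩).elim
  have hQf : ∀ i (d : D), InPredicate L (d : M) ↔ f i d ∈ Q := by
    intro i d
    by_cases hd : (d : M) ∈ Set.range (entry 0 0)
    · obtain ⟨l, hl⟩ := hd
      have := hfe i d l hl.symm
      rw [this]
      refine Iff.trans ?_ (hQj _).symm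
      rw [← hl]
      exact hP i l
    · refine ⟨fun h => Or.inr ⟨i, d, hd, h, rfl⟩, ?_⟩
      rintro (⟨a, -, ha⟩ | ⟨i', d', hd', hP', hdd⟩)
      · exact (hfd i d hd ⟨a, ha⟩).elim
      · exact (hfP i' i d' d hd' hd hdd).1 hP'
  -- Embedding over all of `M` keeps both entries fixed, so the two coloured copies become
  -- realizations over actual row entries.
  obtain ⟨I', U', g, hg, hgQ, hgj⟩ := Theory.exists_embedding_ultrapower hT hN hM hQS
    (x := j) (y := id) j.acl_range_subset (j.sameType id).symm hQj
  have hM' : Ultrapower U' M ⊨ T.genericPredicate S :=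
    ((Ultrapower.diag L.withPredicate U' (M := M)).theory_model_iff _).1 hM
  have hiso : ∀ i, AclIso T S (Subtype.val : D → M) (g ∘ f i) := fun i => by
    refine ⟨hM, hM', ?_, (hf i).trans (hg.comp (f i)), fun d => (hQf i d).trans (hgQ _)⟩
    rw [Subtype.range_val, hD]
    exact acl_acl_subset _
  refine ⟨I', U', fun k => g (f 0 ⟨sol k, hmem (Sum.inl k)⟩), fun i => ?_⟩
  convert ((hiso i).sameType_withPredicate hT).comp fun k => (⟨_, hmem k⟩ : D) using 1
  · exact funext fun k => by rcases k with k | k <;> rfl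
  funext k
  rcases k with k | k
  · change g (f 0 _) = g (f i _)
    have h0 := hfs ⟨sol k, hmem (Sum.inl k)⟩ ⟨k, rfl⟩
    fin_cases i
    · rfl
    · exact congrArg g h0
  · change Ultrapower.diag L.withPredicate U' (entry 0 i k) = g (f i ⟨entry 0 0 k, _⟩)
    have h0 := hfe i ⟨entry 0 0 k, hmem (Sum.inr k)⟩ k rfl
    exact ((congrArg g h0).trans (hgj (entry 0 i k))).symm

end GenericAmalgam

/-! ### Witnesses of `TP₂` of minimal dimension -/

section MinimalDimension

variable {L : Language.{u, v}} {T : L.Theory} {S : L.Formula (Fin 1)}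

theorem SameType.of_withPredicate {M N X : Type*} [L.Structure M] [L.withPredicate.Structure M]
    [(LHom.sumInl : L →ᴸ L.withPredicate).IsExpansionOn M] [L.Structure N]
    [L.withPredicate.Structure N] [(LHom.sumInl : L →ᴸ L.withPredicate).IsExpansionOn N]
    {x : X → M} {y : X → N} (h : SameType L.withPredicate x y) : SameType L x y := fun ψ => by
  rw [← realize_toWithPredicate ψ x, ← realize_toWithPredicate ψ y]
  exact h _

theorem PathArray.inconsistent_of_ne {M : Type w} [L.Structure M] {n m : ℕ}
    {φ : L.Formula (Fin n ⊕ Fin m)} {ι : Type w} (p : PathArray M φ ι) (β : ℕ) {i j : ℕ}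
    (hij : i ≠ j) : ¬ ∃ x : Fin n → M, φ.Realize (Sum.elim x (p.entry β i ∘ p.param)) ∧
      φ.Realize (Sum.elim x (p.entry β j ∘ p.param)) := by
  have hlt : ∀ i j, i < j → ¬ ∃ x : Fin n → M,
      φ.Realize (Sum.elim x (p.entry β i ∘ p.param)) ∧
        φ.Realize (Sum.elim x (p.entry β j ∘ p.param)) := fun i j hij hx => by
    let col : ℕ → ℕ := fun k => if k = 0 then i else j + (k - 1)
    have hcol : StrictMono col := by
      intro k l hkl
      simp only [col]
      split_ifs <;> omega
    have hfo : IsFirstOrder L fun (M : Type w) _ (z : Fin 1 × ℕ × ι → M) => ∃ x : Fin n → M,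
        φ.Realize (Sum.elim x fun k => z (0, 0, p.param k)) ∧
          φ.Realize (Sum.elim x fun k => z (0, 1, p.param k)) :=
      .exists_tuple (.and
        (.of_formula φ (Sum.elim Sum.inr fun k => Sum.inl (0, 0, p.param k))
          fun M x b => by rcases b with b | b <;> rfl)
        (.of_formula φ (Sum.elim Sum.inr fun k => Sum.inl (0, 1, p.param k))
          fun M x b => by rcases b with b | b <;> rfl))
    exact p.inconsistent ((hfo.transfer (p.indiscernible (N := 1) (ρ := fun _ => β)
      (ρ' := fun _ => 0) (s := fun _ => col) (s' := fun _ => id) (Subsingleton.strictMono _)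
      (Subsingleton.strictMono _) (fun _ => hcol) fun _ => strictMono_id)).1 hx)
  rcases hij.lt_or_gt with h | h
  · exact hlt i j h
  · exact fun ⟨x, hx, hx'⟩ => hlt j i h ⟨x, hx', hx⟩

section Model

variable {M : Type (max u v)} [L.Structure M]
  [L.withPredicate.Structure M] [(LHom.sumInl : L →ᴸ L.withPredicate).IsExpansionOn M]
  {ι : Type (max u v)} {n m : ℕ} {φ : L.withPredicate.Formula (Fin n ⊕ Fin m)}

theorem PathArray.isIndiscernibleArray (p : PathArray M φ ι) :
    IsIndiscernibleArray L p.entry := fun hρ hρ' hs hs' =>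
  (p.indiscernible hρ hρ' hs hs').of_withPredicate

theorem PathArray.acl_range_entry_subset (p : PathArray M φ ι) (β k : ℕ) :
    acl L (Set.range (p.entry β k)) ⊆ Set.range (p.entry β k) :=
  acl_range_subset_of_witness fun ψ => by
    have := p.witness β k ψ.toWithPredicate
    simpa only [realize_toWithPredicate] using this

/-- The amalgam yields a common solution over entries `0` and `1` in an ultrapower; its existence
transfers to `M` and contradicts row inconsistency. -/
theorem PathArray.not_independentPath [Nonempty M] (hT : T.EliminatesExistsInfty) (hT' : T.IsNTP2)
    (hM : M ⊨ T.genericPredicate S) (p : PathArray M φ ι) :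
    ¬ IndependentPath L p.entry p.sol := fun h => by
  obtain ⟨I, U, c, hc⟩ := h.exists_sameType_withPredicate hT hT' hM fun i j => by
    have := IsIndiscernibleArray.sameType_entry p.indiscernible 0 0 i (predicateFormula L j)
    rwa [realize_predicateFormula, realize_predicateFormula] at this
  have hφ : ∀ i : Fin 2, φ.Realize (Sum.elim c
      ((Ultrapower.diag L.withPredicate U ∘ p.entry 0 i) ∘ p.param)) := fun i => by
    have h1 := ((hc i).comp (Sum.map id p.param) φ).1 (by
      rw [Sum.elim_comp_map]
      exact p.realize_sol 0)
    rwa [Sum.elim_comp_map] at h1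
  have hfo : IsFirstOrder L.withPredicate fun (M : Type (max u v)) _ (z : Fin m ⊕ Fin m → M) =>
      ∃ x : Fin n → M, φ.Realize (Sum.elim x fun k => z (Sum.inl k)) ∧
        φ.Realize (Sum.elim x fun k => z (Sum.inr k)) :=
    .exists_tuple (.and
      (.of_formula φ (Sum.elim Sum.inr fun k => Sum.inl (Sum.inl k))
        fun M x b => by rcases b with b | b <;> rfl)
      (.of_formula φ (Sum.elim Sum.inr fun k => Sum.inl (Sum.inr k))
        fun M x b => by rcases b with b | b <;> rfl))
  exact p.inconsistent ((hfo.transfer ((Ultrapower.diag L.withPredicate U (M := M)).sameType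
    (Sum.elim (p.entry 0 0 ∘ p.param) (p.entry 0 1 ∘ p.param)))).2 ⟨c, hφ 0, hφ 1⟩)

end Model

/-- Some formula that has `TP₂` modulo `T_{P,S}` forces its solutions to be algebraic over the
parameters and `d` of their coordinates. -/
def HasTP2OfDimension (T : L.Theory) (S : L.Formula (Fin 1)) (d : ℕ) : Prop :=
  ∃ (n m : ℕ) (φ : L.withPredicate.Formula (Fin n ⊕ Fin m)) (J : Finset (Fin n)), J.card = d ∧
    (∀ (M : Type (max u v)) [L.Structure M] [L.withPredicate.Structure M]
      [(LHom.sumInl : L →ᴸ L.withPredicate).IsExpansionOn M] (x : Fin n → M) (y : Fin m → M),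
      φ.Realize (Sum.elim x y) → ∀ j, x j ∈ acl L (x '' J ∪ Set.range y)) ∧
    (T.genericPredicate S).HasTP2 φ

/-- The algebraic dependence uses finitely many entries of column `0`. Add them to the parameters
and the dependence to `φ`: the coordinate `j` leaves the basis, and the rows beyond those entries
still give `TP₂`. -/
theorem hasTP2OfDimension_of_mem_acl {d : ℕ}
    (M : Theory.ModelType.{u, v, max u v} (T.genericPredicate S))
    [L.Structure M] [(LHom.sumInl : L →ᴸ L.withPredicate).IsExpansionOn M]
    {ι : Type (max u v)} {n m : ℕ} {φ : L.withPredicate.Formula (Fin n ⊕ Fin m)}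
    (p : PathArray M φ ι) {J : Finset (Fin n)} (hJ : J.card = d + 1)
    (hφ : ∀ (M : Type (max u v)) [L.Structure M] [L.withPredicate.Structure M]
      [(LHom.sumInl : L →ᴸ L.withPredicate).IsExpansionOn M] (x : Fin n → M) (y : Fin m → M),
      φ.Realize (Sum.elim x y) → ∀ j, x j ∈ acl L (x '' J ∪ Set.range y))
    {j : Fin n} (hj : j ∈ J)
    (hacl : p.sol j ∈ acl L ((Set.range fun q : ℕ × ι => p.entry q.1 0 q.2) ∪
      p.sol '' (J.erase j))) : HasTP2OfDimension T S d := by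
  classical
  let E := {i // i ∈ J.erase j}
  have hrange : (Set.range fun q : ℕ × ι => p.entry q.1 0 q.2) ∪ p.sol '' (J.erase j) =
      Set.range (Sum.elim (fun q : ℕ × ι => p.entry q.1 0 q.2) fun i : E => p.sol i) := by
    rw [Set.Sum.elim_range]
    congr 1
    ext z
    simp [E, and_comm]
  rw [hrange] at hacl
  obtain ⟨δ, k, hk, hδ⟩ := mem_acl_range.1 hacl
  obtain ⟨s, δ', hδ'⟩ := (δ.relabel (Equiv.sumAssoc (ℕ × ι) E Unit)).exists_finite_support_left
  have hδδ : ∀ z, δ.Realize (Sum.elim (Sum.elim (fun q : ℕ × ι => p.entry q.1 0 q.2)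
      fun i : E => p.sol i) fun _ => z) ↔ δ'.Realize (Sum.elim (fun q : s => p.entry q.1.1 0 q.1.2)
        (Sum.elim (fun i : E => p.sol i) fun _ : Unit => z)) := fun z => by
    rw [← hδ' M (fun q : ℕ × ι => p.entry q.1 0 q.2)
      (Sum.elim (fun i : E => p.sol i) fun _ : Unit => z), Formula.realize_relabel]
    refine iff_of_eq (congrArg _ (funext fun i => ?_))
    rcases i with (i | i) | i <;> rfl
  simp only [hδδ] at hk hδ
  let Q : ∀ (M : Type (max u v)) [L.withPredicate.Structure M], (Fin n → M) → (s → M) → M → Prop :=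
    fun M _ x e z => δ'.toWithPredicate.Realize
      (Sum.elim e (Sum.elim (fun i : E => x i) fun _ : Unit => z))
  have hQ : ∀ {γ : Type (max u v)} (f : Fin n → γ) (g : s → γ) (r : γ),
      IsFirstOrder L.withPredicate fun (M : Type (max u v)) _ (y : γ → M) =>
        Q M (fun i => y (f i)) (fun i => y (g i)) (y r) := fun f g r =>
    .of_formula δ'.toWithPredicate (Sum.elim g (Sum.elim (fun i => f i) fun _ => r))
      fun M x b => by rcases b with b | b | b <;> rfl
  -- Including the bound on the number of solutions forces algebraicity for every realization of
  -- `ψ`, not just for `p.sol`.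
  obtain ⟨ψ, hψ⟩ : IsFirstOrder L.withPredicate
      fun (M : Type (max u v)) _ (z : Fin n ⊕ (Fin m ⊕ s) → M) =>
        φ.Realize (Sum.elim (fun i => z (Sum.inl i)) fun i => z (Sum.inr (Sum.inl i))) ∧
          Q M (fun i => z (Sum.inl i)) (fun i => z (Sum.inr (Sum.inr i))) (z (Sum.inl j)) ∧
            AtMost k (Q M (fun i => z (Sum.inl i)) fun i => z (Sum.inr (Sum.inr i))) :=
    .and (.of_formula φ (Sum.map id Sum.inl) fun M x b => by rcases b with b | b <;> rfl)
      (.and (hQ _ _ _) (.atMost k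
        (hQ (fun i => Sum.inl (Sum.inl i)) (fun i => Sum.inl (Sum.inr (Sum.inr i))) (Sum.inr ()))))
  obtain ⟨R, hR⟩ : ∃ R, ∀ q ∈ s, q.1 < R :=
    ⟨s.sup Prod.fst + 1, fun q hq => Nat.lt_succ_of_le (Finset.le_sup (f := Prod.fst) hq)⟩
  obtain ⟨m', ⟨e⟩⟩ := Finite.exists_equiv_fin (Fin m ⊕ s)
  refine ⟨n, m', ψ.relabel (Sum.map (_root_.Equiv.refl _) e), J.erase j, ?_, ?_, ?_⟩
  · rw [Finset.card_erase_of_mem hj, hJ, Nat.add_sub_cancel]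
  · intro M' _ _ _ x y hxy
    rw [Formula.realize_relabel, hψ] at hxy
    obtain ⟨h1, h2, h3⟩ := hxy
    have hsub : x '' J ∪ Set.range (fun i => y (e (Sum.inl i))) ⊆
        acl L (x '' (J.erase j) ∪ Set.range y) := by
      rintro _ (⟨i, hi, rfl⟩ | ⟨i, rfl⟩)
      · by_cases hij : i = j
        · subst hij
          have h4 : x i ∈ acl L (Set.range
              (Sum.elim (fun q : s => y (e (Sum.inr q))) fun i : E => x i)) := by
            refine mem_acl_range.2 ⟨δ'.relabel (Equiv.sumAssoc s E Unit).symm, k, ?_, ?_⟩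
            · intro w hw
              refine h3 w fun l => ?_
              have := Formula.realize_relabel.1 (hw l)
              refine (realize_toWithPredicate δ' _).2 ?_
              convert this using 1
              funext b
              rcases b with b | b | b <;> rfl
            · rw [Formula.realize_relabel]
              have := (realize_toWithPredicate δ' _).1 h2
              convert this using 1
              funext b
              rcases b with b | b | b <;> rfl
          refine acl_mono ?_ h4
          rintro _ ⟨q | q, rfl⟩
          · exact Or.inr ⟨_, rfl⟩
          · exact Or.inl ⟨q, q.2, rfl⟩
        · exact subset_acl _ (Or.inl ⟨i, Finset.mem_erase.2 ⟨hij, hi⟩, rfl⟩)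
      · exact subset_acl _ (Or.inr ⟨_, rfl⟩)
    exact fun i => acl_subset_of_subset_acl hsub (hφ M' x _ h1 i)
  · refine Theory.hasTP2_of_finite_paths M (_root_.Equiv.refl _) e ψ (fun α i => Sum.elim
      (p.entry (R + α) i ∘ p.param) fun q : s => p.entry q.1.1 0 q.1.2) ?_ ?_
    · rintro α i i' hii ⟨b, hb, hb'⟩
      exact p.inconsistent_of_ne (R + α) hii ⟨b, ((hψ M _).1 hb).1, ((hψ M _).1 hb').1⟩
    · intro f N
      have hfo : IsFirstOrder L.withPredicate
          fun (M : Type (max u v)) _ (z : Fin (R + N) × ℕ × ι → M) => ∃ x : Fin n → M,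
            ∀ α : Fin N, ψ.Realize (Sum.elim x (Sum.elim
              (fun i => z (Fin.natAdd R α, 0, p.param i))
              fun q : s => z (⟨q.1.1, Nat.lt_add_right N (hR _ q.2)⟩, 0, q.1.2))) :=
        .exists_tuple (.forall_finite fun α => .of_formula ψ (Sum.elim Sum.inr (Sum.elim
          (fun i => Sum.inl (Fin.natAdd R α, 0, p.param i))
          fun q : s => Sum.inl (⟨q.1.1, Nat.lt_add_right N (hR _ q.2)⟩, 0, q.1.2)))
          fun M x b => by rcases b with b | b | b <;> rfl)
      -- The rows below `R` hold the added parameters and stay fixed; only the later rows are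
      -- shifted along `f`.
      obtain ⟨x, hx⟩ := (hfo.transfer (p.indiscernible (N := R + N) (ρ := Fin.val)
        (ρ' := Fin.val) (s := fun _ => id)
        (s' := fun β i => (if β < R then 0 else f (β - R)) + i) Fin.val_strictMono
        Fin.val_strictMono (fun _ => strictMono_id)
        fun β i i' hii => Nat.add_lt_add_left hii _)).1 ⟨p.sol, fun α => (hψ M _).2
          ⟨p.realize_sol (R + α), (realize_toWithPredicate δ' _).2 hδ,
            fun w hw => hk w fun l => (realize_toWithPredicate δ' _).1 (hw l)⟩⟩
      refine ⟨x, fun α hα => ?_⟩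
      convert hx ⟨α, hα⟩ using 1
      funext b
      rcases b with b | b | b
      · rfl
      · simp
      · simp [hR _ b.2]

end MinimalDimension

/-! ### Exchange and descent on dimension -/

section MinimalDimension

variable {L : Language.{u, v}} {T : L.Theory} {S : L.Formula (Fin 1)}

/-- Suppose `z` violates independence. Adjoin the basis coordinates of the solution one at a time:
when `z` first becomes algebraic over the entry, exchange makes the last coordinate algebraic over
`z` and the earlier ones. As `z` is algebraic over the column, the dimension drops. -/
theorem independentPath_of_minimal (hT : T.AclExchange)
    (M : Theory.ModelType.{u, v, max u v} (T.genericPredicate S))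
    [L.Structure M] [(LHom.sumInl : L →ᴸ L.withPredicate).IsExpansionOn M]
    {ι : Type (max u v)} {n m : ℕ} {φ : L.withPredicate.Formula (Fin n ⊕ Fin m)}
    (p : PathArray M φ ι) {J : Finset (Fin n)}
    (hφ : ∀ (M : Type (max u v)) [L.Structure M] [L.withPredicate.Structure M]
      [(LHom.sumInl : L →ᴸ L.withPredicate).IsExpansionOn M] (x : Fin n → M) (y : Fin m → M),
      φ.Realize (Sum.elim x y) → ∀ j, x j ∈ acl L (x '' J ∪ Set.range y))
    (hmin : ∀ d, d < J.card → ¬ HasTP2OfDimension T S d) :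
    IndependentPath L p.entry p.sol where
  indiscernible := p.isIndiscernibleArray
  sameType_row β γ := (p.sameType_row β γ).of_withPredicate
  notMem_acl β z hz hzβ hzA := by
    classical
    have hMT : M ⊨ T := Theory.model_of_model_genericPredicate (S := S) inferInstance
    have hβA : Set.range (p.entry β 0) ⊆ Set.range fun q : ℕ × ι => p.entry q.1 0 q.2 := by
      rintro _ ⟨i, rfl⟩
      exact ⟨(β, i), rfl⟩
    have hnot : ∀ B : Finset (Fin n), B ⊆ J →
        z ∉ acl L (p.sol '' B ∪ Set.range (p.entry β 0)) := by
      intro B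
      induction B using Finset.induction_on with
      | empty =>
        intro _ h
        rw [Finset.coe_empty, Set.image_empty, Set.empty_union] at h
        exact hzβ (p.acl_range_entry_subset β 0 h)
      | insert j B hjB ih =>
        intro hBJ h
        rw [Finset.coe_insert, Set.image_insert_eq, Set.insert_union] at h
        have hj : j ∈ J := hBJ (Finset.mem_insert_self j B)
        have hex : p.sol j ∈ acl L (insert z (p.sol '' B ∪ Set.range (p.entry β 0))) :=
          hT (Theory.ModelType.of T M) _ z (p.sol j) h (ih ((Finset.subset_insert j B).trans hBJ))
        obtain ⟨d, hd⟩ : ∃ d, J.card = d + 1 :=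
          Nat.exists_eq_add_one.2 (Finset.card_pos.2 ⟨j, hj⟩)
        refine hmin d (by omega) (hasTP2OfDimension_of_mem_acl M p hd hφ hj
          (acl_subset_of_subset_acl ?_ hex))
        refine Set.insert_subset (acl_mono Set.subset_union_left hzA) (Set.union_subset ?_ ?_)
        · rintro _ ⟨i, hi, rfl⟩
          refine subset_acl _ (Or.inr ⟨i, Finset.mem_erase.2 ⟨?_, ?_⟩, rfl⟩)
          · rintro rfl
            exact hjB hi
          · exact hBJ (Finset.mem_insert_of_mem hi)
        · exact fun a ha => subset_acl _ (Or.inl (hβA ha))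
    refine hnot J subset_rfl (acl_subset_of_subset_acl ?_ hz)
    rintro _ ⟨i | i, rfl⟩
    · exact acl_mono (Set.union_subset_union_right _ (Set.range_comp_subset_range _ _))
        (hφ M p.sol _ (p.realize_sol β) i)
    · exact subset_acl _ (Or.inr ⟨i, rfl⟩)

theorem Theory.IsGeometric.not_hasTP2OfDimension (hT : T.IsGeometric) (hT' : T.IsNTP2) (d : ℕ) :
    ¬ HasTP2OfDimension T S d := by
  induction d using Nat.strong_induction_on with
  | _ d ih =>
    rintro ⟨n, m, φ, J, rfl, hφ, hTP⟩
    obtain ⟨M, ι, ⟨p⟩⟩ := hTP.exists_pathArray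
    let := (LHom.sumInl : L →ᴸ L.withPredicate).reduct M
    have : (LHom.sumInl : L →ᴸ L.withPredicate).IsExpansionOn M := LHom.isExpansionOn_reduct _ M
    exact p.not_independentPath hT.eliminatesExistsInfty hT' (S := S) inferInstance
      (independentPath_of_minimal hT.exchange M p hφ ih)

end MinimalDimension

end FirstOrder.Language

theorem mainTheorem8 {L : FirstOrder.Language.{u, v}} (T : L.Theory) (hgeom : T.IsGeometric)
    (hNTP2 : T.IsNTP2) (S : L.Formula (Fin 1)) : (T.genericPredicate S).IsNTP2 := by
  intro n m φ hφ
  -- Every formula has dimension at most its number of variables, with all coordinates as the basis.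
  refine hgeom.not_hasTP2OfDimension hNTP2 n
    ⟨n, m, φ, Finset.univ, by simp, fun M _ _ _ x y _ j => ?_, hφ⟩
  exact FirstOrder.Language.subset_acl _ (Or.inl ⟨j, by simp, rfl⟩)
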